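/- Let $X$ be a metric space, $B(x,r)$ its open balls. Say that $S\subset X$ is *locally (path)connected* at $x\in S$ if for every $r>0$ there is a (path)connected, relatively open $G\subset S\cap B(x,r)$ with $x\in G$, and *(path)connected im kleinen* at $x$ if for every $r>0$ there is a (path)connected $A\subset S\cap B(x,r)$ whose interior relative to $S$ contains $x$. For $\Omega\subset X$ open and $x_0\in\partial\Omega$: - $\Omega$ is *finitely connected* at $x_0$ if for every $r>0$ there is an open $G$ with $x_0\in G\subset B(x_0,r)$ such that $G\cap\Omega$ has only finitely many components; it is *locally connected* at $x_0$ if for every $r>0$ there is such a $G$ for which $G\cap\Omega$ has at most one component. - $x_0$ is *locally accessible* from $\Omega$ if for every $r>0$ there is $\delta>0$ such that every $x\in B(x_0,\delta)\cap\Omega$ can be joined to $x_0$ by a curve $\gamma:[0,1]\to X$ with $\gamma(0)=x$, $\gamma(1)=x_0$ and $\gamma([0,1))\subset B(x_0,r)\cap\Omega$. - $H(r)$ is the union of those components of $B(x_0,r)\cap\Omega$ whose closure does not contain $x_0$. **Theorem.** Let $X$ be a proper locally connected metric space, $\Omega\subset X$ open and $x_0\in\partial\Omega$. Consider the statements - (a)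 $x_0$ is locally accessible from $\Omega$; - (b1)–(b4) $\Omega\cup\{x_0\}$ is, at $x_0$, respectively: locally pathconnected (b1), locally connected (b2), pathconnected im kleinen (b3), connected im kleinen (b4); - (c) $x_0\notin\overline{H(r)}$ for all $r>0$; - (d) $\Omega$ is finitely connected at $x_0$; - (e) $\Omega$ is locally connected at $x_0$; - (f1)–(f4) $\partial\Omega$ is, at $x_0$, respectively: locally pathconnected, locally connected, pathconnected im kleinen, connected im kleinen; - (g1)–(g4) $X\setminus\Omega$ is, at $x_0$, respectively: locally pathconnected, locally connected, pathconnected im kleinen, connected im kleinen. Then $$(e)\Rightarrow(d)\Rightarrow(c)\Leftrightarrow(b1)\Leftrightarrow(b2)\Leftrightarrow(b3)\Leftrightarrow(b4)\Leftrightarrow(a),$$ $$(f1)\Rightarrow(f2)\Rightarrow(f4),\quad (f1)\Rightarrow(f3)\Rightarrow(f4),\quad (g1)\Rightarrow(g2)\Rightarrow(g4),\quad (g1)\Rightarrow(g3)\Rightarrow(g4),$$ and $(fi)\Rightarrow(gi)$ for $i=1,2,3,4$. No other implication is true, even for bounded simply connected planar domains: whenever $P$ and $Q$ are two of these sixteen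 statements such that $P\Rightarrow Q$ is not obtained by composing the implications above, there are a bounded simply connected open set $\Omega\subset\mathbf{R}^2$ and a point $x_0\in\partial\Omega$ for which $P$ holds and $Q$ fails. -/

import Mathlib

open Set Metric Topology

namespace BoundaryConnectivity

section Notions

variable {X : Type*} [MetricSpace X]

/-- The subspace `S` is locally connected at its point `x`: every ball around `x` contains a
relatively open connected neighbourhood `G ∩ S` of `x`. -/
def LocallyConnectedAt (S : Set X) (x : X) : Prop :=
  ∀ r : ℝ, 0 < r → ∃ G : Set X, IsOpen G ∧ x ∈ G ∧ G ∩ S ⊆ ball x r ∧ IsConnected (G ∩ S)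

/-- The subspace `S` is locally pathconnected at its point `x`. -/
def LocallyPathConnectedAt (S : Set X) (x : X) : Prop :=
  ∀ r : ℝ, 0 < r → ∃ G : Set X, IsOpen G ∧ x ∈ G ∧ G ∩ S ⊆ ball x r ∧ IsPathConnected (G ∩ S)

/-- The subspace `S` is connected im kleinen at its point `x`: every ball around `x` contains a
connected set `A ⊆ S` whose interior relative to `S` contains `x`. -/
def ConnectedImKleinenAt (S : Set X) (x : X) : Prop :=
  ∀ r : ℝ, 0 < r → ∃ A : Set X, A ⊆ S ∧ A ⊆ ball x r ∧ IsConnected A ∧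
    ∃ U : Set X, IsOpen U ∧ x ∈ U ∧ U ∩ S ⊆ A

/-- The subspace `S` is pathconnected im kleinen at its point `x`. -/
def PathConnectedImKleinenAt (S : Set X) (x : X) : Prop :=
  ∀ r : ℝ, 0 < r → ∃ A : Set X, A ⊆ S ∧ A ⊆ ball x r ∧ IsPathConnected A ∧
    ∃ U : Set X, IsOpen U ∧ x ∈ U ∧ U ∩ S ⊆ A

/-- The set of connected components of `S`. -/
def componentsOf (S : Set X) : Set (Set X) :=
  {C | ∃ y ∈ S, C = connectedComponentIn S y}

/-- `Ω` is finitely connected at the boundary point `x`. -/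
def FinitelyConnectedAt (Ω : Set X) (x : X) : Prop :=
  ∀ r : ℝ, 0 < r → ∃ G : Set X, IsOpen G ∧ x ∈ G ∧ G ⊆ ball x r ∧ (componentsOf (G ∩ Ω)).Finite

/-- `Ω` is `N`-connected at the boundary point `x`: `N` is the least positive integer such that
`x` has arbitrarily small open neighbourhoods `G` for which `G ∩ Ω` has at most `N` components. -/
def NConnectedAt (Ω : Set X) (x : X) (N : ℕ) : Prop :=
  IsLeast {n : ℕ | 0 < n ∧ ∀ r : ℝ, 0 < r → ∃ G : Set X, IsOpen G ∧ x ∈ G ∧ G ⊆ ball x r ∧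
    (componentsOf (G ∩ Ω)).encard ≤ n} N

/-- The set `H(r)`: the union of the components of `B(x, r) ∩ Ω` whose closure does not
contain `x`. -/
def remoteSet (Ω : Set X) (x : X) (r : ℝ) : Set X :=
  (ball x r ∩ Ω) \ ⋃₀ {C | C ∈ componentsOf (ball x r ∩ Ω) ∧ x ∈ closure C}

/-- The boundary point `x` is locally accessible from `Ω`. -/
def LocallyAccessible (Ω : Set X) (x : X) : Prop :=
  ∀ r : ℝ, 0 < r → ∃ δ : ℝ, 0 < δ ∧ ∀ y ∈ ball x δ ∩ Ω,
    ∃ γ : Path y x, ∀ t : unitInterval, t < 1 → γ t ∈ ball x r ∩ Ω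

end Notions

/-- Labels for the sixteen statements about an open set `Ω` and a point `x₀ ∈ ∂Ω`. -/
inductive Label : Type
  | a | b1 | b2 | b3 | b4 | c | d | e | f1 | f2 | f3 | f4 | g1 | g2 | g3 | g4

/-- The statement with a given label. -/
def Holds {X : Type*} [MetricSpace X] (Ω : Set X) (x₀ : X) : Label → Prop
  | .a => LocallyAccessible Ω x₀
  | .b1 => LocallyPathConnectedAt (Ω ∪ {x₀}) x₀
  | .b2 => LocallyConnectedAt (Ω ∪ {x₀}) x₀
  | .b3 => PathConnectedImKleinenAt (Ω ∪ {x₀}) x₀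
  | .b4 => ConnectedImKleinenAt (Ω ∪ {x₀}) x₀
  | .c => ∀ r : ℝ, 0 < r → x₀ ∉ closure (remoteSet Ω x₀ r)
  | .d => FinitelyConnectedAt Ω x₀
  | .e => NConnectedAt Ω x₀ 1
  | .f1 => LocallyPathConnectedAt (frontier Ω) x₀
  | .f2 => LocallyConnectedAt (frontier Ω) x₀
  | .f3 => PathConnectedImKleinenAt (frontier Ω) x₀
  | .f4 => ConnectedImKleinenAt (frontier Ω) x₀
  | .g1 => LocallyPathConnectedAt Ωᶜ x₀
  | .g2 => LocallyConnectedAt Ωᶜ x₀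
  | .g3 => PathConnectedImKleinenAt Ωᶜ x₀
  | .g4 => ConnectedImKleinenAt Ωᶜ x₀

/-- The arrows of the two implication diagrams
`e ⟹ d ⟹ c ⟺ b1 ⟺ b2 ⟺ b3 ⟺ b4 ⟺ a` and the cube-like diagram on `f1, …, f4, g1, …, g4`. -/
inductive Arrow : Label → Label → Prop
  | e_d : Arrow .e .d
  | d_c : Arrow .d .c
  | c_b1 : Arrow .c .b1
  | b1_c : Arrow .b1 .c
  | b1_b2 : Arrow .b1 .b2
  | b2_b1 : Arrow .b2 .b1
  | b2_b3 : Arrow .b2 .b3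
  | b3_b2 : Arrow .b3 .b2
  | b3_b4 : Arrow .b3 .b4
  | b4_b3 : Arrow .b4 .b3
  | b4_a : Arrow .b4 .a
  | a_b4 : Arrow .a .b4
  | f1_f2 : Arrow .f1 .f2
  | f1_f3 : Arrow .f1 .f3
  | f2_f4 : Arrow .f2 .f4
  | f3_f4 : Arrow .f3 .f4
  | g1_g2 : Arrow .g1 .g2
  | g1_g3 : Arrow .g1 .g3
  | g2_g4 : Arrow .g2 .g4
  | g3_g4 : Arrow .g3 .g4
  | f1_g1 : Arrow .f1 .g1
  | f2_g2 : Arrow .f2 .g2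
  | f3_g3 : Arrow .f3 .g3
  | f4_g4 : Arrow .f4 .g4

end BoundaryConnectivity

/-! The only deep implication is that connectedness of Ω ∪ {x₀} at x₀ upgrades to pathconnectedness.
It rests on the Mazurkiewicz–Moore–Menger theorem for a locally connected G_δ set S in a complete
space (`locallyPathConnectedAt_of_locallyConnectedAt`). Two points are joined by a finite chain of
small connected pieces of S, each piece is subdivided by a finer chain, and the nested pieces over a
parameter shrink to a point of a curve. Writing S = ⋂ O n and keeping the closures of the level n
pieces in O n forces the limits into S. Here Ω ∪ {x₀} is the intersection of the open sets Ω ∪ B(x₀,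
1/(n+1)), and it is locally connected away from x₀ because X is.

The rest of the first diagram is the cycle b4 ⇒ c ⇒ b1. A component of B(x₀, r) ∩ Ω whose closure
misses x₀ is clopen relative to any subset of Ω ∪ {x₀} inside the ball. Conversely, if such
components do not accumulate at x₀, the remaining ones together with x₀ form a relatively open
connected set. Finite connectedness gives (c), since a finite union of closures is closed.

For f ⇒ g, a path from a point of the complement to ∂Ω, cut at its first hit of ∂Ω, never enters Ω
(`exists_joinedIn_frontier`). So a neighbourhood in the complement can be attached by paths to one
in the frontier.

For the converse part, `exists_separating_pair` reduces all missing implications to seven. These are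
refuted by a comb with thin teeth (f1 without a, e without g4, d without e), a comb with thick teeth
(g1 without f4), a fan of slits (a without d), a chain of topologist's sine curves (f2 without g3)
and a sequence of brooms (f3 without g2). Each domain is contractible by an explicit deformation
that moves points along the removed pieces or away from them. -/

namespace BoundaryConnectivity

/-! ### Locally connected G_δ sets in complete spaces are locally pathconnected -/

section PathConstruction

variable {X : Type*} [MetricSpace X]

/-- A link of level `n`: a relatively open connected piece of `S` of diameter at most `2⁻ⁿ`
whose closure lies in the `n`-th member of the family `O`. -/
structure IsLink (S : Set X) (O : ℕ → Set X) (n : ℕ) (W : Set X) : Prop where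
  preconnected : IsPreconnected W
  relOpen : ∃ G, IsOpen G ∧ W = G ∩ S
  closure_subset : closure W ⊆ O n
  dist_le : ∀ x ∈ W, ∀ y ∈ W, dist x y ≤ (1 / 2 : ℝ) ^ n

theorem exists_isLink {S : Set X} {O : ℕ → Set X} (hO : ∀ n, IsOpen (O n)) (hS : S ⊆ ⋂ n, O n)
    (hL : ∀ p ∈ S, LocallyConnectedAt S p) (n : ℕ) {p : X} (hp : p ∈ S) {G : Set X}
    (hG : IsOpen G) (hpG : p ∈ G) : ∃ W, IsLink S O n W ∧ p ∈ W ∧ W ⊆ G := by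
  have hpO : p ∈ O n := mem_iInter.1 (hS hp) n
  obtain ⟨r, hr, hrG⟩ := Metric.isOpen_iff.1 (hG.inter (hO n)) p ⟨hpG, hpO⟩
  obtain ⟨ε, hε, hεr⟩ : ∃ ε : ℝ, 0 < ε ∧ ε ≤ r / 2 ∧ ε ≤ (1 / 2 : ℝ) ^ n / 2 :=
    ⟨min (r / 2) ((1 / 2 : ℝ) ^ n / 2), by positivity, min_le_left _ _, min_le_right _ _⟩
  obtain ⟨U, hU, hpU, hUb, hUc⟩ := hL p hp ε hε
  refine ⟨U ∩ S, ⟨hUc.isPreconnected, ⟨U, hU, rfl⟩, ?_, ?_⟩, ⟨hpU, hp⟩, ?_⟩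
  · intro x hx
    have h1 := closure_mono hUb hx
    have h2 : x ∈ closedBall p ε := closure_ball_subset_closedBall h1
    exact (hrG (closedBall_subset_ball (by linarith) h2)).2
  · intro x hx y hy
    have h1 := mem_ball.1 (hUb hx)
    have h2 := mem_ball.1 (hUb hy)
    have := dist_triangle_right x y p
    linarith
  · intro x hx
    exact (hrG (ball_subset_ball (by linarith) (hUb hx))).1

/-- A chain of links of level `n` running from `p` to `q`, constant from the index `m` on. -/
structure IsLinkChain (S : Set X) (O : ℕ → Set X) (n : ℕ) (p q : X) (m : ℕ) (c : ℕ → X)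
    (V : ℕ → Set X) : Prop where
  zero : c 0 = p
  eventually : ∀ i, m ≤ i → c i = q
  link : ∀ i, IsLink S O n (V i)
  left_mem : ∀ i, c i ∈ V i
  right_mem : ∀ i, c (i + 1) ∈ V i

theorem IsLinkChain.mono {S : Set X} {O : ℕ → Set X} {n : ℕ} {p q : X} {m m' : ℕ} {c : ℕ → X}
    {V : ℕ → Set X} (h : IsLinkChain S O n p q m c V) (hm : m ≤ m') : IsLinkChain S O n p q m' c V :=
  ⟨h.zero, fun i hi => h.eventually i (hm.trans hi), h.link, h.left_mem, h.right_mem⟩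

/-- Being linked by a finite chain inside V is transitive and holds between nearby points, because
links are relatively open; so connectedness of V links all its points. -/
theorem exists_chain {S : Set X} {O : ℕ → Set X} (hO : ∀ n, IsOpen (O n)) (hS : S ⊆ ⋂ n, O n)
    (hL : ∀ p ∈ S, LocallyConnectedAt S p) (n : ℕ) {V : Set X} (hV : IsPreconnected V)
    (hVo : ∃ G, IsOpen G ∧ V = G ∩ S) {p q : X} (hp : p ∈ V) (hq : q ∈ V) :
    ∃ m c W, IsLinkChain S O n p q m c W ∧ ∀ i, W i ⊆ V := by
  obtain ⟨G, hG, rfl⟩ := hVo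
  have key : Relation.ReflTransGen
      (fun x y => ∃ W, IsLink S O n W ∧ W ⊆ G ∩ S ∧ x ∈ W ∧ y ∈ W) p q := by
    refine hV.induction₂' _ ?_ (fun x y z _ _ _ => Relation.ReflTransGen.trans) hp hq
    intro x hx
    obtain ⟨W, hW, hxW, hWG⟩ := exists_isLink hO hS hL n hx.2 hG hx.1
    obtain ⟨U, hU, rfl⟩ := hW.relOpen
    have : U ∈ 𝓝 x := hU.mem_nhds hxW.1
    filter_upwards [mem_nhdsWithin_of_mem_nhds this, self_mem_nhdsWithin] with y hy hy'
    exact ⟨.single ⟨_, hW, fun z hz => ⟨hWG hz, hz.2⟩, hxW, ⟨hy, hy'.2⟩⟩,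
      .single ⟨_, hW, fun z hz => ⟨hWG hz, hz.2⟩, ⟨hy, hy'.2⟩, hxW⟩⟩
  clear hp
  induction key using Relation.ReflTransGen.head_induction_on with
  | refl =>
    obtain ⟨W, hW, hqW, hWG⟩ := exists_isLink hO hS hL n hq.2 hG hq.1
    refine ⟨0, fun _ => q, fun _ => W, ⟨rfl, fun _ _ => rfl, fun _ => hW, fun _ => hqW,
      fun _ => hqW⟩, fun _ z hz => ⟨hWG hz, ?_⟩⟩
    obtain ⟨U, -, rfl⟩ := hW.relOpen
    exact hz.2
  | @head x y hxy _ ih =>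
    obtain ⟨W, hW, hWG, hx, hy⟩ := hxy
    obtain ⟨m, c, W', hc, hW'⟩ := ih
    refine ⟨m + 1, fun i => Nat.casesOn i x c, fun i => Nat.casesOn i W W',
      ⟨rfl, ?_, ?_, ?_, ?_⟩, ?_⟩
    · rintro (_ | i) hi
      · omega
      · exact hc.eventually i (by omega)
    · rintro (_ | i)
      exacts [hW, hc.link i]
    · rintro (_ | i)
      exacts [hx, hc.left_mem i]
    · rintro (_ | i)
      · change c 0 ∈ W
        rwa [hc.zero]
      · exact hc.right_mem i
    · rintro (_ | i)
      exacts [hWG, hW' i]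

/-- A link is again connected and relatively open, so a finer chain fits inside it. All subchains
are padded to one common length k; then the new link number i lies in the old link number i / k,
which makes the parametrizations of successive levels compatible. -/
theorem IsLinkChain.refine {S : Set X} {O : ℕ → Set X} (hO : ∀ n, IsOpen (O n)) (hS : S ⊆ ⋂ n, O n)
    (hL : ∀ p ∈ S, LocallyConnectedAt S p) {n : ℕ} {p q : X} {m : ℕ} {c : ℕ → X}
    {V : ℕ → Set X} (h : IsLinkChain S O n p q m c V) :
    ∃ k c' V', 0 < k ∧ IsLinkChain S O (n + 1) p q (m * k) c' V' ∧ ∀ i, V' i ⊆ V (i / k) := by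
  have hex : ∀ i, ∃ l d W, IsLinkChain S O (n + 1) (c i) (c (i + 1)) l d W ∧ (∀ j, W j ⊆ V i) ∧
      (m ≤ i → l = 0) := by
    intro i
    obtain ⟨l, d, W, hd, hW⟩ := exists_chain hO hS hL (n + 1) (h.link i).preconnected
      (h.link i).relOpen (h.left_mem i) (h.right_mem i)
    -- Past m the chain rests at q; a constant subchain of length 0 there leaves only finitely many
    -- positive lengths, so that a common bound k exists.
    by_cases hi : m ≤ i
    · refine ⟨0, fun _ => q, fun _ => W 0, ⟨(h.eventually i hi).symm,
        fun _ _ => (h.eventually (i + 1) (by omega)).symm, fun _ => hd.link 0, ?_, ?_⟩,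
        fun _ => hW 0, fun _ => rfl⟩
      all_goals
        intro _
        have := hd.left_mem 0
        rwa [hd.zero, h.eventually i hi] at this
    · exact ⟨l, d, W, hd, hW, fun h => absurd h hi⟩
  choose l d W hd hW hl using hex
  obtain ⟨k, hk0, hk⟩ : ∃ k, 0 < k ∧ ∀ i, l i ≤ k := by
    refine ⟨1 + ∑ i ∈ Finset.range m, l i, by omega, fun i => ?_⟩
    by_cases hi : m ≤ i
    · simp [hl i hi]
    · have := Finset.single_le_sum (f := l) (fun _ _ => Nat.zero_le _)
        (Finset.mem_range.2 (not_le.1 hi))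
      omega
  refine ⟨k, fun j => d (j / k) (j % k), fun j => W (j / k) (j % k), hk0, ⟨?_, ?_, ?_, ?_, ?_⟩,
    fun i => hW _ _⟩
  · simp [(hd 0).zero, h.zero]
  · intro i hi
    have h1 : m ≤ i / k := (Nat.le_div_iff_mul_le hk0).2 hi
    have := (hd (i / k)).eventually (i % k) (by rw [hl _ h1]; omega)
    simp only [this]
    exact h.eventually _ (by omega)
  · exact fun i => (hd _).link _
  · exact fun i => (hd _).left_mem _
  · intro i
    have h1 := (hd (i / k)).right_mem (i % k)
    have h2 := Nat.div_add_mod i k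
    have h3 := Nat.mod_lt i hk0
    rcases Nat.lt_or_ge (i % k + 1) k with h4 | h4
    · have e1 : (i + 1) / k = i / k := by
        rw [Nat.div_eq_iff hk0]
        constructor
        · rw [mul_comm]; omega
        · have : i + 1 = k * (i / k) + (i % k + 1) := by omega
          rw [this, mul_comm]; omega
      have e2 : (i + 1) % k = i % k + 1 := by
        have h5 := Nat.div_add_mod (i + 1) k
        rw [e1] at h5; omega
      simpa only [e1, e2] using h1
    -- At the end of a block the subchain, of length at most k, has arrived at the point where the
    -- next block starts.
    · have e0 : i % k + 1 = k := by omega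
      have e3 : i + 1 = k * (i / k + 1) := by rw [mul_add]; omega
      have e1 : (i + 1) / k = i / k + 1 := by rw [e3, Nat.mul_div_cancel_left _ hk0]
      have e2 : (i + 1) % k = 0 := by rw [e3, Nat.mul_mod_right]
      simp only [e1, e2]
      rw [(hd _).zero]
      rwa [e0, (hd _).eventually k (hk _)] at h1

/-- In a complete space, two points of a relatively open connected piece `V` of a locally
connected `G_δ` set `S` can be joined within `S ∩ closure V`. -/
theorem joinedIn_of_isPreconnected [CompleteSpace X] {S : Set X} {O : ℕ → Set X}
    (hO : ∀ n, IsOpen (O n)) (hS : S = ⋂ n, O n)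
    (hL : ∀ p ∈ S, LocallyConnectedAt S p) {V : Set X} (hV : IsPreconnected V)
    (hVo : ∃ G, IsOpen G ∧ V = G ∩ S) {p q : X} (hp : p ∈ V) (hq : q ∈ V) :
    JoinedIn (S ∩ closure V) p q := by
  obtain ⟨m₀, c₀, V₀, hc₀, hV₀⟩ := exists_chain hO hS.subset hL 0 hV hVo hp hq
  let D (n : ℕ) := {x : ℕ × (ℕ → X) × (ℕ → Set X) //
    IsLinkChain S O n p q x.1 x.2.1 x.2.2 ∧ 0 < x.1}
  have step : ∀ n (x : D n), ∃ y : D (n + 1), ∃ k, 0 < k ∧ y.1.1 = x.1.1 * k ∧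
      ∀ i, y.1.2.2 i ⊆ x.1.2.2 (i / k) := by
    rintro n ⟨⟨m, c, V⟩, hc, hm⟩
    obtain ⟨k, c', V', hk, hc', hV'⟩ := hc.refine hO hS.subset hL
    exact ⟨⟨⟨m * k, c', V'⟩, hc', Nat.mul_pos hm hk⟩, k, hk, rfl, hV'⟩
  choose next k hk hnext hsub using step
  -- The length `m₀ + 1` instead of `m₀` makes all M n positive, so that 1 / M n can serve as a
  -- modulus of continuity.
  let L : ∀ n, D n := fun n => Nat.rec
    ⟨⟨m₀ + 1, c₀, V₀⟩, hc₀.mono (Nat.le_succ _), Nat.succ_pos _⟩ (fun n x => next n x) n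
  let M : ℕ → ℕ := fun n => (L n).1.1
  let c : ℕ → ℕ → X := fun n => (L n).1.2.1
  let W : ℕ → ℕ → Set X := fun n => (L n).1.2.2
  have hc : ∀ n, IsLinkChain S O n p q (M n) (c n) (W n) := fun n => (L n).2.1
  have hM : ∀ n, 0 < M n := fun n => (L n).2.2
  -- The parameter t selects the link number ⌊t M n⌋ at level n. Since M (n+1) is M n times the
  -- refinement factor, the links selected by a fixed t are nested, and their diameters tend to 0.
  let Z : ℕ → ℝ → Set X := fun n t => W n ⌊t * M n⌋₊
  let f : ℕ → ℝ → X := fun n t => c n ⌊t * M n⌋₊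
  have hfZ : ∀ n t, f n t ∈ Z n t := fun n t => (hc n).left_mem _
  have hZs : ∀ n t, Z (n + 1) t ⊆ Z n t := by
    intro n t
    have h1 : M (n + 1) = M n * k n (L n) := hnext n (L n)
    have h2 := hsub n (L n) ⌊t * M (n + 1)⌋₊
    have h3 : ⌊t * M (n + 1)⌋₊ / k n (L n) = ⌊t * M n⌋₊ := by
      rw [← Nat.floor_div_natCast, h1]
      have : (k n (L n) : ℝ) ≠ 0 := by exact_mod_cast (hk n (L n)).ne'
      congr 1
      push_cast
      field_simp
    rw [h3] at h2
    exact h2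
  have hZmono : ∀ t, Antitone fun n => Z n t := fun t => antitone_nat_of_succ_le fun n => hZs n t
  have hmem : ∀ t n j, n ≤ j → f j t ∈ Z n t := fun t n j hnj => hZmono t hnj (hfZ j t)
  have hcau : ∀ t, CauchySeq fun n => f n t := by
    intro t
    refine cauchySeq_of_le_geometric (1 / 2) 1 (by norm_num) fun n => ?_
    rw [one_mul]
    exact ((hc n).link _).dist_le _ (hmem t n n le_rfl) _ (hmem t n (n + 1) (Nat.le_succ n))
  choose F hF using fun t => cauchySeq_tendsto_of_complete (hcau t)
  have hFcl : ∀ n t, F t ∈ closure (Z n t) := fun n t =>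
    mem_closure_of_tendsto (hF t) (Filter.eventually_atTop.2 ⟨n, fun j hj => hmem t n j hj⟩)
  have hFd : ∀ n t, dist (f n t) (F t) ≤ (1 / 2 : ℝ) ^ n := fun n t =>
    le_of_tendsto (tendsto_const_nhds.dist (hF t)) (Filter.eventually_atTop.2
      ⟨n, fun j hj => ((hc n).link _).dist_le _ (hmem t n n le_rfl) _ (hmem t n j hj)⟩)
  -- Parameters closer than 1 / M n select equal or consecutive links. One 2⁻ⁿ accounts for the
  -- chain points, two more for passing to the limits.
  have hclose : ∀ (n : ℕ) (s t : ℝ), 0 ≤ s → s ≤ t → (t - s) * M n < 1 →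
      dist (F s) (F t) ≤ 3 * (1 / 2 : ℝ) ^ n := by
    intro n s t hs hst h
    have h1 : ⌊s * M n⌋₊ ≤ ⌊t * M n⌋₊ := Nat.floor_mono (by gcongr)
    have h2 : ⌊t * M n⌋₊ ≤ ⌊s * M n⌋₊ + 1 := by
      have h0 : (0 : ℝ) ≤ s * M n := by positivity
      rw [← Nat.floor_add_one h0]
      exact Nat.floor_mono (by nlinarith)
    have h3 : dist (f n s) (f n t) ≤ (1 / 2 : ℝ) ^ n := by
      refine ((hc n).link ⌊s * M n⌋₊).dist_le _ (hfZ n s) _ ?_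
      have : ⌊t * M n⌋₊ = ⌊s * M n⌋₊ ∨ ⌊t * M n⌋₊ = ⌊s * M n⌋₊ + 1 := by omega
      rcases this with h | h
      · change c n _ ∈ _
        rw [h]; exact hfZ n s
      · change c n _ ∈ _
        rw [h]; exact (hc n).right_mem _
    have := dist_triangle4 (F s) (f n s) (f n t) (F t)
    have h4 := hFd n s
    have h5 := hFd n t
    rw [dist_comm] at h4
    linarith
  have hcont : ContinuousOn F unitInterval := by
    refine Metric.continuousOn_iff.2 fun t ht ε hε => ?_
    obtain ⟨n, hn⟩ := exists_pow_lt_of_lt_one (show (0 : ℝ) < ε / 3 by positivity)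
      (show (1 / 2 : ℝ) < 1 by norm_num)
    have hMn : (0 : ℝ) < M n := by exact_mod_cast hM n
    refine ⟨1 / M n, by positivity, fun s hs hst => ?_⟩
    rw [Real.dist_eq, lt_div_iff₀ hMn] at hst
    rcases le_total s t with h | h
    · rw [abs_of_nonpos (by linarith)] at hst
      have := hclose n s t hs.1 h (by linarith)
      linarith
    · rw [abs_of_nonneg (by linarith)] at hst
      have := hclose n t s ht.1 h hst
      rw [dist_comm]
      linarith
  have h0 : F 0 = p := by
    refine tendsto_nhds_unique (hF 0) ?_
    have : ∀ n, f n 0 = p := fun n => by simp [f, (hc n).zero]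
    simp only [this]
    exact tendsto_const_nhds
  have h1 : F 1 = q := by
    refine tendsto_nhds_unique (hF 1) ?_
    have : ∀ n, f n 1 = q := fun n => by simp [f, (hc n).eventually]
    simp only [this]
    exact tendsto_const_nhds
  have hFm : F '' unitInterval ⊆ S ∩ closure V := by
    rintro _ ⟨t, -, rfl⟩
    refine ⟨?_, closure_mono (hV₀ _) (hFcl 0 t)⟩
    -- The limit lies in the closure of a link of level n, hence in O n, for every n.
    rw [hS]
    exact mem_iInter.2 fun n => ((hc n).link _).closure_subset (hFcl n t)
  exact (JoinedIn.ofLine hcont h0 h1 hFm)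

/-- In a complete space, a locally connected `G_δ` set is locally pathconnected. -/
theorem locallyPathConnectedAt_of_locallyConnectedAt [CompleteSpace X] {S : Set X}
    {O : ℕ → Set X} (hO : ∀ n, IsOpen (O n)) (hS : S = ⋂ n, O n)
    (hL : ∀ p ∈ S, LocallyConnectedAt S p) {x : X} (hx : x ∈ S) :
    LocallyPathConnectedAt S x := by
  -- The joining path may leave G, so this is only pathconnectedness im kleinen. Because it holds at
  -- every point of S, it makes the path component of x in ball x r ∩ S relatively open.
  have key : ∀ p ∈ S, ∀ U : Set X, IsOpen U → p ∈ U →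
      ∃ G, IsOpen G ∧ p ∈ G ∧ ∀ q ∈ G ∩ S, JoinedIn (U ∩ S) p q := by
    intro p hp U hU hpU
    obtain ⟨r, hr, hrU⟩ := Metric.isOpen_iff.1 hU p hpU
    obtain ⟨G, hG, hpG, hGb, hGc⟩ := hL p hp (r / 2) (by positivity)
    refine ⟨G, hG, hpG, fun q hq => ?_⟩
    refine (joinedIn_of_isPreconnected hO hS hL hGc.isPreconnected ⟨G, hG, rfl⟩ ⟨hpG, hp⟩
      hq).mono fun z hz => ⟨hrU ?_, hz.1⟩
    exact closedBall_subset_ball (by linarith)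
      (closure_ball_subset_closedBall (closure_mono hGb hz.2))
  intro r hr
  set P := pathComponentIn (ball x r ∩ S) x
  have hxP : x ∈ P := mem_pathComponentIn_self ⟨mem_ball_self hr, hx⟩
  have hPs : P ⊆ ball x r ∩ S := pathComponentIn_subset
  have hex : ∀ p : P, ∃ G, IsOpen G ∧ (p : X) ∈ G ∧ ∀ q ∈ G ∩ S, JoinedIn (ball x r ∩ S) p q :=
    fun p => key p (hPs p.2).2 _ isOpen_ball (hPs p.2).1
  choose G hG hpG hGj using hex
  have hGP : (⋃ p, G p) ∩ S = P := by
    ext z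
    constructor
    · rintro ⟨hz, hzS⟩
      obtain ⟨p, hp⟩ := mem_iUnion.1 hz
      exact JoinedIn.trans p.2 (hGj p z ⟨hp, hzS⟩)
    · exact fun hz => ⟨mem_iUnion.2 ⟨⟨z, hz⟩, hpG _⟩, (hPs hz).2⟩
  refine ⟨⋃ p, G p, isOpen_iUnion hG, mem_iUnion.2 ⟨⟨x, hxP⟩, hpG _⟩, ?_, ?_⟩
  · rw [hGP]; exact fun z hz => (hPs hz).1
  · rw [hGP]
    exact isPathConnected_pathComponentIn ⟨mem_ball_self hr, hx⟩

end PathConstruction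

/-! ### The implications between the sixteen statements -/

section Implications

variable {X : Type*}

/-- The preimage of F is compact and has a least element t₀; the path is restricted to [0, t₀] and
rescaled. -/
theorem exists_path_first_hit [TopologicalSpace X] {F : Set X} (hF : IsClosed F) {z w : X}
    (γ : Path z w) (hz : z ∉ F) (hw : w ∈ F) :
    ∃ w' ∈ F, ∃ γ' : Path z w', (∀ t : unitInterval, t < 1 → γ' t ∉ F) ∧
      ∀ t, γ' t ∈ range γ := by
  have hne : (γ ⁻¹' F).Nonempty := ⟨1, by simpa using hw⟩
  obtain ⟨t₀, ht₀, hmin⟩ := (hF.preimage γ.continuous).isCompact.exists_isLeast hne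
  have ht₀0 : 0 < t₀ := by
    rw [unitInterval.pos_iff_ne_zero]
    rintro rfl
    exact hz (by simpa using ht₀)
  refine ⟨γ t₀, ht₀, ⟨⟨fun t => γ (t * t₀), by fun_prop⟩, by simp, by simp⟩, fun t ht htF => ?_,
    fun t => ⟨_, rfl⟩⟩
  have h1 : t₀ ≤ t * t₀ := hmin htF
  have h2 : (t : ℝ) < 1 := ht
  have h3 : (t₀ : ℝ) ≤ t * t₀ := h1
  have h4 : (0 : ℝ) < t₀ := ht₀0
  nlinarith

/-- Before its first hit of the frontier, a path starting in the exterior of Ω stays in the union of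
the disjoint open sets Ω and (closure Ω)ᶜ, hence in the latter. -/
theorem exists_joinedIn_frontier [TopologicalSpace X] {Ω U : Set X} (hΩ : IsOpen Ω)
    (hU : IsPathConnected U) {w z : X} (hw : w ∈ U ∩ frontier Ω) (hz : z ∈ U ∩ Ωᶜ) :
    ∃ w' ∈ U ∩ frontier Ω, JoinedIn (U ∩ Ωᶜ) z w' := by
  by_cases hzF : z ∈ frontier Ω
  · exact ⟨z, ⟨hz.1, hzF⟩, JoinedIn.refl hz⟩
  obtain ⟨γ, hγ⟩ := hU.joinedIn z hz.1 w hw.1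
  obtain ⟨w', hw', γ', hγ', hr⟩ := exists_path_first_hit isClosed_frontier γ hzF hw.2
  have hγU : ∀ t, γ' t ∈ U := fun t => by
    obtain ⟨s, hs⟩ := hr t
    rw [← hs]; exact hγ s
  refine ⟨w', ⟨by simpa using hγU 1, hw'⟩, γ', fun t => ⟨hγU t, fun htΩ => ?_⟩⟩
  rcases eq_or_lt_of_le (show t ≤ 1 from unitInterval.le_one t) with h | h
  · rw [h, γ'.target] at htΩ
    rw [hΩ.frontier_eq] at hw'
    exact hw'.2 htΩ
  · have hpre : IsPreconnected (γ' '' Iic t) := isPreconnected_Iic.image _ γ'.continuous.continuousOn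
    have hcov : γ' '' Iic t ⊆ Ω ∪ (closure Ω)ᶜ := by
      rintro _ ⟨s, hs, rfl⟩
      have := hγ' s (lt_of_le_of_lt hs h)
      rw [hΩ.frontier_eq] at this
      by_cases hsΩ : γ' s ∈ Ω
      · exact .inl hsΩ
      · exact .inr fun hc => this ⟨hc, hsΩ⟩
    have hz0 : z ∈ γ' '' Iic t := ⟨0, unitInterval.nonneg t, by simp⟩
    obtain ⟨y, -, hy, hy'⟩ := hpre Ω (closure Ω)ᶜ hΩ isClosed_closure.isOpen_compl hcov
      ⟨_, ⟨t, mem_Iic.2 le_rfl, rfl⟩, htΩ⟩ ⟨z, hz0, (hcov hz0).resolve_left hz.2⟩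
    exact hy' (subset_closure hy)

theorem isConnected_of_joinedIn [TopologicalSpace X] {A S : Set X} (hA : IsConnected A)
    (hAS : A ⊆ S) (h : ∀ z ∈ S, ∃ w ∈ A, JoinedIn S z w) : IsConnected S := by
  obtain ⟨x, hx⟩ := hA.nonempty
  refine ⟨⟨x, hAS hx⟩, isPreconnected_of_forall x fun z hz => ?_⟩
  obtain ⟨w, hw, hzw⟩ := h z hz
  exact ⟨A ∪ pathComponentIn S z, union_subset hAS pathComponentIn_subset, .inl hx,
    .inr (mem_pathComponentIn_self hz), hA.isPreconnected.union w hw hzw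
      (isPathConnected_pathComponentIn hz).isConnected.isPreconnected⟩

theorem isPathConnected_of_joinedIn [TopologicalSpace X] {A S : Set X} (hA : IsPathConnected A)
    (hAS : A ⊆ S) (h : ∀ z ∈ S, ∃ w ∈ A, JoinedIn S z w) : IsPathConnected S := by
  obtain ⟨x, hx⟩ := hA.nonempty
  refine ⟨x, hAS hx, fun {z} hz => ?_⟩
  obtain ⟨w, hw, hzw⟩ := h z hz
  exact ((hA.joinedIn x hx w hw).mono hAS).trans hzw.symm

variable [MetricSpace X]

theorem LocallyPathConnectedAt.locallyConnectedAt {S : Set X} {x : X}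
    (h : LocallyPathConnectedAt S x) : LocallyConnectedAt S x := fun r hr => by
  obtain ⟨G, h1, h2, h3, h4⟩ := h r hr
  exact ⟨G, h1, h2, h3, h4.isConnected⟩

theorem PathConnectedImKleinenAt.connectedImKleinenAt {S : Set X} {x : X}
    (h : PathConnectedImKleinenAt S x) : ConnectedImKleinenAt S x := fun r hr => by
  obtain ⟨A, h1, h2, h3, h4⟩ := h r hr
  exact ⟨A, h1, h2, h3.isConnected, h4⟩

theorem LocallyPathConnectedAt.pathConnectedImKleinenAt {S : Set X} {x : X}
    (h : LocallyPathConnectedAt S x) : PathConnectedImKleinenAt S x := fun r hr => by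
  obtain ⟨G, h1, h2, h3, h4⟩ := h r hr
  exact ⟨G ∩ S, inter_subset_right, h3, h4, G, h1, h2, subset_rfl⟩

theorem LocallyConnectedAt.connectedImKleinenAt {S : Set X} {x : X}
    (h : LocallyConnectedAt S x) : ConnectedImKleinenAt S x := fun r hr => by
  obtain ⟨G, h1, h2, h3, h4⟩ := h r hr
  exact ⟨G ∩ S, inter_subset_right, h3, h4, G, h1, h2, subset_rfl⟩

theorem NConnectedAt.finitelyConnectedAt {Ω : Set X} {x : X} {N : ℕ} (h : NConnectedAt Ω x N) :
    FinitelyConnectedAt Ω x := fun r hr => by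
  obtain ⟨G, h1, h2, h3, h4⟩ := h.1.2 r hr
  exact ⟨G, h1, h2, h3, finite_of_encard_le_coe h4⟩

/-- The finitely many components of G ∩ Ω whose closures miss x have a closed union of closures,
which can be removed from G. A point of Ω in what remains lies in a component of G ∩ Ω clinging to
x, and that component is contained in one of ball x r ∩ Ω. -/
theorem FinitelyConnectedAt.notMem_closure_remoteSet {Ω : Set X} {x : X}
    (h : FinitelyConnectedAt Ω x) {r : ℝ} (hr : 0 < r) : x ∉ closure (remoteSet Ω x r) := by
  obtain ⟨G, hG, hxG, hGr, hfin⟩ := h r hr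
  have hK : IsClosed (⋃ C ∈ {C | C ∈ componentsOf (G ∩ Ω) ∧ x ∉ closure C}, closure C) :=
    (hfin.subset fun C hC => hC.1).isClosed_biUnion fun _ _ => isClosed_closure
  intro hx
  have hV := hG.sdiff hK
  obtain ⟨y, ⟨hyG, hyK⟩, ⟨hyr, hyΩ⟩, hyC⟩ := mem_closure_iff.1 hx _ hV ⟨hxG, by simp⟩
  refine hyC ⟨_, ⟨⟨y, ⟨hyr, hyΩ⟩, rfl⟩, ?_⟩, mem_connectedComponentIn ⟨hyr, hyΩ⟩⟩
  by_contra hcon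
  refine hyK (mem_biUnion (x := connectedComponentIn (G ∩ Ω) y) ⟨⟨y, ⟨hyG, hyΩ⟩, rfl⟩, fun hc =>
    hcon ?_⟩ (subset_closure (mem_connectedComponentIn ⟨hyG, hyΩ⟩)))
  exact closure_mono (connectedComponentIn_mono y (inter_subset_inter_left _ hGr)) hc

/-- A component K of ball x r ∩ Ω is open, and relatively closed there. If x is not in its closure,
K remains clopen relative to the connected set A, which contains x, so K cannot meet A. -/
theorem ConnectedImKleinenAt.notMem_closure_remoteSet [LocallyConnectedSpace X] {Ω : Set X} {x : X}
    (hΩ : IsOpen Ω) (hxΩ : x ∉ Ω) (h : ConnectedImKleinenAt (Ω ∪ {x}) x) {r : ℝ} (hr : 0 < r) :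
    x ∉ closure (remoteSet Ω x r) := by
  obtain ⟨A, hAS, hAr, hA, U, hU, hxU, hUA⟩ := h r hr
  intro hx
  obtain ⟨y, hyU, hyr, hyC⟩ := mem_closure_iff.1 hx U hU hxU
  have hxA : x ∈ A := hUA ⟨hxU, .inr rfl⟩
  have hyA : y ∈ A := hUA ⟨hyU, .inl hyr.2⟩
  set K := connectedComponentIn (ball x r ∩ Ω) y
  have hKo : IsOpen K := (isOpen_ball.inter hΩ).connectedComponentIn
  have hKs : K ⊆ ball x r ∩ Ω := connectedComponentIn_subset _ _
  have hyK : y ∈ K := mem_connectedComponentIn hyr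
  have hxK : x ∉ closure K := fun hc => hyC ⟨K, ⟨⟨y, hyr, rfl⟩, hc⟩, hyK⟩
  have hcl : closure K ∩ A ⊆ K := by
    rintro z ⟨hz, hzA⟩
    rcases hAS hzA with hzΩ | rfl
    · have : IsPreconnected (insert z K) :=
        isPreconnected_connectedComponentIn.subset_closure (subset_insert _ _)
          (insert_subset hz subset_closure)
      have h2 : insert z K ⊆ ball x r ∩ Ω := insert_subset (mem_inter (hAr hzA) hzΩ) hKs
      exact this.subset_connectedComponentIn (mem_insert_of_mem _ hyK) h2 (mem_insert _ _)
    · exact absurd hz hxK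
  obtain ⟨z, hzA, hzK, hz⟩ := hA.isPreconnected K (closure K)ᶜ hKo isClosed_closure.isOpen_compl
    (fun z hz => by
      by_cases hzK : z ∈ closure K
      · exact .inl (hcl ⟨hzK, hz⟩)
      · exact .inr hzK) ⟨y, hyA, hyK⟩ ⟨x, hxA, hxK⟩
  exact hz (subset_closure hzK)

/-- The components whose closures contain x, joined together at x, form the required connected set.
It is relatively open because the other components stay away from x. -/
theorem locallyConnectedAt_of_notMem_closure_remoteSet [LocallyConnectedSpace X] {Ω : Set X} {x : X}
    (hΩ : IsOpen Ω) (h : ∀ r : ℝ, 0 < r → x ∉ closure (remoteSet Ω x r)) :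
    LocallyConnectedAt (Ω ∪ {x}) x := by
  intro r hr
  set 𝒞 := {C | C ∈ componentsOf (ball x r ∩ Ω) ∧ x ∈ closure C} with h𝒞
  have hCo : ∀ C ∈ 𝒞, IsOpen C := by
    rintro _ ⟨⟨y, -, rfl⟩, -⟩
    exact (isOpen_ball.inter hΩ).connectedComponentIn
  have hCs : ∀ C ∈ 𝒞, C ⊆ ball x r ∩ Ω := by
    rintro _ ⟨⟨y, -, rfl⟩, -⟩
    exact connectedComponentIn_subset _ _
  set G := ⋃₀ 𝒞 ∪ (ball x r \ closure (remoteSet Ω x r))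
  have hxG : x ∈ G := .inr ⟨mem_ball_self hr, h r hr⟩
  have hGS : G ∩ (Ω ∪ {x}) = ⋃₀ 𝒞 ∪ {x} := by
    ext z
    constructor
    · rintro ⟨hz | hz, hz' | hz'⟩
      · exact .inl hz
      · exact .inr hz'
      · by_contra hc
        exact hz.2 (subset_closure ⟨⟨hz.1, hz'⟩, fun hc' => hc (.inl hc')⟩)
      · exact .inr hz'
    · rintro (⟨C, hC, hz⟩ | hz)
      · exact ⟨.inl ⟨C, hC, hz⟩, .inl (hCs C hC hz).2⟩
      · exact ⟨by rw [mem_singleton_iff.1 hz]; exact hxG, .inr hz⟩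
  refine ⟨G, (isOpen_sUnion hCo).union (isOpen_ball.sdiff isClosed_closure), hxG, ?_, ?_⟩
  · rw [hGS]
    rintro z (⟨C, hC, hz⟩ | hz)
    · exact (hCs C hC hz).1
    · rw [mem_singleton_iff.1 hz]; exact mem_ball_self hr
  · rw [hGS]
    refine ⟨⟨x, .inr rfl⟩, isPreconnected_of_forall x ?_⟩
    rintro z (⟨C, hC, hz⟩ | hz)
    · refine ⟨insert x C, insert_subset (.inr rfl) fun w hw => .inl ⟨C, hC, hw⟩, mem_insert _ _,
        mem_insert_of_mem _ hz, ?_⟩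
      obtain ⟨⟨y, -, rfl⟩, hxC⟩ := hC
      exact isPreconnected_connectedComponentIn.subset_closure (subset_insert _ _)
          (insert_subset hxC subset_closure)
    · exact ⟨{x}, by simp, rfl, hz, isPreconnected_singleton⟩

theorem locallyConnectedAt_of_isOpen [LocallyConnectedSpace X] {Ω S : Set X} (hΩ : IsOpen Ω)
    (hΩS : Ω ⊆ S) {x : X} (hx : x ∈ Ω) : LocallyConnectedAt S x := by
  intro r hr
  have hsub := connectedComponentIn_subset (ball x r ∩ Ω) x
  have hG : connectedComponentIn (ball x r ∩ Ω) x ∩ S = connectedComponentIn (ball x r ∩ Ω) x :=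
    inter_eq_left.2 fun z hz => hΩS (hsub hz).2
  refine ⟨connectedComponentIn (ball x r ∩ Ω) x, (isOpen_ball.inter hΩ).connectedComponentIn,
    mem_connectedComponentIn ⟨mem_ball_self hr, hx⟩, ?_, ?_⟩
  · exact fun z hz => (hsub hz.1).1
  · rw [hG]
    exact isConnected_connectedComponentIn_iff.2 ⟨mem_ball_self hr, hx⟩

/-- The set Ω ∪ {x} is the intersection of the open sets Ω ∪ ball x (1 / (n + 1)) and is locally
connected at all its points, so the G_δ theorem applies. -/
theorem locallyPathConnectedAt_of_notMem_closure_remoteSet [CompleteSpace X]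
    [LocallyConnectedSpace X] {Ω : Set X} {x : X} (hΩ : IsOpen Ω)
    (h : ∀ r : ℝ, 0 < r → x ∉ closure (remoteSet Ω x r)) :
    LocallyPathConnectedAt (Ω ∪ {x}) x := by
  refine locallyPathConnectedAt_of_locallyConnectedAt
    (O := fun n : ℕ => Ω ∪ ball x (1 / (n + 1))) (fun n => hΩ.union isOpen_ball) ?_ ?_ (.inr rfl)
  · ext z
    simp only [mem_iInter, mem_union, mem_singleton_iff]
    constructor
    · rintro (hz | rfl) n
      · exact .inl hz
      · exact .inr (mem_ball_self (by positivity))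
    · intro hz
      by_contra! hc
      obtain ⟨n, hn⟩ := exists_nat_one_div_lt (dist_pos.2 hc.2)
      exact absurd (mem_ball.1 ((hz n).resolve_left hc.1)) (not_lt.2 hn.le)
  · rintro p (hp | rfl)
    · exact locallyConnectedAt_of_isOpen hΩ subset_union_left hp
    · exact locallyConnectedAt_of_notMem_closure_remoteSet hΩ h

/-- A path in Ω ∪ {x} towards x, cut at its first arrival at x, lies in Ω before its end. -/
theorem LocallyPathConnectedAt.locallyAccessible {Ω : Set X} {x : X} (hx : x ∉ Ω)
    (h : LocallyPathConnectedAt (Ω ∪ {x}) x) : LocallyAccessible Ω x := by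
  intro r hr
  obtain ⟨G, hG, hxG, hGr, hGc⟩ := h r hr
  obtain ⟨δ, hδ, hδG⟩ := Metric.isOpen_iff.1 hG x hxG
  refine ⟨δ, hδ, fun y hy => ?_⟩
  obtain ⟨γ, hγ⟩ := hGc.joinedIn y ⟨hδG hy.1, .inl hy.2⟩ x ⟨hxG, .inr rfl⟩
  obtain ⟨w, rfl, γ', hγ', hr'⟩ := exists_path_first_hit isClosed_singleton γ
    (fun hyx => hx (by rw [← mem_singleton_iff.1 hyx]; exact hy.2)) (mem_singleton x)
  refine ⟨γ', fun t ht => ?_⟩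
  obtain ⟨s, hs⟩ := hr' t
  have h1 := hγ s
  rw [hs] at h1
  exact ⟨hGr h1, h1.2.resolve_right (hγ' t ht)⟩

theorem LocallyAccessible.connectedImKleinenAt {Ω : Set X} {x : X}
    (h : LocallyAccessible Ω x) : ConnectedImKleinenAt (Ω ∪ {x}) x := by
  intro r hr
  obtain ⟨δ, hδ, hγ⟩ := h r hr
  have hsub : pathComponentIn (ball x r ∩ (Ω ∪ {x})) x ⊆ ball x r ∩ (Ω ∪ {x}) :=
    pathComponentIn_subset
  have hx : x ∈ ball x r ∩ (Ω ∪ {x}) := ⟨mem_ball_self hr, .inr rfl⟩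
  refine ⟨pathComponentIn (ball x r ∩ (Ω ∪ {x})) x, fun z hz => (hsub hz).2,
    fun z hz => (hsub hz).1, (isPathConnected_pathComponentIn hx).isConnected,
    ball x δ, isOpen_ball, mem_ball_self hδ, ?_⟩
  rintro z ⟨hz, hzΩ | rfl⟩
  · obtain ⟨γ, hγ⟩ := hγ z ⟨hz, hzΩ⟩
    refine JoinedIn.symm ⟨γ, fun t => ?_⟩
    rcases eq_or_lt_of_le (show t ≤ 1 from unitInterval.le_one t) with h | h
    · rw [h, γ.target]; exact hx
    · exact ⟨(hγ t h).1, .inl (hγ t h).2⟩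
  · exact mem_pathComponentIn_self hx

theorem exists_isPathConnected_nhds [CompleteSpace X] [LocallyConnectedSpace X] {V : Set X}
    (hV : IsOpen V) {x : X} (hx : x ∈ V) :
    ∃ U, IsOpen U ∧ x ∈ U ∧ U ⊆ V ∧ IsPathConnected U := by
  obtain ⟨r, hr, hrV⟩ := Metric.isOpen_iff.1 hV x hx
  obtain ⟨G, hG, hxG, hGr, hGc⟩ := locallyPathConnectedAt_of_locallyConnectedAt
    (O := fun _ => (univ : Set X)) (S := univ) (fun _ => isOpen_univ) (by simp)
    (fun p _ => locallyConnectedAt_of_isOpen isOpen_univ subset_rfl (mem_univ p)) (mem_univ x) r hr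
  rw [inter_univ] at hGr hGc
  exact ⟨G, hG, hxG, hGr.trans hrV, hGc⟩

/-- Shrinking G to a union G' of pathconnected neighbourhoods of its frontier points loses no
frontier point, and discards the points of the complement that might not be reachable from the
frontier inside G. -/
theorem exists_isOpen_joinedIn_frontier [CompleteSpace X] [LocallyConnectedSpace X] {Ω G : Set X}
    (hΩ : IsOpen Ω) (hG : IsOpen G) : ∃ G', IsOpen G' ∧ G' ⊆ G ∧
      G' ∩ frontier Ω = G ∩ frontier Ω ∧
      ∀ z ∈ G' ∩ Ωᶜ, ∃ w ∈ G ∩ frontier Ω, JoinedIn (G' ∩ Ωᶜ) z w := by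
  have hex : ∀ p : ↥(G ∩ frontier Ω), ∃ U, IsOpen U ∧ (p : X) ∈ U ∧ U ⊆ G ∧ IsPathConnected U :=
    fun p => exists_isPathConnected_nhds hG p.2.1
  choose U hU hpU hUG hUc using hex
  have hsub : (⋃ p, U p) ⊆ G := iUnion_subset hUG
  refine ⟨⋃ p, U p, isOpen_iUnion hU, hsub, Subset.antisymm (inter_subset_inter_left _ hsub)
    fun z hz => ⟨mem_iUnion.2 ⟨⟨z, hz⟩, hpU _⟩, hz.2⟩, ?_⟩
  rintro z ⟨hz, hzΩ⟩
  obtain ⟨p, hp⟩ := mem_iUnion.1 hz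
  obtain ⟨w, hw, hzw⟩ := exists_joinedIn_frontier hΩ (hUc p) ⟨hpU p, p.2.2⟩ ⟨hp, hzΩ⟩
  exact ⟨w, ⟨hUG p hw.1, hw.2⟩, hzw.mono (inter_subset_inter_left _ (subset_iUnion U p))⟩

theorem frontier_subset_compl {Ω : Set X} (hΩ : IsOpen Ω) : frontier Ω ⊆ Ωᶜ := by
  rw [hΩ.frontier_eq]
  exact fun z hz => hz.2

/-! ### From the frontier to the complement, and all arrows together -/

section Compl

variable [CompleteSpace X] [LocallyConnectedSpace X] {Ω : Set X} {x : X}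

theorem LocallyConnectedAt.compl_of_frontier (hΩ : IsOpen Ω) (hx : x ∈ frontier Ω)
    (h : LocallyConnectedAt (frontier Ω) x) : LocallyConnectedAt Ωᶜ x := by
  intro r hr
  obtain ⟨G, hG, hxG, hGr, hGc⟩ := h r hr
  obtain ⟨G', hG', hsub, heq, hj⟩ := exists_isOpen_joinedIn_frontier hΩ (hG.inter isOpen_ball)
  have hGf : G ∩ ball x r ∩ frontier Ω = G ∩ frontier Ω := by
    ext z; exact ⟨fun hz => ⟨hz.1.1, hz.2⟩, fun hz => ⟨⟨hz.1, hGr hz⟩, hz.2⟩⟩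
  rw [hGf] at heq hj
  refine ⟨G', hG', (heq.symm.subset ⟨hxG, hx⟩).1, fun z hz => (hsub hz.1).2,
    isConnected_of_joinedIn hGc ?_ hj⟩
  rw [← heq]
  exact inter_subset_inter_right _ (frontier_subset_compl hΩ)

theorem LocallyPathConnectedAt.compl_of_frontier (hΩ : IsOpen Ω) (hx : x ∈ frontier Ω)
    (h : LocallyPathConnectedAt (frontier Ω) x) : LocallyPathConnectedAt Ωᶜ x := by
  intro r hr
  obtain ⟨G, hG, hxG, hGr, hGc⟩ := h r hr
  obtain ⟨G', hG', hsub, heq, hj⟩ := exists_isOpen_joinedIn_frontier hΩ (hG.inter isOpen_ball)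
  have hGf : G ∩ ball x r ∩ frontier Ω = G ∩ frontier Ω := by
    ext z; exact ⟨fun hz => ⟨hz.1.1, hz.2⟩, fun hz => ⟨⟨hz.1, hGr hz⟩, hz.2⟩⟩
  rw [hGf] at heq hj
  refine ⟨G', hG', (heq.symm.subset ⟨hxG, hx⟩).1, fun z hz => (hsub hz.1).2,
    isPathConnected_of_joinedIn hGc ?_ hj⟩
  rw [← heq]
  exact inter_subset_inter_right _ (frontier_subset_compl hΩ)

/-- Here one pathconnected neighbourhood U' of x suffices: the frontier points that paths hit inside
U' already belong to A. Thus A ∪ (U' ∩ Ωᶜ) inherits its connectedness from A. -/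
theorem exists_joinedIn_of_frontier_im_kleinen (hΩ : IsOpen Ω) (hx : x ∈ frontier Ω) {r : ℝ}
    (hr : 0 < r) {A U : Set X} (hAr : A ⊆ ball x r) (hAS : A ⊆ frontier Ω) (hU : IsOpen U)
    (hxU : x ∈ U) (hUA : U ∩ frontier Ω ⊆ A) : ∃ U', IsOpen U' ∧ x ∈ U' ∧
      A ∪ U' ∩ Ωᶜ ⊆ ball x r ∩ Ωᶜ ∧
      ∀ z ∈ A ∪ U' ∩ Ωᶜ, ∃ w ∈ A, JoinedIn (A ∪ U' ∩ Ωᶜ) z w := by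
  obtain ⟨U', hU', hxU', hsub, hc⟩ := exists_isPathConnected_nhds (hU.inter isOpen_ball)
    (show x ∈ U ∩ ball x r from ⟨hxU, mem_ball_self hr⟩)
  refine ⟨U', hU', hxU', union_subset (fun z hz => ⟨hAr hz, frontier_subset_compl hΩ (hAS hz)⟩)
    fun z hz => ⟨(hsub hz.1).2, hz.2⟩, ?_⟩
  rintro z (hz | hz)
  · exact ⟨z, hz, JoinedIn.refl (.inl hz)⟩
  · obtain ⟨w, hw, hzw⟩ := exists_joinedIn_frontier hΩ hc ⟨hxU', hx⟩ hz
    exact ⟨w, hUA ⟨(hsub hw.1).1, hw.2⟩, hzw.mono subset_union_right⟩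

theorem ConnectedImKleinenAt.compl_of_frontier (hΩ : IsOpen Ω) (hx : x ∈ frontier Ω)
    (h : ConnectedImKleinenAt (frontier Ω) x) : ConnectedImKleinenAt Ωᶜ x := by
  intro r hr
  obtain ⟨A, hAS, hAr, hA, U, hU, hxU, hUA⟩ := h r hr
  obtain ⟨U', hU', hxU', hsub, hj⟩ := exists_joinedIn_of_frontier_im_kleinen hΩ hx hr hAr hAS hU
    hxU hUA
  exact ⟨A ∪ U' ∩ Ωᶜ, fun z hz => (hsub hz).2, fun z hz => (hsub hz).1,
    isConnected_of_joinedIn hA subset_union_left hj, U', hU', hxU', subset_union_right⟩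

theorem PathConnectedImKleinenAt.compl_of_frontier (hΩ : IsOpen Ω) (hx : x ∈ frontier Ω)
    (h : PathConnectedImKleinenAt (frontier Ω) x) : PathConnectedImKleinenAt Ωᶜ x := by
  intro r hr
  obtain ⟨A, hAS, hAr, hA, U, hU, hxU, hUA⟩ := h r hr
  obtain ⟨U', hU', hxU', hsub, hj⟩ := exists_joinedIn_of_frontier_im_kleinen hΩ hx hr hAr hAS hU
    hxU hUA
  exact ⟨A ∪ U' ∩ Ωᶜ, fun z hz => (hsub hz).2, fun z hz => (hsub hz).1,
    isPathConnected_of_joinedIn hA subset_union_left hj, U', hU', hxU', subset_union_right⟩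

theorem Holds.of_arrow (hΩ : IsOpen Ω) (hx : x ∈ frontier Ω) {p q : Label} (hpq : Arrow p q)
    (hp : Holds Ω x p) : Holds Ω x q := by
  have hxΩ : x ∉ Ω := frontier_subset_compl hΩ hx
  have hb : ConnectedImKleinenAt (Ω ∪ {x}) x → LocallyPathConnectedAt (Ω ∪ {x}) x := fun h =>
    locallyPathConnectedAt_of_notMem_closure_remoteSet hΩ fun r hr =>
      h.notMem_closure_remoteSet hΩ hxΩ hr
  cases hpq with
  | e_d => exact NConnectedAt.finitelyConnectedAt hp
  | d_c => exact fun r hr => FinitelyConnectedAt.notMem_closure_remoteSet hp hr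
  | c_b1 => exact locallyPathConnectedAt_of_notMem_closure_remoteSet hΩ hp
  | b1_c =>
    exact fun r hr => (LocallyPathConnectedAt.locallyConnectedAt
      hp).connectedImKleinenAt.notMem_closure_remoteSet hΩ hxΩ hr
  | b1_b2 => exact LocallyPathConnectedAt.locallyConnectedAt hp
  | b2_b1 => exact hb (LocallyConnectedAt.connectedImKleinenAt hp)
  | b2_b3 => exact (hb (LocallyConnectedAt.connectedImKleinenAt hp)).pathConnectedImKleinenAt
  | b3_b2 => exact (hb (PathConnectedImKleinenAt.connectedImKleinenAt hp)).locallyConnectedAt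
  | b3_b4 => exact PathConnectedImKleinenAt.connectedImKleinenAt hp
  | b4_b3 => exact (hb hp).pathConnectedImKleinenAt
  | b4_a => exact (hb hp).locallyAccessible hxΩ
  | a_b4 => exact LocallyAccessible.connectedImKleinenAt hp
  | f1_f2 => exact LocallyPathConnectedAt.locallyConnectedAt hp
  | f1_f3 => exact LocallyPathConnectedAt.pathConnectedImKleinenAt hp
  | f2_f4 => exact LocallyConnectedAt.connectedImKleinenAt hp
  | f3_f4 => exact PathConnectedImKleinenAt.connectedImKleinenAt hp
  | g1_g2 => exact LocallyPathConnectedAt.locallyConnectedAt hp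
  | g1_g3 => exact LocallyPathConnectedAt.pathConnectedImKleinenAt hp
  | g2_g4 => exact LocallyConnectedAt.connectedImKleinenAt hp
  | g3_g4 => exact PathConnectedImKleinenAt.connectedImKleinenAt hp
  | f1_g1 => exact LocallyPathConnectedAt.compl_of_frontier hΩ hx hp
  | f2_g2 => exact LocallyConnectedAt.compl_of_frontier hΩ hx hp
  | f3_g3 => exact PathConnectedImKleinenAt.compl_of_frontier hΩ hx hp
  | f4_g4 => exact ConnectedImKleinenAt.compl_of_frontier hΩ hx hp

theorem Holds.of_reflTransGen (hΩ : IsOpen Ω) (hx : x ∈ frontier Ω) {p q : Label}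
    (hpq : Relation.ReflTransGen Arrow p q) (hp : Holds Ω x p) : Holds Ω x q := by
  induction hpq with
  | refl => exact hp
  | tail _ h ih => exact ih.of_arrow hΩ hx h

end Compl

end Implications

/-! ### Invariance under homeomorphisms -/

section Transfer

variable {X Y : Type*} [MetricSpace X] [MetricSpace Y]

theorem exists_image_ball_subset (h : X ≃ₜ Y) (x : X) {r : ℝ} (hr : 0 < r) :
    ∃ s : ℝ, 0 < s ∧ h '' ball x s ⊆ ball (h x) r := by
  obtain ⟨s, hs, hsr⟩ := Metric.isOpen_iff.1 (isOpen_ball.preimage h.continuous) x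
    (show x ∈ h ⁻¹' ball (h x) r from mem_ball_self hr)
  exact ⟨s, hs, image_subset_iff.2 hsr⟩

theorem LocallyConnectedAt.image (h : X ≃ₜ Y) {S : Set X} {x : X}
    (hS : LocallyConnectedAt S x) : LocallyConnectedAt (h '' S) (h x) := fun r hr => by
  obtain ⟨s, hs, hsr⟩ := exists_image_ball_subset h x hr
  obtain ⟨G, h1, h2, h3, h4⟩ := hS s hs
  refine ⟨h '' G, h.isOpenMap _ h1, mem_image_of_mem _ h2, ?_, ?_⟩ <;>
    rw [← image_inter h.injective]
  · exact (image_mono h3).trans hsr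
  · exact h4.image _ h.continuous.continuousOn

theorem LocallyPathConnectedAt.image (h : X ≃ₜ Y) {S : Set X} {x : X}
    (hS : LocallyPathConnectedAt S x) : LocallyPathConnectedAt (h '' S) (h x) := fun r hr => by
  obtain ⟨s, hs, hsr⟩ := exists_image_ball_subset h x hr
  obtain ⟨G, h1, h2, h3, h4⟩ := hS s hs
  refine ⟨h '' G, h.isOpenMap _ h1, mem_image_of_mem _ h2, ?_, ?_⟩ <;>
    rw [← image_inter h.injective]
  · exact (image_mono h3).trans hsr
  · exact h4.image h.continuous

theorem ConnectedImKleinenAt.image (h : X ≃ₜ Y) {S : Set X} {x : X}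
    (hS : ConnectedImKleinenAt S x) : ConnectedImKleinenAt (h '' S) (h x) := fun r hr => by
  obtain ⟨s, hs, hsr⟩ := exists_image_ball_subset h x hr
  obtain ⟨A, h1, h2, h3, U, h4, h5, h6⟩ := hS s hs
  refine ⟨h '' A, image_mono h1, (image_mono h2).trans hsr,
    h3.image _ h.continuous.continuousOn, h '' U, h.isOpenMap _ h4, mem_image_of_mem _ h5, ?_⟩
  rw [← image_inter h.injective]
  exact image_mono h6

theorem PathConnectedImKleinenAt.image (h : X ≃ₜ Y) {S : Set X} {x : X}
    (hS : PathConnectedImKleinenAt S x) : PathConnectedImKleinenAt (h '' S) (h x) := fun r hr => by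
  obtain ⟨s, hs, hsr⟩ := exists_image_ball_subset h x hr
  obtain ⟨A, h1, h2, h3, U, h4, h5, h6⟩ := hS s hs
  refine ⟨h '' A, image_mono h1, (image_mono h2).trans hsr,
    h3.image h.continuous, h '' U, h.isOpenMap _ h4, mem_image_of_mem _ h5, ?_⟩
  rw [← image_inter h.injective]
  exact image_mono h6

theorem componentsOf_image (h : X ≃ₜ Y) (S : Set X) :
    componentsOf (h '' S) = image h '' componentsOf S := by
  ext C
  constructor
  · rintro ⟨_, ⟨y, hy, rfl⟩, rfl⟩
    exact ⟨_, ⟨y, hy, rfl⟩, h.image_connectedComponentIn hy⟩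
  · rintro ⟨_, ⟨y, hy, rfl⟩, rfl⟩
    exact ⟨h y, mem_image_of_mem _ hy, h.image_connectedComponentIn hy⟩

theorem FinitelyConnectedAt.image (h : X ≃ₜ Y) {Ω : Set X} {x : X}
    (hS : FinitelyConnectedAt Ω x) : FinitelyConnectedAt (h '' Ω) (h x) := fun r hr => by
  obtain ⟨s, hs, hsr⟩ := exists_image_ball_subset h x hr
  obtain ⟨G, h1, h2, h3, h4⟩ := hS s hs
  refine ⟨h '' G, h.isOpenMap _ h1, mem_image_of_mem _ h2, (image_mono h3).trans hsr, ?_⟩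
  rw [← image_inter h.injective, componentsOf_image]
  exact h4.image _

theorem nConnectedAt_one_iff {Ω : Set X} {x : X} : NConnectedAt Ω x 1 ↔
    ∀ r : ℝ, 0 < r → ∃ G : Set X, IsOpen G ∧ x ∈ G ∧ G ⊆ ball x r ∧
      (componentsOf (G ∩ Ω)).encard ≤ 1 :=
  ⟨fun h => by simpa using h.1.2, fun h => ⟨⟨one_pos, by simpa using h⟩, fun _ hn => hn.1⟩⟩

theorem NConnectedAt.image_one (h : X ≃ₜ Y) {Ω : Set X} {x : X}
    (hS : NConnectedAt Ω x 1) : NConnectedAt (h '' Ω) (h x) 1 := by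
  rw [nConnectedAt_one_iff] at hS ⊢
  intro r hr
  obtain ⟨s, hs, hsr⟩ := exists_image_ball_subset h x hr
  obtain ⟨G, h1, h2, h3, h4⟩ := hS s hs
  refine ⟨h '' G, h.isOpenMap _ h1, mem_image_of_mem _ h2, (image_mono h3).trans hsr, ?_⟩
  rw [← image_inter h.injective, componentsOf_image]
  exact (encard_image_le _ _).trans h4

theorem LocallyAccessible.image (h : X ≃ₜ Y) {Ω : Set X} {x : X}
    (hS : LocallyAccessible Ω x) : LocallyAccessible (h '' Ω) (h x) := by
  intro r hr
  obtain ⟨s, hs, hsr⟩ := exists_image_ball_subset h x hr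
  obtain ⟨δ, hδ, hγ⟩ := hS s hs
  obtain ⟨δ', hδ', hsub⟩ := exists_image_ball_subset h.symm (h x) hδ
  rw [h.symm_apply_apply] at hsub
  refine ⟨δ', hδ', ?_⟩
  rintro _ ⟨hy, y, hyΩ, rfl⟩
  have hy' : y ∈ ball x δ := by simpa using hsub (mem_image_of_mem _ hy)
  obtain ⟨γ, hγ⟩ := hγ y ⟨hy', hyΩ⟩
  refine ⟨γ.map h.continuous, fun t ht => ⟨hsr ⟨_, (hγ t ht).1, rfl⟩, ⟨_, (hγ t ht).2, rfl⟩⟩⟩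

/-- Statement (c) is left out because H(r) is defined by metric balls, which a homeomorphism need
not preserve; where needed it is replaced by the equivalent (a). -/
theorem Holds.image (h : X ≃ₜ Y) {Ω : Set X} {x : X} {p : Label} (hpc : p ≠ .c)
    (hp : Holds Ω x p) : Holds (h '' Ω) (h x) p := by
  have e1 : h '' (Ω ∪ {x}) = h '' Ω ∪ {h x} := by rw [image_union, image_singleton]
  have e2 := h.image_frontier Ω
  have e3 : h '' Ωᶜ = (h '' Ω)ᶜ := image_compl_eq h.bijective
  cases p
  case c => exact absurd rfl hpc
  case a => exact LocallyAccessible.image h hp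
  case d => exact FinitelyConnectedAt.image h hp
  case e => exact NConnectedAt.image_one h hp
  all_goals simp only [Holds, ← e1, ← e2, ← e3] at hp ⊢
  any_goals exact LocallyPathConnectedAt.image h hp
  any_goals exact LocallyConnectedAt.image h hp
  any_goals exact PathConnectedImKleinenAt.image h hp
  all_goals exact ConnectedImKleinenAt.image h hp

end Transfer

/-! ### Deformations and simple connectedness -/

section Deformation

variable {E : Type*} [TopologicalSpace E]

/-- The set `S` can be deformed within `Ω` into the set `S'`. -/
def DeformsInto (Ω S S' : Set E) : Prop :=
  ∃ (f : C(S, S')) (i : C(S, Ω)) (j : C(S', Ω)), (∀ x, (i x : E) = x) ∧ (∀ x, (j x : E) = x) ∧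
    i.Homotopic (j.comp f)

theorem DeformsInto.trans {Ω S S' S'' : Set E} (h : DeformsInto Ω S S')
    (h' : DeformsInto Ω S' S'') : DeformsInto Ω S S'' := by
  obtain ⟨f, i, j, hi, hj, H⟩ := h
  obtain ⟨f', i', j', hi', hj', H'⟩ := h'
  have : j = i' := by ext x; rw [hj, hi']
  subst this
  exact ⟨f'.comp f, i, j', hi, hj', H.trans (H'.comp (.refl f))⟩

theorem DeformsInto.of_continuousOn {Ω S S' : Set E} (H : E × ℝ → E)
    (hH : ContinuousOn H (S ×ˢ Icc 0 1)) (hΩ : ∀ p ∈ S, ∀ t ∈ Icc (0 : ℝ) 1, H (p, t) ∈ Ω)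
    (h0 : ∀ p ∈ S, H (p, 0) = p) (h1 : ∀ p ∈ S, H (p, 1) ∈ S') (hS' : S' ⊆ Ω) :
    DeformsInto Ω S S' := by
  have hS : S ⊆ Ω := fun p hp => by
    rw [← h0 p hp]; exact hΩ p hp 0 (by simp)
  have hc : Continuous fun x : unitInterval × S => H (x.2, x.1) :=
    hH.comp_continuous (by fun_prop) fun x => ⟨x.2.2, x.1.2⟩
  have hc1 : Continuous fun x : S => H (x, 1) :=
    hH.comp_continuous (by fun_prop) fun x => ⟨x.2, by simp⟩
  refine ⟨⟨fun x => ⟨H (x, 1), h1 x x.2⟩, hc1.subtype_mk _⟩, ⟨inclusion hS, continuous_inclusion hS⟩,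
    ⟨inclusion hS', continuous_inclusion hS'⟩, fun _ => rfl, fun _ => rfl, ⟨⟨⟨fun x =>
    ⟨H (x.2, x.1), hΩ _ x.2.2 _ x.1.2⟩, hc.subtype_mk _⟩, fun x => ?_, fun x => ?_⟩⟩⟩
  · exact Subtype.ext (h0 x x.2)
  · rfl

/-- A deformation of Ω into a point makes the identity nullhomotopic, so Ω is contractible. -/
theorem DeformsInto.simplyConnectedSpace {Ω : Set E} {c : E} (h : DeformsInto Ω Ω {c}) :
    SimplyConnectedSpace Ω := by
  obtain ⟨f, i, j, hi, hj, H⟩ := h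
  have : ContractibleSpace Ω := by
    rw [contractible_iff_id_nullhomotopic]
    refine ⟨j ⟨c, rfl⟩, ?_⟩
    have e1 : i = ContinuousMap.id Ω := by ext x; exact hi x
    have e2 : j.comp f = ContinuousMap.const Ω (j ⟨c, rfl⟩) := by
      ext x
      simp only [ContinuousMap.comp_apply, ContinuousMap.const_apply, hj]
      exact (f x).2
    rwa [e1, e2] at H
  infer_instance

theorem DeformsInto.of_starConvex {E : Type*} [AddCommGroup E] [Module ℝ E] [TopologicalSpace E]
    [IsTopologicalAddGroup E] [ContinuousSMul ℝ E] {Ω T : Set E} {c : E} (hT : StarConvex ℝ c T)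
    (hc : c ∈ T) (hTΩ : T ⊆ Ω) : DeformsInto Ω T {c} := by
  refine DeformsInto.of_continuousOn (fun x => x.2 • c + (1 - x.2) • x.1) (by fun_prop)
    (fun p hp t ht => hTΩ (hT hp ht.1 (by linarith [ht.2]) (by ring))) (by simp) (by simp)
    (by simpa using hTΩ hc)

end Deformation

/-! ### Reduction of the missing implications to seven -/

section Counterexamples

/-- Some bounded simply connected plane domain satisfies `p` and violates `q` at some boundary
point. -/
def Separates (p q : Label) : Prop :=
  ∃ (Ω : Set (ℝ × ℝ)) (x₀ : ℝ × ℝ), IsOpen Ω ∧ Bornology.IsBounded Ω ∧ SimplyConnectedSpace Ω ∧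
    x₀ ∈ frontier Ω ∧ Holds Ω x₀ p ∧ ¬ Holds Ω x₀ q

/-- The examples live in ℝ × ℝ with the maximum metric, where balls are squares. A linear
homeomorphism carries them to the Euclidean plane, and one example for p and q serves every p'
implied by p and every q' that implies q. -/
theorem Separates.euclidean {p q p' q' : Label} (h : Separates p q) (hp : p ≠ .c) (hq : q ≠ .c)
    (hpp : Relation.ReflTransGen Arrow p p') (hqq : Relation.ReflTransGen Arrow q' q) :
    ∃ (Ω : Set (EuclideanSpace ℝ (Fin 2))) (x₀ : EuclideanSpace ℝ (Fin 2)),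
      IsOpen Ω ∧ Bornology.IsBounded Ω ∧ SimplyConnectedSpace Ω ∧ x₀ ∈ frontier Ω ∧
        Holds Ω x₀ p' ∧ ¬ Holds Ω x₀ q' := by
  obtain ⟨Ω, x₀, h1, h2, h3, h4, h5, h6⟩ := h
  let e : (ℝ × ℝ) ≃L[ℝ] EuclideanSpace ℝ (Fin 2) :=
    (ContinuousLinearEquiv.finTwoArrow ℝ ℝ).symm.trans (EuclideanSpace.equiv (Fin 2) ℝ).symm
  let h : (ℝ × ℝ) ≃ₜ EuclideanSpace ℝ (Fin 2) := e.toHomeomorph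
  have hfr : h x₀ ∈ frontier (h '' Ω) := by
    rw [← h.image_frontier]; exact mem_image_of_mem _ h4
  have ho : IsOpen (h '' Ω) := h.isOpenMap _ h1
  refine ⟨h '' Ω, h x₀, ho, e.lipschitz.isBounded_image h2, ?_, hfr,
    (h5.image h hp).of_reflTransGen ho hfr hpp, fun hq' => h6 ?_⟩
  · exact ((h.image Ω).toHomotopyEquiv.simplyConnectedSpace_iff).1 h3
  · have := (hq'.of_reflTransGen ho hfr hqq).image h.symm hq
    rwa [h.symm_apply_apply, ← image_comp, h.symm_comp_self, image_id] at this

/-- The reachability relation of the implication diagram. -/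
def Label.reaches : Label → Label → Bool
  | .e, .e | .e, .d | .d, .d => true
  | .e, q | .d, q | .a, q | .b1, q | .b2, q | .b3, q | .b4, q | .c, q => match q with
    | .a | .b1 | .b2 | .b3 | .b4 | .c => true
    | _ => false
  | .f1, q => match q with
    | .f1 | .f2 | .f3 | .f4 | .g1 | .g2 | .g3 | .g4 => true
    | _ => false
  | .f2, q => match q with
    | .f2 | .f4 | .g2 | .g4 => true
    | _ => false
  | .f3, q => match q with
    | .f3 | .f4 | .g3 | .g4 => true
    | _ => false
  | .f4, q => match q with
    | .f4 | .g4 => true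
    | _ => false
  | .g1, q => match q with
    | .g1 | .g2 | .g3 | .g4 => true
    | _ => false
  | .g2, q => match q with
    | .g2 | .g4 => true
    | _ => false
  | .g3, q => match q with
    | .g3 | .g4 => true
    | _ => false
  | .g4, q => match q with
    | .g4 => true
    | _ => false

theorem Label.reflTransGen_of_reaches {p q : Label} (h : p.reaches q = true) :
    Relation.ReflTransGen Arrow p q := by
  have ed := Relation.ReflTransGen.single Arrow.e_d
  have dc := Relation.ReflTransGen.single Arrow.d_c
  have cb1 := Relation.ReflTransGen.single Arrow.c_b1
  have b12 := cb1.tail Arrow.b1_b2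
  have b23 := b12.tail Arrow.b2_b3
  have b34 := b23.tail Arrow.b3_b4
  have b4a := b34.tail Arrow.b4_a
  have b1c := Relation.ReflTransGen.single Arrow.b1_c
  have b2c := b1c.head Arrow.b2_b1
  have b3c := b2c.head Arrow.b3_b2
  have b4c := b3c.head Arrow.b4_b3
  have ac := b4c.head Arrow.a_b4
  have f12 := Relation.ReflTransGen.single Arrow.f1_f2
  have f13 := Relation.ReflTransGen.single Arrow.f1_f3
  have f24 := Relation.ReflTransGen.single Arrow.f2_f4
  have f34 := Relation.ReflTransGen.single Arrow.f3_f4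
  have g12 := Relation.ReflTransGen.single Arrow.g1_g2
  have g13 := Relation.ReflTransGen.single Arrow.g1_g3
  have g24 := Relation.ReflTransGen.single Arrow.g2_g4
  have g34 := Relation.ReflTransGen.single Arrow.g3_g4
  have f1g := Relation.ReflTransGen.single Arrow.f1_g1
  have f2g := Relation.ReflTransGen.single Arrow.f2_g2
  have f3g := Relation.ReflTransGen.single Arrow.f3_g3
  have f4g := Relation.ReflTransGen.single Arrow.f4_g4
  have toC : ∀ p : Label, p.reaches .c = true → Relation.ReflTransGen Arrow p .c := by
    intro p hp
    cases p
    all_goals first | exact absurd hp (by decide) | assumption | exact .refl | exact ed.trans dc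
  have ofC : ∀ q : Label, Label.c.reaches q = true → Relation.ReflTransGen Arrow .c q := by
    intro p hp
    cases p
    all_goals first | exact absurd hp (by decide) | assumption | exact .refl
  cases p <;> cases q
  all_goals first
    | exact absurd h (by decide)
    | exact .refl
    | assumption
    | exact (toC _ rfl).trans (ofC _ rfl)
    | exact f12.trans f24
    | exact g12.trans g24
    | exact f12.trans f2g
    | exact f13.trans f3g
    | exact f24.trans f4g
    | exact f34.trans f4g
    | exact (f12.trans f24).trans f4g

/-- A finite check on the Boolean table `Label.reaches`. Only its soundness is needed: every pair
outside the table is dominated by one of the seven. -/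
theorem exists_separating_pair {p q : Label} (h : ¬ Relation.ReflTransGen Arrow p q) :
    ∃ p₀ q₀ : Label, (p₀, q₀) ∈ ({(.f1, .a), (.e, .g4), (.d, .e), (.a, .d), (.f2, .g3), (.f3, .g2),
      (.g1, .f4)} : Set (Label × Label)) ∧ Relation.ReflTransGen Arrow p₀ p ∧
      Relation.ReflTransGen Arrow q q₀ := by
  have key : p.reaches q = true ∨ (Label.reaches .f1 p && Label.reaches q .a) = true ∨
      (Label.reaches .e p && Label.reaches q .g4) = true ∨
      (Label.reaches .d p && Label.reaches q .e) = true ∨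
      (Label.reaches .a p && Label.reaches q .d) = true ∨
      (Label.reaches .f2 p && Label.reaches q .g3) = true ∨
      (Label.reaches .f3 p && Label.reaches q .g2) = true ∨
      (Label.reaches .g1 p && Label.reaches q .f4) = true := by
    cases p <;> cases q <;> decide
  simp only [Bool.and_eq_true] at key
  rcases key with hk | hk | hk | hk | hk | hk | hk | hk
  · exact absurd (Label.reflTransGen_of_reaches hk) h
  all_goals
    exact ⟨_, _, by simp, Label.reflTransGen_of_reaches hk.1, Label.reflTransGen_of_reaches hk.2⟩

end Counterexamples

/-! ### Segments and intermediate values in the plane -/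

section Plane

theorem mem_ball_prod {p c : ℝ × ℝ} {r : ℝ} :
    p ∈ ball c r ↔ |p.1 - c.1| < r ∧ |p.2 - c.2| < r := by
  rw [mem_ball, Prod.dist_eq, max_lt_iff, Real.dist_eq, Real.dist_eq]

theorem _root_.IsPreconnected.exists_fst_eq {A : Set (ℝ × ℝ)} (hA : IsPreconnected A) {p q : ℝ × ℝ}
    (hp : p ∈ A) (hq : q ∈ A) {m : ℝ} (h1 : p.1 ≤ m) (h2 : m ≤ q.1) : ∃ z ∈ A, z.1 = m := by
  obtain ⟨z, hz, h⟩ := hA.intermediate_value hp hq continuous_fst.continuousOn ⟨h1, h2⟩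
  exact ⟨z, hz, h⟩

theorem joinedIn_vertical {S : Set (ℝ × ℝ)} {x y y' : ℝ} (h : ∀ s ∈ uIcc y y', (x, s) ∈ S) :
    JoinedIn S (x, y) (x, y') := by
  have h1 : IsPathConnected ((fun s => (x, s)) '' uIcc y y') :=
    ((convex_uIcc y y').isPathConnected nonempty_uIcc).image (by fun_prop)
  exact (h1.joinedIn _ ⟨y, left_mem_uIcc, rfl⟩ _ ⟨y', right_mem_uIcc, rfl⟩).mono
    (image_subset_iff.2 h)

theorem joinedIn_horizontal {S : Set (ℝ × ℝ)} {x x' y : ℝ} (h : ∀ s ∈ uIcc x x', (s, y) ∈ S) :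
    JoinedIn S (x, y) (x', y) := by
  have h1 : IsPathConnected ((fun s => (s, y)) '' uIcc x x') :=
    ((convex_uIcc x x').isPathConnected nonempty_uIcc).image (by fun_prop)
  exact (h1.joinedIn _ ⟨x, left_mem_uIcc, rfl⟩ _ ⟨x', right_mem_uIcc, rfl⟩).mono
    (image_subset_iff.2 h)

theorem encard_componentsOf_le_one {X : Type*} [MetricSpace X] {S : Set X}
    (hS : IsPreconnected S) : (componentsOf S).encard ≤ 1 := by
  rw [encard_le_one_iff]
  rintro _ _ ⟨y, hy, rfl⟩ ⟨z, hz, rfl⟩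
  exact connectedComponentIn_eq (hS.subset_connectedComponentIn hy subset_rfl hz)

end Plane

/-! ### Combs with thin and with thick teeth -/

section Comb

/-- The rectangle `(0, 1) × (0, 2)` with the set `T × (0, 1]` of teeth removed. -/
def comb (T : Set ℝ) : Set (ℝ × ℝ) :=
  {p | (0 < p.1 ∧ p.1 < 1) ∧ (0 < p.2 ∧ p.2 < 2) ∧ (1 < p.2 ∨ p.1 ∉ T)}

variable {T : Set ℝ}

theorem isOpen_comb (hT : IsClosed T) : IsOpen (comb T) := by
  have h1 : IsOpen {p : ℝ × ℝ | p.1 ∉ T} := hT.isOpen_compl.preimage continuous_fst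
  have h2 : ∀ c : ℝ, IsOpen {p : ℝ × ℝ | c < p.2} := fun c => isOpen_lt (by fun_prop) (by fun_prop)
  have h3 : ∀ c : ℝ, IsOpen {p : ℝ × ℝ | p.2 < c} := fun c => isOpen_lt (by fun_prop) (by fun_prop)
  have h4 : ∀ c : ℝ, IsOpen {p : ℝ × ℝ | c < p.1} := fun c => isOpen_lt (by fun_prop) (by fun_prop)
  have h5 : ∀ c : ℝ, IsOpen {p : ℝ × ℝ | p.1 < c} := fun c => isOpen_lt (by fun_prop) (by fun_prop)
  exact ((h4 0).inter (h5 1)).inter (((h2 0).inter (h3 2)).inter ((h2 1).union h1))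

theorem isBounded_comb : Bornology.IsBounded (comb T) := by
  refine isBounded_ball.subset (t := ball (0, 0) 3) ?_
  rintro p ⟨h1, h2, -⟩
  rw [mem_ball_prod, abs_lt, abs_lt]
  refine ⟨⟨?_, ?_⟩, ?_, ?_⟩ <;> simp only [sub_zero] <;> linarith

/-- Raising points vertically to height at least 3/2 never runs into a tooth, and the strip above
the teeth is convex. -/
theorem simplyConnectedSpace_comb : SimplyConnectedSpace (comb T) := by
  have hsub : Ioo (0 : ℝ) 1 ×ˢ Ioo (1 : ℝ) 2 ⊆ comb T := by
    rintro p ⟨h1, h2⟩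
    exact ⟨h1, ⟨by linarith [h2.1], h2.2⟩, .inl h2.1⟩
  have h1 : DeformsInto (comb T) (comb T) (Ioo (0 : ℝ) 1 ×ˢ Ioo (1 : ℝ) 2) := by
    refine .of_continuousOn (fun x => (x.1.1, max x.1.2 (x.2 * (3 / 2)))) (by fun_prop) ?_ ?_ ?_
      hsub
    · rintro p ⟨h1, h2, h3⟩ t ⟨ht, ht'⟩
      refine ⟨h1, ⟨lt_max_of_lt_left h2.1, max_lt h2.2 (by linarith)⟩, ?_⟩
      exact h3.imp (fun h => lt_max_of_lt_left h) id
    · rintro p ⟨h1, h2, h3⟩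
      ext <;> simp [h2.1.le]
    · rintro p ⟨h1, h2, h3⟩
      exact ⟨h1, lt_max_of_lt_right (by norm_num), max_lt h2.2 (by norm_num)⟩
  have hc : ((1 / 2, 3 / 2) : ℝ × ℝ) ∈ Ioo (0 : ℝ) 1 ×ˢ Ioo (1 : ℝ) 2 := by
    constructor <;> constructor <;> norm_num
  exact (h1.trans (.of_starConvex (((convex_Ioo _ _).prod (convex_Ioo _ _)).starConvex hc) hc
    hsub)).simplyConnectedSpace

theorem mem_closure_comb {x y : ℝ} (hx : x ∈ Ioo (0 : ℝ) 1) (hxT : x ∉ T) (hy : y ∈ Icc (0 : ℝ) 2) :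
    (x, y) ∈ closure (comb T) := by
  have h : ({x} : Set ℝ) ×ˢ Ioo (0 : ℝ) 2 ⊆ comb T := by
    rintro ⟨a, b⟩ ⟨rfl, hb⟩
    exact ⟨hx, hb, .inr hxT⟩
  refine closure_mono h ?_
  rw [closure_prod_eq, closure_Ioo (by norm_num)]
  exact ⟨subset_closure rfl, hy⟩

theorem mem_frontier_comb (hT : IsClosed T) (hd : Dense Tᶜ) {p : ℝ × ℝ} :
    p ∈ frontier (comb T) ↔ p.1 ∈ Icc (0 : ℝ) 1 ∧ p.2 ∈ Icc (0 : ℝ) 2 ∧ p ∉ comb T := by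
  rw [(isOpen_comb hT).frontier_eq, mem_sdiff, ← and_assoc]
  refine and_congr_left fun _ => ?_
  have h1 : Icc (0 : ℝ) 1 ⊆ closure (Ioo 0 1 ∩ Tᶜ) := by
    rw [← closure_Ioo (by norm_num)]
    exact closure_minimal (hd.open_subset_closure_inter isOpen_Ioo) isClosed_closure
  constructor
  · intro h
    have : comb T ⊆ Icc (0 : ℝ) 1 ×ˢ Icc (0 : ℝ) 2 :=
      fun p hp => ⟨⟨hp.1.1.le, hp.1.2.le⟩, hp.2.1.1.le, hp.2.1.2.le⟩
    exact closure_minimal this (isClosed_Icc.prod isClosed_Icc) h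
  · rintro ⟨h2, h3⟩
    have h4 : (Ioo (0 : ℝ) 1 ∩ Tᶜ) ×ˢ Ioo (0 : ℝ) 2 ⊆ comb T := fun p hp => ⟨hp.1.1, hp.2, .inr hp.1.2⟩
    refine closure_mono h4 ?_
    rw [closure_prod_eq, closure_Ioo (by norm_num)]
    exact ⟨h1 h2, h3⟩

/-- The set of the reciprocals of the natural numbers, including `0⁻¹ = 0`. -/
def reciprocals : Set ℝ := range fun n : ℕ => (n : ℝ)⁻¹

theorem zero_mem_reciprocals : (0 : ℝ) ∈ reciprocals := ⟨0, by simp⟩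

theorem isClosed_reciprocals : IsClosed reciprocals := by
  have h := (tendsto_inv_atTop_nhds_zero_nat (𝕜 := ℝ)).isCompact_insert_range
  rw [insert_eq_of_mem (show (0 : ℝ) ∈ range fun n : ℕ => (n : ℝ)⁻¹ from
    zero_mem_reciprocals)] at h
  exact h.isClosed

theorem dense_compl_reciprocals : Dense reciprocalsᶜ :=
  (countable_range _).dense_compl ℝ

theorem exists_reciprocal_lt {ε : ℝ} (hε : 0 < ε) : ∃ m ∈ reciprocals, 0 < m ∧ m < ε := by
  obtain ⟨n, hn⟩ := exists_nat_one_div_lt hε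
  refine ⟨((n + 1 : ℕ) : ℝ)⁻¹, ⟨n + 1, rfl⟩, by positivity, ?_⟩
  simpa using hn

theorem exists_notMem_reciprocals {a b : ℝ} (h : a < b) : ∃ m ∉ reciprocals, a < m ∧ m < b := by
  obtain ⟨m, hm, h1, h2⟩ := dense_compl_reciprocals.exists_between h
  exact ⟨m, hm, h1, h2⟩

/-- Near the corner (0, 0) the frontier is the base with vertical segments standing on it, so every
point travels down and then along the base. A curve in Ω towards the corner would have to cross the
teeth close to the left side while staying below height 1/2. -/
theorem separates_f1_a : Separates .f1 .a := by
  have hfr := fun p => mem_frontier_comb (p := p) isClosed_reciprocals dense_compl_reciprocals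
  refine ⟨comb reciprocals, (0, 0), isOpen_comb isClosed_reciprocals, isBounded_comb,
    simplyConnectedSpace_comb, ?_, ?_, ?_⟩
  · exact (hfr _).2 ⟨by simp, by simp, fun h => lt_irrefl _ h.1.1⟩
  · intro r hr
    have hε : 0 < min r 1 := by positivity
    have h0 : ((0, 0) : ℝ × ℝ) ∈ frontier (comb reciprocals) :=
      (hfr _).2 ⟨by simp, by simp, fun h => lt_irrefl _ h.1.1⟩
    refine ⟨ball (0, 0) (min r 1), isOpen_ball, mem_ball_self hε,
      fun p hp => ball_subset_ball (min_le_left _ _) hp.1,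
      isPathConnected_of_joinedIn (isPathConnected_singleton ((0, 0) : ℝ × ℝ)) ?_ ?_⟩
    · exact singleton_subset_iff.2 ⟨mem_ball_self hε, h0⟩
    · rintro ⟨x, y⟩ ⟨hb, hf⟩
      refine ⟨_, rfl, ?_⟩
      obtain ⟨hx, hy, hn⟩ := (hfr _).1 hf
      simp only [mem_ball_prod, sub_zero, lt_min_iff, abs_lt, mem_Icc] at hb hx hy
      have hxy : y = 0 ∨ x ∈ reciprocals := by
        by_contra! hc
        refine hn ⟨⟨lt_of_le_of_ne hx.1 fun h => hc.2 ?_, by linarith⟩,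
          ⟨lt_of_le_of_ne hy.1 (Ne.symm hc.1), by linarith⟩, .inr hc.2⟩
        rw [show x = 0 from h.symm]
        exact zero_mem_reciprocals
      have h1 : JoinedIn (ball (0, 0) (min r 1) ∩ frontier (comb reciprocals)) (x, y) (x, 0) := by
        refine joinedIn_vertical fun s hs => ?_
        rw [uIcc_of_ge hy.1] at hs
        simp only [mem_Icc] at hs
        refine ⟨?_, (hfr _).2 ⟨hx, ⟨hs.1, by linarith⟩, fun h => ?_⟩⟩
        · simp only [mem_ball_prod, sub_zero, lt_min_iff, abs_lt]
          refine ⟨hb.1, ?_, ?_⟩ <;> constructor <;> linarith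
        · obtain ⟨-, h2, h3⟩ := h
          simp only at h2 h3
          rcases hxy with h | h
          · linarith
          · rcases h3 with h3 | h3
            · linarith
            · exact h3 h
      have h2 : JoinedIn (ball (0, 0) (min r 1) ∩ frontier (comb reciprocals)) (x, 0) (0, 0) := by
        refine joinedIn_horizontal fun s hs => ?_
        rw [uIcc_of_ge hx.1] at hs
        simp only [mem_Icc] at hs
        refine ⟨?_, (hfr _).2 ⟨⟨hs.1, by linarith⟩, by simp, fun h => lt_irrefl _ h.2.1.1⟩⟩
        simp only [mem_ball_prod, sub_zero, lt_min_iff, abs_lt]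
        refine ⟨⟨⟨?_, ?_⟩, ?_, ?_⟩, ⟨?_, ?_⟩, ?_, ?_⟩ <;> linarith
      exact h1.trans h2
  · intro h
    obtain ⟨δ, hδ, hγ⟩ := h (1 / 2) (by norm_num)
    have hε : 0 < min δ 1 := by positivity
    obtain ⟨x, hxT, hx0, hxε⟩ := exists_notMem_reciprocals hε
    rw [lt_min_iff] at hxε
    obtain ⟨γ, hγ⟩ := hγ (x, x) ⟨by
      simp only [mem_ball_prod, sub_zero, abs_lt]
      refine ⟨⟨?_, ?_⟩, ?_, ?_⟩ <;> linarith, ⟨hx0, hxε.2⟩, ⟨hx0, by linarith⟩, .inr hxT⟩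
    obtain ⟨m, hm, hm0, hmx⟩ := exists_reciprocal_lt hx0
    obtain ⟨_, ⟨t, rfl⟩, ht⟩ := (isPreconnected_range γ.continuous).exists_fst_eq
      (p := (0, 0)) (q := (x, x)) ⟨1, by simp⟩ ⟨0, by simp⟩ hm0.le hmx.le
    have ht1 : t < 1 := by
      refine lt_of_le_of_ne (unitInterval.le_one t) fun h => ?_
      rw [h, γ.target] at ht
      exact hm0.ne ht
    obtain ⟨hb, -, -, h3⟩ := hγ t ht1
    simp only [mem_ball_prod, sub_zero, abs_lt] at hb
    rcases h3 with h3 | h3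
    · linarith
    · exact h3 (ht ▸ hm)

/-- At (0, 1) the tips of the teeth accumulate. Every point of a small square can be lifted into the
open strip above them, so Ω is connected there; but a vertical line between two teeth misses the
complement near (0, 1) and separates it. -/
theorem separates_e_g4 : Separates .e .g4 := by
  have hfr := fun p => mem_frontier_comb (p := p) isClosed_reciprocals dense_compl_reciprocals
  refine ⟨comb reciprocals, (0, 1), isOpen_comb isClosed_reciprocals, isBounded_comb,
    simplyConnectedSpace_comb, ?_, ?_, ?_⟩
  · exact (hfr _).2 ⟨by simp, by simp, fun h => lt_irrefl _ h.1.1⟩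
  · refine nConnectedAt_one_iff.2 fun r hr => ?_
    obtain ⟨ε, hε, hεr, hε1⟩ : ∃ ε : ℝ, 0 < ε ∧ ε ≤ r ∧ ε ≤ 1 :=
      ⟨min r 1, by positivity, min_le_left _ _, min_le_right _ _⟩
    refine ⟨ball (0, 1) ε, isOpen_ball, mem_ball_self hε,
      ball_subset_ball hεr, encard_componentsOf_le_one (IsConnected.isPreconnected ?_)⟩
    have hA : IsConnected (Ioo (0 : ℝ) ε ×ˢ Ioo (1 : ℝ) (1 + ε)) :=
      (isConnected_Ioo hε).prod (isConnected_Ioo (by linarith))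
    refine isConnected_of_joinedIn hA ?_ ?_
    · rintro ⟨x, y⟩ ⟨hx, hy⟩
      simp only [mem_Ioo] at hx hy
      refine ⟨?_, ⟨hx.1, by simp only; linarith⟩, ⟨by simp only; linarith,
        by simp only; linarith⟩, .inl hy.1⟩
      simp only [mem_ball_prod, sub_zero, abs_lt]
      refine ⟨⟨?_, ?_⟩, ?_, ?_⟩ <;> linarith
    · rintro ⟨x, y⟩ ⟨hb, hx, hy, h⟩
      simp only [mem_ball_prod, sub_zero, abs_lt] at hb hx hy h
      have hm1 : y ≤ max y (1 + ε / 2) := le_max_left _ _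
      have hm2 : 1 + ε / 2 ≤ max y (1 + ε / 2) := le_max_right _ _
      have hm3 : max y (1 + ε / 2) < 1 + ε := max_lt (by linarith) (by linarith)
      refine ⟨(x, max y (1 + ε / 2)), ⟨⟨hx.1, hb.1.2⟩, ?_, hm3⟩, joinedIn_vertical fun s hs => ?_⟩
      · simp only; linarith
      · rw [uIcc_of_le hm1] at hs
        simp only [mem_Icc] at hs
        refine ⟨?_, hx, ⟨?_, ?_⟩, h.imp (fun h => ?_) id⟩
        · simp only [mem_ball_prod, sub_zero, abs_lt]
          refine ⟨⟨?_, ?_⟩, ?_, ?_⟩ <;> linarith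
        all_goals simp only; linarith
  · intro h
    obtain ⟨A, hAS, hAr, hA, U, hU, hxU, hUA⟩ := h (1 / 2) (by norm_num)
    obtain ⟨η, hη, hηU⟩ := Metric.isOpen_iff.1 hU _ hxU
    obtain ⟨a, ha, ha0, haη⟩ := exists_reciprocal_lt (ε := min η 1) (by positivity)
    rw [lt_min_iff] at haη
    have h0 : ((0, 1) : ℝ × ℝ) ∈ A := hUA ⟨hxU, fun h => lt_irrefl _ h.1.1⟩
    have h1 : ((a, 1) : ℝ × ℝ) ∈ A := by
      refine hUA ⟨hηU ?_, fun h => ?_⟩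
      · simp only [mem_ball_prod, sub_zero, abs_lt]
        refine ⟨⟨?_, ?_⟩, ?_, ?_⟩ <;> linarith
      · exact h.2.2.elim (lt_irrefl _) (fun h => h ha)
    obtain ⟨m, hm, hm0, hma⟩ := exists_notMem_reciprocals ha0
    obtain ⟨z, hz, rfl⟩ := hA.isPreconnected.exists_fst_eq h0 h1 hm0.le hma.le
    have hb := hAr hz
    simp only [mem_ball_prod, sub_zero, abs_lt] at hb
    refine hAS hz ⟨⟨hm0, by linarith⟩, ⟨?_, ?_⟩, .inr hm⟩ <;> linarith

theorem _root_.IsPreconnected.componentsOf_subsingleton {X : Type*} [TopologicalSpace X] {A S : Set X}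
    (hA : IsPreconnected A) (hAS : A ⊆ S) :
    {C | ∃ y ∈ A, C = connectedComponentIn S y}.Subsingleton := by
  rintro _ ⟨y, hy, rfl⟩ _ ⟨z, hz, rfl⟩
  exact connectedComponentIn_eq (hA.subset_connectedComponentIn hy hAS hz)

theorem eq_half_of_mem_reciprocals {x : ℝ} (hx : x ∈ reciprocals) (h1 : 1 / 3 < x)
    (h2 : x < 2 / 3) : x = 1 / 2 := by
  obtain ⟨n, rfl⟩ := hx
  have hn : (0 : ℝ) < n := by
    by_contra hc
    have : (n : ℝ) = 0 := le_antisymm (not_lt.1 hc) (by positivity)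
    simp only [this, inv_zero] at h1
    linarith
  have h3 : (n : ℝ) * (n : ℝ)⁻¹ = 1 := mul_inv_cancel₀ hn.ne'
  have h4 : n < 3 := by
    have : (n : ℝ) < 3 := by nlinarith
    exact_mod_cast this
  have h5 : 1 < n := by
    have : (1 : ℝ) < n := by nlinarith
    exact_mod_cast this
  obtain rfl : n = 2 := by omega
  norm_num

/-- The point (1/2, 1/2) lies inside the isolated tooth over 1/2, whose two sides are locally two
components. -/
theorem separates_d_e : Separates .d .e := by
  have hfr := fun p => mem_frontier_comb (p := p) isClosed_reciprocals dense_compl_reciprocals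
  have h2 : (1 / 2 : ℝ) ∈ reciprocals := ⟨2, by norm_num⟩
  refine ⟨comb reciprocals, (1 / 2, 1 / 2), isOpen_comb isClosed_reciprocals, isBounded_comb,
    simplyConnectedSpace_comb, ?_, ?_, ?_⟩
  · refine (hfr _).2 ⟨⟨by norm_num, by norm_num⟩, ⟨by norm_num, by norm_num⟩, fun h => ?_⟩
    rcases h.2.2 with h | h
    · norm_num at h
    · exact h h2
  · intro r hr
    obtain ⟨ε, hε, hεr, hε1⟩ : ∃ ε : ℝ, 0 < ε ∧ ε ≤ r ∧ ε ≤ 1 / 6 :=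
      ⟨min r (1 / 6), by positivity, min_le_left _ _, min_le_right _ _⟩
    refine ⟨ball (1 / 2, 1 / 2) ε, isOpen_ball, mem_ball_self hε, ball_subset_ball hεr, ?_⟩
    have hsub : ∀ I : Set ℝ, I ⊆ Ioo (1 / 2 - ε) (1 / 2 + ε) → (1 / 2 : ℝ) ∉ I →
        I ×ˢ Ioo (1 / 2 - ε) (1 / 2 + ε) ⊆ ball (1 / 2, 1 / 2) ε ∩ comb reciprocals := by
      rintro I hI hI2 ⟨x, y⟩ ⟨hx, hy⟩
      have hx' := hI hx
      simp only [mem_Ioo] at hx' hy hx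
      refine ⟨?_, ⟨?_, ?_⟩, ⟨?_, ?_⟩, .inr fun hxT => hI2 ?_⟩
      · simp only [mem_ball_prod, abs_lt]
        refine ⟨⟨?_, ?_⟩, ?_, ?_⟩ <;> linarith
      iterate 4 simp only; linarith
      rw [← eq_half_of_mem_reciprocals hxT (by simp only; linarith) (by simp only; linarith)]
      exact hx
    have hL := hsub (Ioo (1 / 2 - ε) (1 / 2)) (Ioo_subset_Ioo_right (by linarith)) (by simp)
    have hR := hsub (Ioo (1 / 2) (1 / 2 + ε)) (Ioo_subset_Ioo_left (by linarith)) (by simp)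
    refine ((IsPreconnected.componentsOf_subsingleton (isPreconnected_Ioo.prod isPreconnected_Ioo)
      hL).finite.union (IsPreconnected.componentsOf_subsingleton
      (isPreconnected_Ioo.prod isPreconnected_Ioo) hR).finite).subset ?_
    rintro _ ⟨⟨x, y⟩, ⟨hb, hc⟩, rfl⟩
    simp only [mem_ball_prod, abs_lt] at hb
    have hx : x ≠ 1 / 2 := by
      rintro rfl
      rcases hc.2.2 with h | h
      · simp only at h; linarith
      · exact h h2
    rcases lt_or_gt_of_ne hx with h | h
    · refine .inl ⟨(x, y), ⟨⟨?_, ?_⟩, ?_, ?_⟩, rfl⟩ <;> simp only <;> linarith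
    · refine .inr ⟨(x, y), ⟨⟨?_, ?_⟩, ?_, ?_⟩, rfl⟩ <;> simp only <;> linarith
  · intro h
    obtain ⟨G, hG, hxG, hGb, hcard⟩ := nConnectedAt_one_iff.1 h (1 / 6) (by norm_num)
    obtain ⟨η, hη, hηG⟩ := Metric.isOpen_iff.1 hG _ hxG
    have hmem : ∀ x : ℝ, |x - 1 / 2| < η → x ≠ 1 / 2 → (x, 1 / 2) ∈ G ∩ comb reciprocals := by
      intro x hx hne
      have hxG : ((x, 1 / 2) : ℝ × ℝ) ∈ G := hηG (mem_ball_prod.2 ⟨hx, by simpa using hη⟩)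
      have hb := hGb hxG
      simp only [mem_ball_prod, abs_lt] at hb
      refine ⟨hxG, ⟨?_, ?_⟩, ⟨?_, ?_⟩, .inr fun hxT => hne ?_⟩
      iterate 4 simp only; linarith
      exact eq_half_of_mem_reciprocals hxT (by linarith) (by linarith)
    have hp := hmem (1 / 2 - η / 2) (by rw [abs_lt]; constructor <;> linarith) (by linarith)
    have hq := hmem (1 / 2 + η / 2) (by rw [abs_lt]; constructor <;> linarith) (by linarith)
    have heq := encard_le_one_iff.1 hcard _ _ ⟨_, hp, rfl⟩ ⟨_, hq, rfl⟩
    have hq' := mem_connectedComponentIn hq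
    rw [← heq] at hq'
    obtain ⟨z, hz, hz1⟩ := isPreconnected_connectedComponentIn.exists_fst_eq
      (mem_connectedComponentIn hp) hq' (m := 1 / 2) (by simp only; linarith)
      (by simp only; linarith)
    obtain ⟨hzG, hzc⟩ := connectedComponentIn_subset _ _ hz
    have hb := hGb hzG
    simp only [mem_ball_prod, abs_lt] at hb
    rcases hzc.2.2 with h | h
    · linarith
    · exact h (hz1 ▸ h2)

/-- A closed set of reals in which intervals and gaps alternate towards `0`. -/
def thickTeeth : Set ℝ := closure {x | 0 < x ∧ 0 < Real.sin x⁻¹}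

/-- The points are reciprocals of π/2 + 2πk and -π/2 + 2πk, where the sine of the reciprocal is 1
and -1. -/
theorem exists_thickTeeth {ε : ℝ} (hε : 0 < ε) :
    ∃ m s : ℝ, 0 < m ∧ m < s ∧ s < ε ∧ thickTeeth ∈ 𝓝 m ∧ s ∉ thickTeeth := by
  obtain ⟨k, hk⟩ := exists_nat_gt (ε⁻¹ + 2)
  have hε' : 0 < ε⁻¹ := inv_pos.2 hε
  have hpi := Real.pi_gt_three
  have hpi4 := Real.pi_lt_four
  have hs : ε⁻¹ < -(Real.pi / 2) + k * (2 * Real.pi) := by nlinarith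
  have hs0 : 0 < -(Real.pi / 2) + k * (2 * Real.pi) := hε'.trans hs
  have hm : -(Real.pi / 2) + k * (2 * Real.pi) < Real.pi / 2 + k * (2 * Real.pi) := by linarith
  have hcont : ∀ x : ℝ, 0 < x → ContinuousAt (fun x : ℝ => Real.sin x⁻¹) x := fun x hx =>
    Real.continuous_sin.continuousAt.comp (continuousAt_inv₀ hx.ne')
  refine ⟨(Real.pi / 2 + k * (2 * Real.pi))⁻¹, (-(Real.pi / 2) + k * (2 * Real.pi))⁻¹,
    by positivity, inv_strictAnti₀ hs0 hm, inv_lt_of_inv_lt₀ hε hs, ?_, ?_⟩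
  · refine Filter.mem_of_superset ?_ subset_closure
    refine (lt_mem_nhds (by positivity)).and ((hcont _ (by positivity)).eventually
      (lt_mem_nhds ?_))
    simp only
    rw [inv_inv, Real.sin_add_nat_mul_two_pi, Real.sin_pi_div_two]
    exact one_pos
  · rw [thickTeeth, mem_closure_iff_frequently, Filter.not_frequently]
    have hneg : Real.sin (-(Real.pi / 2) + k * (2 * Real.pi))⁻¹⁻¹ < 0 := by
      rw [inv_inv, Real.sin_add_nat_mul_two_pi, Real.sin_neg, Real.sin_pi_div_two]
      norm_num
    filter_upwards [(hcont _ (inv_pos.2 hs0)).eventually (gt_mem_nhds hneg)] with x hx h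
    exact lt_asymm hx h.2

/-- The complement contains the half-plane below the base, onto which its nearby points can be
brought vertically. The frontier contains no point over the interior of a tooth at heights below 1,
not even on the base, so each tooth near the origin disconnects it. -/
theorem separates_g1_f4 : Separates .g1 .f4 := by
  have hT : IsClosed thickTeeth := isClosed_closure
  have ho := isOpen_comb hT
  have h0c : ((0, 0) : ℝ × ℝ) ∉ comb thickTeeth := fun h => lt_irrefl _ h.1.1
  have hfr : ∀ s, 0 < s → s < 1 → s ∉ thickTeeth → (s, 0) ∈ frontier (comb thickTeeth) := by
    intro s hs hs1 hsT
    rw [ho.frontier_eq]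
    exact ⟨mem_closure_comb ⟨hs, hs1⟩ hsT (by simp), fun h => lt_irrefl _ h.2.1.1⟩
  have h0f : ((0, 0) : ℝ × ℝ) ∈ frontier (comb thickTeeth) := by
    rw [← isClosed_frontier.closure_eq, Metric.mem_closure_iff]
    intro ε hε
    obtain ⟨m, s, hm, hms, hsε, -, hs⟩ := exists_thickTeeth (ε := min ε 1) (by positivity)
    rw [lt_min_iff] at hsε
    refine ⟨(s, 0), hfr s (hm.trans hms) hsε.2 hs, ?_⟩
    rw [dist_comm, ← mem_ball, mem_ball_prod]
    simp only [sub_zero, abs_lt]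
    refine ⟨⟨?_, ?_⟩, ?_, ?_⟩ <;> linarith
  refine ⟨comb thickTeeth, (0, 0), ho, isBounded_comb, simplyConnectedSpace_comb, h0f, ?_, ?_⟩
  · intro r hr
    obtain ⟨ε, hε, hεr, hε1⟩ : ∃ ε : ℝ, 0 < ε ∧ ε ≤ r ∧ ε ≤ 1 :=
      ⟨min r 1, by positivity, min_le_left _ _, min_le_right _ _⟩
    refine ⟨ball (0, 0) ε, isOpen_ball, mem_ball_self hε, fun p hp => ball_subset_ball hεr hp.1,
      isPathConnected_of_joinedIn (isPathConnected_singleton ((0, 0) : ℝ × ℝ))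
        (singleton_subset_iff.2 ⟨mem_ball_self hε, h0c⟩) ?_⟩
    rintro ⟨x, y⟩ ⟨hb, hn⟩
    refine ⟨_, rfl, ?_⟩
    simp only [mem_ball_prod, sub_zero, abs_lt] at hb
    have h1 : JoinedIn (ball (0, 0) ε ∩ (comb thickTeeth)ᶜ) (x, y) (x, 0) := by
      refine joinedIn_vertical fun s hs => ⟨?_, ?_⟩
      · rw [mem_uIcc] at hs
        simp only [mem_ball_prod, sub_zero, abs_lt]
        refine ⟨hb.1, ?_, ?_⟩ <;> rcases hs with hs | hs <;> linarith
      · rintro ⟨h1, h2, h3⟩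
        simp only at h1 h2 h3
        rw [mem_uIcc] at hs
        rcases hs with hs | hs
        · linarith
        · refine hn ⟨h1, ⟨by simp only; linarith, by simp only; linarith⟩,
            h3.imp (fun h => ?_) id⟩
          simp only; linarith
    have h2 : JoinedIn (ball (0, 0) ε ∩ (comb thickTeeth)ᶜ) (x, 0) (0, 0) := by
      refine joinedIn_horizontal fun s hs => ⟨?_, fun h => lt_irrefl _ h.2.1.1⟩
      rw [mem_uIcc] at hs
      simp only [mem_ball_prod, sub_zero, abs_lt]
      refine ⟨⟨?_, ?_⟩, ?_, ?_⟩ <;> rcases hs with hs | hs <;> linarith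
    exact h1.trans h2
  · intro h
    obtain ⟨A, hAS, hAr, hA, U, hU, hxU, hUA⟩ := h (1 / 2) (by norm_num)
    obtain ⟨η, hη, hηU⟩ := Metric.isOpen_iff.1 hU _ hxU
    obtain ⟨m, s, hm, hms, hsε, hmT, hs⟩ := exists_thickTeeth (ε := min η 1) (by positivity)
    rw [lt_min_iff] at hsε
    have h1 : ((s, 0) : ℝ × ℝ) ∈ A := by
      refine hUA ⟨hηU ?_, hfr s (hm.trans hms) hsε.2 hs⟩
      simp only [mem_ball_prod, sub_zero, abs_lt]
      refine ⟨⟨?_, ?_⟩, ?_, ?_⟩ <;> linarith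
    obtain ⟨z, hz, rfl⟩ := hA.isPreconnected.exists_fst_eq (hUA ⟨hxU, h0f⟩) h1 hm.le hms.le
    have hb := hAr hz
    simp only [mem_ball_prod, sub_zero, abs_lt] at hb
    have hzc := (ho.frontier_eq ▸ hAS hz).1
    rw [mem_closure_iff_frequently] at hzc
    have e1 : ∀ᶠ p : ℝ × ℝ in 𝓝 z, p.1 ∈ thickTeeth := continuous_fst.continuousAt hmT
    have e2 : ∀ᶠ p : ℝ × ℝ in 𝓝 z, p.2 < 1 :=
      continuous_snd.continuousAt (gt_mem_nhds (by linarith))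
    obtain ⟨p, hp, hp1, hp2⟩ := (hzc.and_eventually (e1.and e2)).exists
    rcases hp.2.2 with h | h
    · exact lt_asymm h hp2
    · exact h hp1

end Comb

theorem convex_setOf_lt (a b c : ℝ) : Convex ℝ {p : ℝ × ℝ | a * p.1 + b * p.2 < c} :=
  convex_halfSpace_lt (f := fun p : ℝ × ℝ => a * p.1 + b * p.2)
    ⟨fun p q => by simp only [Prod.fst_add, Prod.snd_add]; ring,
      fun t p => by simp only [Prod.smul_fst, Prod.smul_snd, smul_eq_mul]; ring⟩ c

/-! ### A fan of slits issuing from the boundary point -/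

section Fan

/-- The triangle `0 < y < x < 2` with the segments of slope `1, 1 / 2, 1 / 3, …` from the origin to
the line `x = 1` removed. -/
def fan : Set (ℝ × ℝ) :=
  {p | (0 < p.1 ∧ p.1 < 2) ∧ (0 < p.2 ∧ p.2 < p.1) ∧ (1 < p.1 ∨ p.2 / p.1 ∉ reciprocals)}

theorem continuousOn_slope : ContinuousOn (fun p : ℝ × ℝ => p.2 / p.1) {p | 0 < p.1} :=
  continuousOn_snd.div continuousOn_fst fun p (hp : 0 < p.1) => hp.ne'

theorem isOpen_fan : IsOpen fan := by
  have h1 : IsOpen ({p : ℝ × ℝ | 0 < p.1} ∩ (fun p => p.2 / p.1) ⁻¹' reciprocalsᶜ) :=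
    continuousOn_slope.isOpen_inter_preimage (isOpen_lt (by fun_prop) (by fun_prop))
      isClosed_reciprocals.isOpen_compl
  have h2 : IsOpen {p : ℝ × ℝ | (0 < p.1 ∧ p.1 < 2) ∧ (0 < p.2 ∧ p.2 < p.1)} := by
    refine ((?_ : IsOpen _).and ?_).and ((?_ : IsOpen _).and ?_) <;>
      exact isOpen_lt (by fun_prop) (by fun_prop)
  have h3 : IsOpen {p : ℝ × ℝ | 1 < p.1} := isOpen_lt (by fun_prop) (by fun_prop)
  convert h2.inter (h3.union h1) using 1
  ext p
  constructor
  · rintro ⟨a, b, c⟩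
    exact ⟨⟨a, b⟩, c.imp id fun h => ⟨a.1, h⟩⟩
  · rintro ⟨⟨a, b⟩, c⟩
    exact ⟨a, b, c.imp id fun h => h.2⟩

theorem isBounded_fan : Bornology.IsBounded fan := by
  refine isBounded_ball.subset (t := ball (0, 0) 3) ?_
  rintro p ⟨h1, h2, -⟩
  rw [mem_ball_prod, abs_lt, abs_lt]
  refine ⟨⟨?_, ?_⟩, ?_, ?_⟩ <;> simp only [sub_zero] <;> linarith

/-- Points move outwards along rays from the origin. The slope is preserved, so no slit is met on
the way to the convex part x > 1. -/
theorem simplyConnectedSpace_fan : SimplyConnectedSpace fan := by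
  set S : Set (ℝ × ℝ) := {p | (1 < p.1 ∧ p.1 < 2) ∧ (0 < p.2 ∧ p.2 < p.1)} with hS
  have hsub : S ⊆ fan := fun p hp => ⟨⟨by linarith [hp.1.1], hp.1.2⟩, hp.2, .inl hp.1.1⟩
  have hconv : Convex ℝ S := by
    have h := ((convex_setOf_lt (-1) 0 (-1)).inter (convex_setOf_lt 1 0 2)).inter
      ((convex_setOf_lt 0 (-1) 0).inter (convex_setOf_lt (-1) 1 0))
    convert h using 1
    ext p
    simp only [hS, mem_inter_iff, mem_ofPred_eq]
    constructor
    · rintro ⟨⟨h1, h2⟩, h3, h4⟩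
      refine ⟨⟨?_, ?_⟩, ?_, ?_⟩ <;> linarith
    · rintro ⟨⟨h1, h2⟩, h3, h4⟩
      refine ⟨⟨?_, ?_⟩, ?_, ?_⟩ <;> linarith
  have h1 : DeformsInto fan fan S := by
    refine .of_continuousOn (fun q => (max q.1.1 (q.2 * (3 / 2)),
      q.1.2 / q.1.1 * max q.1.1 (q.2 * (3 / 2)))) ?_ ?_ ?_ ?_ hsub
    · refine ContinuousOn.prodMk (by fun_prop) (ContinuousOn.mul ?_ (by fun_prop))
      exact continuousOn_slope.comp continuousOn_fst fun q hq => hq.1.1.1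
    · rintro p ⟨h1, h2, h3⟩ t ⟨ht, ht'⟩
      have hp : 0 < p.2 / p.1 := div_pos h2.1 h1.1
      have hp1 : p.2 / p.1 < 1 := (div_lt_one h1.1).2 h2.2
      have hm : 0 < max p.1 (t * (3 / 2)) := lt_max_of_lt_left h1.1
      refine ⟨⟨hm, max_lt h1.2 (by linarith)⟩, ⟨mul_pos hp hm, mul_lt_of_lt_one_left hm hp1⟩,
        h3.imp (fun h => lt_max_of_lt_left h) fun h => ?_⟩
      simp only
      rwa [mul_div_cancel_right₀ _ hm.ne']
    · rintro p ⟨h1, h2, h3⟩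
      ext
      · simp [h1.1.le]
      · simp [h1.1.le, h1.1.ne']
    · rintro p ⟨h1, h2, h3⟩
      have hp : 0 < p.2 / p.1 := div_pos h2.1 h1.1
      have hp1 : p.2 / p.1 < 1 := (div_lt_one h1.1).2 h2.2
      have hm : 0 < max p.1 (1 * (3 / 2)) := lt_max_of_lt_left h1.1
      exact ⟨⟨lt_max_of_lt_right (by norm_num), max_lt h1.2 (by norm_num)⟩,
        mul_pos hp hm, mul_lt_of_lt_one_left hm hp1⟩
  have hc : ((3 / 2, 1 / 2) : ℝ × ℝ) ∈ S := by
    constructor <;> constructor <;> norm_num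
  exact (h1.trans (.of_starConvex (hconv.starConvex hc) hc hsub)).simplyConnectedSpace

theorem mem_fan_of_slope {x σ : ℝ} (hx : 0 < x) (hx2 : x < 2) (hσ : 0 < σ) (hσ1 : σ < 1)
    (hσT : σ ∉ reciprocals) : (x, σ * x) ∈ fan := by
  refine ⟨⟨hx, hx2⟩, ⟨mul_pos hσ hx, mul_lt_of_lt_one_left hx hσ1⟩, .inr ?_⟩
  simp only
  rwa [mul_div_cancel_right₀ _ hx.ne']

/-- Radial segments to the origin stay in Ω, whereas infinitely many sectors between consecutive
slits reach into every neighbourhood of the origin and are separated by the slits. -/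
theorem separates_a_d : Separates .a .d := by
  refine ⟨fan, (0, 0), isOpen_fan, isBounded_fan, simplyConnectedSpace_fan, ?_, ?_, ?_⟩
  · rw [isOpen_fan.frontier_eq]
    refine ⟨Metric.mem_closure_iff.2 fun ε hε => ?_, fun h => lt_irrefl _ h.1.1⟩
    obtain ⟨σ, hσT, hσ0, hσ1⟩ := exists_notMem_reciprocals (zero_lt_one (α := ℝ))
    obtain ⟨x, hx, hxε, hx1⟩ : ∃ x : ℝ, 0 < x ∧ x < ε ∧ x < 2 :=
      ⟨min ε 1 / 2, by positivity, by linarith [min_le_left ε 1], by linarith [min_le_right ε 1]⟩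
    refine ⟨_, mem_fan_of_slope hx hx1 hσ0 hσ1 hσT, ?_⟩
    rw [dist_comm, ← mem_ball, mem_ball_prod]
    simp only [sub_zero, abs_lt]
    refine ⟨⟨?_, ?_⟩, ?_, ?_⟩ <;> nlinarith
  · intro r hr
    refine ⟨min r 1, by positivity, ?_⟩
    rintro ⟨x, y⟩ ⟨hb, hx, hy, h⟩
    simp only [mem_ball_prod, sub_zero, lt_min_iff, abs_lt] at hb hx hy h
    refine ⟨⟨⟨fun t => ((1 - t) * x, (1 - t) * y), by fun_prop⟩, by simp, by simp⟩, fun t ht => ?_⟩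
    have ht1 : (t : ℝ) < 1 := ht
    have ht0 : (0 : ℝ) ≤ t := t.2.1
    obtain ⟨u, hu, hu1, hut⟩ : ∃ u : ℝ, 0 < u ∧ u ≤ 1 ∧ u = 1 - t :=
      ⟨1 - t, by linarith, by linarith, rfl⟩
    change ((1 - (t : ℝ)) * x, (1 - (t : ℝ)) * y) ∈ _
    rw [← hut]
    have h1 : u * x ≤ x := mul_le_of_le_one_left hx.1.le hu1
    have h2 : u * y ≤ y := mul_le_of_le_one_left hy.1.le hu1
    have h3 : 0 < u * x := mul_pos hu hx.1
    have h4 : 0 < u * y := mul_pos hu hy.1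
    refine ⟨?_, ⟨h3, by simp only; linarith⟩, ⟨h4, mul_lt_mul_of_pos_left hy.2 hu⟩, .inr ?_⟩
    · simp only [mem_ball_prod, sub_zero, abs_lt]
      refine ⟨⟨?_, ?_⟩, ?_, ?_⟩ <;> linarith
    · simp only
      rw [mul_div_mul_left _ _ hu.ne']
      exact h.resolve_left (by linarith)
  · intro h
    obtain ⟨G, hG, hxG, hGb, hfin⟩ := h 1 one_pos
    obtain ⟨η, hη, hηG⟩ := Metric.isOpen_iff.1 hG _ hxG
    obtain ⟨x, hx, hxη, hx1⟩ : ∃ x : ℝ, 0 < x ∧ x < η ∧ x < 2 :=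
      ⟨min η 1 / 2, by positivity, by linarith [min_le_left η 1], by linarith [min_le_right η 1]⟩
    have hlt : ∀ n : ℕ, ((n + 2 : ℕ) : ℝ)⁻¹ < ((n + 1 : ℕ) : ℝ)⁻¹ := fun n =>
      inv_strictAnti₀ (by positivity) (by push_cast; linarith)
    -- One slope in each gap between 1/(n+2) and 1/(n+1). A component containing points of two such
    -- slopes would contain a point of slope 1/(n+2), by the intermediate value theorem.
    choose σ hσT hσl hσu using fun n => exists_notMem_reciprocals (hlt n)
    have hσ0 : ∀ n, 0 < σ n := fun n => lt_trans (by positivity) (hσl n)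
    have hσ1 : ∀ n, σ n < 1 := fun n =>
      (hσu n).trans_le (inv_le_one_of_one_le₀ (by push_cast; linarith [n.cast_nonneg (α := ℝ)]))
    have hmem : ∀ n, (x, σ n * x) ∈ G ∩ fan := by
      refine fun n => ⟨hηG ?_, mem_fan_of_slope hx hx1 (hσ0 n) (hσ1 n) (hσT n)⟩
      have h1 := mul_pos (hσ0 n) hx
      have h2 := mul_lt_of_lt_one_left hx (hσ1 n)
      simp only [mem_ball_prod, sub_zero, abs_lt]
      refine ⟨⟨?_, ?_⟩, ?_, ?_⟩ <;> linarith
    have key : ∀ n m, n < m → connectedComponentIn (G ∩ fan) (x, σ n * x) ≠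
        connectedComponentIn (G ∩ fan) (x, σ m * x) := by
      intro n m hnm heq
      have h1 := mem_connectedComponentIn (hmem n)
      have h2 := mem_connectedComponentIn (hmem m)
      rw [← heq] at h2
      have hsub := connectedComponentIn_subset (G ∩ fan) (x, σ n * x)
      have hm : σ m ≤ ((n + 2 : ℕ) : ℝ)⁻¹ :=
        (hσu m).le.trans (inv_anti₀ (by positivity) (by exact_mod_cast Nat.succ_le_succ hnm))
      obtain ⟨z, hz, hzs⟩ := isPreconnected_connectedComponentIn.intermediate_value h2 h1
        (continuousOn_slope.mono fun p hp => (hsub hp).2.1.1)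
        (show ((n + 2 : ℕ) : ℝ)⁻¹ ∈ Icc _ _ by
          simp only [mul_div_cancel_right₀ _ hx.ne']
          exact ⟨hm, (hσl n).le⟩)
      have hb := hGb (hsub hz).1
      simp only [mem_ball_prod, sub_zero, abs_lt] at hb
      rcases (hsub hz).2.2.2 with h | h
      · linarith
      · refine h ?_
        rw [show z.2 / z.1 = _ from hzs]
        exact mem_range_self (n + 2)
    have hcomp : ∀ n : ℕ, connectedComponentIn (G ∩ fan) (x, σ n * x) ∈ componentsOf (G ∩ fan) :=
      fun n => ⟨_, hmem n, rfl⟩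
    refine infinite_of_injective_forall_mem (fun n m hnm => ?_) hcomp hfin
    rcases lt_trichotomy n m with h | h | h
    · exact absurd hnm (key n m h)
    · exact h
    · exact absurd hnm.symm (key m n h)

end Fan

/-! ### Frontiers of slit domains and connectedness through fibres -/

theorem frontier_sdiff_of_dense {X : Type*} [TopologicalSpace X] {R C : Set X} (hR : IsOpen R)
    (hC : IsClosed C) (hd : Dense Cᶜ) : frontier (R \ C) = closure R \ (R \ C) := by
  rw [(hR.sdiff hC).frontier_eq]
  congr 1
  refine Subset.antisymm (closure_mono sdiff_subset) ?_
  exact closure_minimal (hd.open_subset_closure_inter hR) isClosed_closure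

/-- If two closed sets that meet K cover it, compactness makes the projections of the two parts
closed. These then share a point, and the connected fibre over it meets both sets. -/
theorem isPreconnected_of_fibers {K : Set (ℝ × ℝ)} (hK : IsCompact K)
    (hI : IsPreconnected (Prod.fst '' K)) (hF : ∀ x, IsPreconnected {y | (x, y) ∈ K}) :
    IsPreconnected K := by
  rw [isPreconnected_closed_iff] at hI ⊢
  intro t t' ht ht' hcov ⟨p, hp⟩ ⟨p', hp'⟩
  have hc : ∀ u : Set (ℝ × ℝ), IsClosed u → IsClosed (Prod.fst '' (K ∩ u)) := fun u hu =>
    ((hK.inter_right hu).image continuous_fst).isClosed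
  obtain ⟨_, -, ⟨⟨x, y⟩, hy, rfl⟩, ⟨⟨x', y'⟩, hy', rfl⟩⟩ := hI _ _ (hc t ht) (hc t' ht')
    (by
      rintro _ ⟨q, hq, rfl⟩
      exact (hcov hq).imp (fun h => ⟨q, ⟨hq, h⟩, rfl⟩) fun h => ⟨q, ⟨hq, h⟩, rfl⟩)
    ⟨_, ⟨p, hp.1, rfl⟩, ⟨p, hp, rfl⟩⟩ ⟨_, ⟨p', hp'.1, rfl⟩, ⟨p', hp', rfl⟩⟩
  have h := (hF x').image (fun y => (x', y)) (by fun_prop)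
  rw [isPreconnected_closed_iff] at h
  obtain ⟨_, ⟨z, hz, rfl⟩, hzt⟩ := h t t' ht ht' (by
    rintro _ ⟨z, hz, rfl⟩
    exact hcov hz) ⟨_, ⟨y, hy.1, rfl⟩, hy.2⟩ ⟨_, ⟨y', hy'.1, rfl⟩, hy'.2⟩
  exact ⟨_, hz, hzt⟩

/-! ### A square slit along a chain of topologist's sine curves -/

section Slit

/-- The open square `(-1, 1)²`. -/
def openSquare : Set (ℝ × ℝ) := Ioo (-1) 1 ×ˢ Ioo (-1) 1

theorem isOpen_openSquare : IsOpen openSquare := isOpen_Ioo.prod isOpen_Ioo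

theorem ball_subset_openSquare {ε : ℝ} (hε : ε ≤ 1) : ball ((0, 0) : ℝ × ℝ) ε ⊆ openSquare := by
  intro p hp
  simp only [mem_ball_prod, sub_zero, abs_lt] at hp
  refine ⟨⟨?_, ?_⟩, ?_, ?_⟩ <;> linarith

/-- The part of the square `(-1, 1)²` outside a sector around the positive first axis. -/
def outsideSector : Set (ℝ × ℝ) := {p | p ∈ openSquare ∧ p.1 < 2 * |p.2|}

theorem starConvex_outsideSector : StarConvex ℝ (-1 / 2, 0) outsideSector := by
  rintro p ⟨hp, hp'⟩ a b ha hb hab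
  have hc : ((-1 / 2, 0) : ℝ × ℝ) ∈ openSquare := by
    constructor <;> constructor <;> norm_num
  refine ⟨((convex_Ioo _ _).prod (convex_Ioo _ _)) hc hp ha hb hab, ?_⟩
  simp only [Prod.smul_mk, Prod.fst_add, Prod.snd_add, Prod.smul_fst, Prod.smul_snd, smul_eq_mul,
    mul_zero, zero_add, abs_mul, abs_of_nonneg hb]
  rcases hb.eq_or_lt with rfl | hb'
  · have : a = 1 := by linarith
    subst this
    norm_num
  · nlinarith [mul_lt_mul_of_pos_left hp' hb']

theorem outsideSector_center_mem : ((-1 / 2, 0) : ℝ × ℝ) ∈ outsideSector :=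
  ⟨by constructor <;> constructor <;> norm_num, by norm_num⟩

/-- A function on `(0, ∞)` that oscillates between the lines of slope `±1 / 4` at every reciprocal
of a natural number. -/
noncomputable def oscillation (x : ℝ) : ℝ := x / 4 * Real.sin (infDist x reciprocals)⁻¹

theorem infDist_reciprocals_pos {x : ℝ} (hx : x ∉ reciprocals) : 0 < infDist x reciprocals :=
  (isClosed_reciprocals.notMem_iff_infDist_pos ⟨0, zero_mem_reciprocals⟩).1 hx

theorem continuousOn_oscillation : ContinuousOn oscillation reciprocalsᶜ :=
  (by fun_prop : Continuous fun x : ℝ => x / 4).continuousOn.mul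
    (Real.continuous_sin.comp_continuousOn
      ((continuous_infDist_pt reciprocals).continuousOn.inv₀ fun _ hx =>
        (infDist_reciprocals_pos hx).ne'))

theorem abs_oscillation_le {x : ℝ} (hx : 0 ≤ x) : |oscillation x| ≤ x / 4 := by
  rw [oscillation, abs_mul, abs_of_nonneg (by positivity : 0 ≤ x / 4)]
  exact mul_le_of_le_one_right (by positivity) (Real.abs_sin_le_one _)

/-- A chain of topologist's sine curves that shrink to the origin. -/
def sineChain : Set (ℝ × ℝ) :=
  {p | 0 ≤ p.1 ∧ |p.2| ≤ p.1 / 4 ∧ (p.1 ∉ reciprocals → p.2 = oscillation p.1)}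

theorem isOpen_off_oscillation {s : Set ℝ} (hs : IsOpen s) :
    IsOpen {p : ℝ × ℝ | p.1 ∉ reciprocals ∧ p.2 - oscillation p.1 ∈ s} := by
  have h : ContinuousOn (fun p : ℝ × ℝ => p.2 - oscillation p.1) (Prod.fst ⁻¹' reciprocalsᶜ) :=
    continuousOn_snd.sub (continuousOn_oscillation.comp continuousOn_fst fun p hp => hp)
  exact h.isOpen_inter_preimage (isClosed_reciprocals.isOpen_compl.preimage continuous_fst) hs

theorem isClosed_sineChain : IsClosed sineChain := by
  have h1 : IsClosed {p : ℝ × ℝ | 0 ≤ p.1} := isClosed_le (by fun_prop) (by fun_prop)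
  have h2 : IsClosed {p : ℝ × ℝ | |p.2| ≤ p.1 / 4} := isClosed_le (by fun_prop) (by fun_prop)
  have h3 := (isOpen_off_oscillation (isOpen_compl_singleton (x := (0 : ℝ)))).isClosed_compl
  convert h1.inter (h2.inter h3) using 1
  ext p
  simp [sineChain, sub_eq_zero]

theorem dense_compl_sineChain : Dense sineChainᶜ := by
  refine fun p => Metric.mem_closure_iff.2 fun ε hε => ?_
  obtain ⟨x, hxT, hx1, hx2⟩ := exists_notMem_reciprocals (show p.1 < p.1 + ε by linarith)
  obtain ⟨y, hy1, hy2⟩ : ∃ y : ℝ, |y - p.2| < ε ∧ y ≠ oscillation x := by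
    by_cases h : p.2 = oscillation x
    · exact ⟨p.2 + ε / 2, by rw [add_sub_cancel_left, abs_of_pos] <;> linarith, by linarith⟩
    · exact ⟨p.2, by simpa using hε, h⟩
  refine ⟨(x, y), fun h => hy2 (h.2.2 hxT), ?_⟩
  rw [dist_comm, ← mem_ball, mem_ball_prod]
  exact ⟨by rw [abs_of_pos] <;> simp only <;> linarith, hy1⟩

/-- The square `(-1, 1)²` with a chain of topologist's sine curves removed. -/
def sineSlit : Set (ℝ × ℝ) := openSquare \ sineChain

theorem isOpen_sineSlit : IsOpen sineSlit := isOpen_openSquare.sdiff isClosed_sineChain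

theorem isBounded_sineSlit : Bornology.IsBounded sineSlit :=
  ((isBounded_Ioo _ _).prod (isBounded_Ioo _ _)).subset sdiff_subset

theorem mem_frontier_sineSlit {p : ℝ × ℝ} (hp : p ∈ openSquare) :
    p ∈ frontier sineSlit ↔ p ∈ sineChain := by
  rw [sineSlit, frontier_sdiff_of_dense isOpen_openSquare isClosed_sineChain dense_compl_sineChain]
  constructor
  · intro h
    by_contra hc
    exact h.2 ⟨hp, hc⟩
  · exact fun h => ⟨subset_closure hp, fun hc => hc.2 h⟩

/-- The points above the chain of sine curves. -/
def aboveChain : Set (ℝ × ℝ) :=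
  {p | 0 < p.1 ∧ (p.1 / 4 < p.2 ∨ (p.1 ∉ reciprocals ∧ p.2 - oscillation p.1 ∈ Ioi 0))}

/-- The points below the chain of sine curves. -/
def belowChain : Set (ℝ × ℝ) :=
  {p | 0 < p.1 ∧ (p.2 < -(p.1 / 4) ∨ (p.1 ∉ reciprocals ∧ p.2 - oscillation p.1 ∈ Iio 0))}

theorem isOpen_aboveChain : IsOpen aboveChain := by
  have h1 : IsOpen {p : ℝ × ℝ | 0 < p.1} := isOpen_lt (by fun_prop) (by fun_prop)
  have h2 : IsOpen {p : ℝ × ℝ | p.1 / 4 < p.2} := isOpen_lt (by fun_prop) (by fun_prop)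
  exact h1.inter (h2.union (isOpen_off_oscillation isOpen_Ioi))

theorem isOpen_belowChain : IsOpen belowChain := by
  have h1 : IsOpen {p : ℝ × ℝ | 0 < p.1} := isOpen_lt (by fun_prop) (by fun_prop)
  have h2 : IsOpen {p : ℝ × ℝ | p.2 < -(p.1 / 4)} := isOpen_lt (by fun_prop) (by fun_prop)
  exact h1.inter (h2.union (isOpen_off_oscillation isOpen_Iio))

theorem neg_lt_of_mem_aboveChain {p : ℝ × ℝ} (hp : p ∈ aboveChain) : -(p.1 / 4) < p.2 := by
  obtain ⟨h0, h | ⟨-, h⟩⟩ := hp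
  · linarith
  · have := (abs_le.1 (abs_oscillation_le h0.le)).1
    simp only [mem_Ioi] at h
    linarith

theorem lt_of_mem_belowChain {p : ℝ × ℝ} (hp : p ∈ belowChain) : p.2 < p.1 / 4 := by
  obtain ⟨h0, h | ⟨-, h⟩⟩ := hp
  · linarith
  · have := (abs_le.1 (abs_oscillation_le h0.le)).2
    simp only [mem_Iio] at h
    linarith

theorem notMem_aboveChain_of_mem_belowChain {p : ℝ × ℝ} (hp : p ∈ belowChain) :
    p ∉ aboveChain := by
  intro hp'
  have h1 := neg_lt_of_mem_aboveChain hp'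
  have h2 := lt_of_mem_belowChain hp
  obtain ⟨h0, h | ⟨-, h⟩⟩ := hp
  · linarith
  · obtain ⟨h0, h' | ⟨-, h'⟩⟩ := hp'
    · linarith
    · exact lt_asymm (mem_Iio.1 h) (mem_Ioi.1 h')

theorem notMem_sineChain_of_mem_aboveChain {p : ℝ × ℝ} (hp : p ∈ aboveChain) :
    p ∉ sineChain := by
  rintro ⟨h0, h1, h2⟩
  obtain ⟨-, h | ⟨hT, h⟩⟩ := hp
  · linarith [le_abs_self p.2]
  · simp [h2 hT] at h

theorem notMem_sineChain_of_mem_belowChain {p : ℝ × ℝ} (hp : p ∈ belowChain) :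
    p ∉ sineChain := by
  rintro ⟨h0, h1, h2⟩
  obtain ⟨-, h | ⟨hT, h⟩⟩ := hp
  · linarith [neg_abs_le p.2]
  · simp [h2 hT] at h

theorem mem_above_or_below_of_notMem_sineChain {p : ℝ × ℝ} (hp : p ∉ sineChain) (h0 : 0 < p.1) :
    p ∈ aboveChain ∨ p ∈ belowChain := by
  by_cases hT : p.1 ∈ reciprocals
  · have h1 : p.1 / 4 < |p.2| := by
      by_contra! hc
      exact hp ⟨h0.le, hc, fun h => absurd hT h⟩
    rcases lt_abs.1 h1 with h | h
    · exact .inl ⟨h0, .inl h⟩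
    · exact .inr ⟨h0, .inl (by linarith)⟩
  · rcases lt_trichotomy p.2 (oscillation p.1) with h | h | h
    · exact .inr ⟨h0, .inr ⟨hT, sub_neg.2 h⟩⟩
    · exact absurd ⟨h0.le, h ▸ abs_oscillation_le h0.le, fun _ => h⟩ hp
    · exact .inl ⟨h0, .inr ⟨hT, sub_pos.2 h⟩⟩

theorem aboveChain_mono {x y y' : ℝ} (h : (x, y) ∈ aboveChain) (hy : y ≤ y') :
    (x, y') ∈ aboveChain := by
  refine ⟨h.1, h.2.imp (fun h => lt_of_lt_of_le h hy) fun h => ⟨h.1, ?_⟩⟩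
  have := h.2
  simp only [mem_Ioi] at this ⊢
  linarith

theorem belowChain_mono {x y y' : ℝ} (h : (x, y) ∈ belowChain) (hy : y' ≤ y) :
    (x, y') ∈ belowChain := by
  refine ⟨h.1, h.2.imp (fun h => lt_of_le_of_lt hy h) fun h => ⟨h.1, ?_⟩⟩
  have := h.2
  simp only [mem_Iio] at this ⊢
  linarith

theorem lt_abs_of_mem_sineSlit {p : ℝ × ℝ} (hp : p ∈ sineSlit) (h0 : p.1 ≤ 0) : p.1 < |p.2| := by
  refine lt_of_le_of_ne (h0.trans (abs_nonneg _)) fun h => hp.2 ?_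
  have h1 : p.1 = 0 := le_antisymm h0 (h ▸ abs_nonneg _)
  refine ⟨h1.ge, by rw [← h, h1]; norm_num, fun hT => absurd zero_mem_reciprocals (h1 ▸ hT)⟩

/-- Points above the chain are pushed up and points below it down, until they leave the sector
around the chain; what remains is star-shaped. -/
theorem simplyConnectedSpace_sineSlit : SimplyConnectedSpace sineSlit := by
  classical
  have hsub : outsideSector ⊆ sineSlit := by
    rintro p ⟨hp, hp'⟩
    exact ⟨hp, fun h => by linarith [h.1, h.2.1]⟩
  -- The barrier has slope 2t - 1. At t = 0 it lies beyond the chain and moves nothing, since the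
  -- chain has |y| ≤ x/4; at t = 1 it has slope 1. The map is the identity where x < |y|, which
  -- gives continuity across the axis x = 0.
  let H : (ℝ × ℝ) × ℝ → ℝ × ℝ := fun q =>
    if q.1 ∈ aboveChain then (q.1.1, max q.1.2 ((2 * q.2 - 1) * q.1.1))
    else if 0 < q.1.1 then (q.1.1, min q.1.2 (-((2 * q.2 - 1) * q.1.1))) else q.1
  have hHa : ∀ p t, p ∈ aboveChain → H (p, t) = (p.1, max p.2 ((2 * t - 1) * p.1)) := fun p t hp => if_pos hp
  have hHb : ∀ p t, p ∈ belowChain → H (p, t) = (p.1, min p.2 (-((2 * t - 1) * p.1))) := fun p t hp => by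
    simp only [H, if_neg (notMem_aboveChain_of_mem_belowChain hp), if_pos hp.1]
  have hHn : ∀ p t, p.1 ≤ 0 → H (p, t) = p := fun p t hp => by
    simp only [H, if_neg (not_lt.2 hp), if_neg fun h : p ∈ aboveChain => not_lt.2 hp h.1]
  have hHw : ∀ p ∈ sineSlit, ∀ t ∈ Icc (0 : ℝ) 1, p.1 < |p.2| → H (p, t) = p := by
    intro p hp t ht hlt
    rcases le_or_gt p.1 0 with h0 | h0
    · exact hHn p t h0
    have htp : (2 * t - 1) * p.1 ≤ p.1 := mul_le_of_le_one_left h0.le (by linarith [ht.2])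
    rcases mem_above_or_below_of_notMem_sineChain hp.2 h0 with h | h
    · have h1 := neg_lt_of_mem_aboveChain h
      rw [hHa p t h, max_eq_left]
      rcases lt_abs.1 hlt with h2 | h2 <;> linarith
    · have h1 := lt_of_mem_belowChain h
      rw [hHb p t h, min_eq_left]
      rcases lt_abs.1 hlt with h2 | h2 <;> linarith
  have h1 : DeformsInto sineSlit sineSlit outsideSector := by
    refine .of_continuousOn H ?_ ?_ ?_ ?_ hsub
    · refine continuousOn_of_locally_continuousOn ?_
      rintro ⟨p, t⟩ ⟨hp, ht⟩
      rcases le_or_gt p.1 0 with h0 | h0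
      · refine ⟨{q | q.1.1 < |q.1.2|}, isOpen_lt (by fun_prop) (by fun_prop),
          lt_abs_of_mem_sineSlit hp h0, ?_⟩
        exact continuousOn_fst.congr fun q hq => hHw q.1 hq.1.1 q.2 hq.1.2 hq.2
      rcases mem_above_or_below_of_notMem_sineChain hp.2 h0 with h | h
      · refine ⟨Prod.fst ⁻¹' aboveChain, isOpen_aboveChain.preimage continuous_fst, h, ?_⟩
        exact ContinuousOn.congr (f := fun q : (ℝ × ℝ) × ℝ => (q.1.1, max q.1.2 ((2 * q.2 - 1) * q.1.1)))
          (by fun_prop) fun q hq => hHa q.1 q.2 hq.2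
      · refine ⟨Prod.fst ⁻¹' belowChain, isOpen_belowChain.preimage continuous_fst, h, ?_⟩
        exact ContinuousOn.congr (f := fun q : (ℝ × ℝ) × ℝ => (q.1.1, min q.1.2 (-((2 * q.2 - 1) * q.1.1))))
          (by fun_prop) fun q hq => hHb q.1 q.2 hq.2
    · intro p hp t ht
      rcases le_or_gt p.1 0 with h0 | h0
      · rwa [hHn p t h0]
      have htp : (2 * t - 1) * p.1 ≤ p.1 := mul_le_of_le_one_left h0.le (by linarith [ht.2])
      have hR := hp.1
      simp only [openSquare, mem_prod, mem_Ioo] at hR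
      rcases mem_above_or_below_of_notMem_sineChain hp.2 h0 with h | h
      · rw [hHa p t h]
        exact ⟨⟨hR.1, lt_max_of_lt_left hR.2.1, max_lt hR.2.2 (by linarith)⟩,
          notMem_sineChain_of_mem_aboveChain (aboveChain_mono h (le_max_left _ _))⟩
      · rw [hHb p t h]
        exact ⟨⟨hR.1, lt_min hR.2.1 (by linarith), min_lt_of_left_lt hR.2.2⟩,
          notMem_sineChain_of_mem_belowChain (belowChain_mono h (min_le_left _ _))⟩
    · intro p hp
      rcases le_or_gt p.1 0 with h0 | h0
      · exact hHn p 0 h0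
      rcases mem_above_or_below_of_notMem_sineChain hp.2 h0 with h | h
      · have h1 := neg_lt_of_mem_aboveChain h
        rw [hHa p 0 h, max_eq_left (by linarith)]
      · have h1 := lt_of_mem_belowChain h
        rw [hHb p 0 h, min_eq_left (by linarith)]
    · intro p hp
      have hR := hp.1
      simp only [openSquare, mem_prod, mem_Ioo] at hR
      rcases le_or_gt p.1 0 with h0 | h0
      · rw [hHn p 1 h0]
        have := lt_abs_of_mem_sineSlit hp h0
        exact ⟨hp.1, by linarith [abs_nonneg p.2]⟩
      rcases mem_above_or_below_of_notMem_sineChain hp.2 h0 with h | h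
      · rw [hHa p 1 h]
        have h2 : p.1 ≤ max p.2 ((2 * 1 - 1) * p.1) := by
          refine le_max_of_le_right ?_; linarith
        refine ⟨⟨hR.1, lt_max_of_lt_left hR.2.1, max_lt hR.2.2 (by linarith)⟩, ?_⟩
        simp only
        rw [abs_of_pos] <;> linarith
      · rw [hHb p 1 h]
        have h2 : min p.2 (-((2 * 1 - 1) * p.1)) ≤ -p.1 := by
          refine min_le_of_right_le ?_; linarith
        refine ⟨⟨hR.1, lt_min hR.2.1 (by linarith), min_lt_of_left_lt hR.2.2⟩, ?_⟩
        simp only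
        rw [abs_of_neg] <;> linarith
  exact (h1.trans (.of_starConvex starConvex_outsideSector outsideSector_center_mem
    hsub)).simplyConnectedSpace

/-- The part up to any abscissa is compact, projects onto an interval, and has points or vertical
segments as fibres. -/
theorem isConnected_sineChain {ε : ℝ} (hε : 0 < ε) : IsConnected (sineChain ∩ {p | p.1 < ε}) := by
  have h0 : ((0, 0) : ℝ × ℝ) ∈ sineChain :=
    ⟨le_rfl, by norm_num, fun h => absurd zero_mem_reciprocals h⟩
  refine ⟨⟨(0, 0), h0, hε⟩, isPreconnected_of_forall (0, 0) fun p hp => ?_⟩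
  set K : Set (ℝ × ℝ) := sineChain ∩ {q | q.1 ≤ p.1} with hK
  refine ⟨K, fun q hq => ⟨hq.1, (show q.1 ≤ p.1 from hq.2).trans_lt hp.2⟩, ⟨h0, hp.1.1⟩, ⟨hp.1, le_refl p.1⟩,
    isPreconnected_of_fibers ?_ ?_ fun x => ?_⟩
  · refine (isCompact_Icc.prod isCompact_Icc : IsCompact (Icc (0 : ℝ) p.1 ×ˢ
      Icc (-p.1) p.1)).of_isClosed_subset
      (isClosed_sineChain.inter (isClosed_le (by fun_prop) (by fun_prop))) ?_
    rintro q ⟨⟨h1, h2, -⟩, h3⟩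
    have h3' : q.1 ≤ p.1 := h3
    have := abs_le.1 h2
    refine ⟨⟨h1, h3⟩, ?_, ?_⟩ <;> linarith
  · have : Prod.fst '' K = Icc 0 p.1 := by
      ext x
      constructor
      · rintro ⟨q, hq, rfl⟩
        exact ⟨hq.1.1, hq.2⟩
      · exact fun hx => ⟨(x, oscillation x), ⟨⟨hx.1, abs_oscillation_le hx.1, fun _ => rfl⟩, hx.2⟩,
          rfl⟩
    rw [this]
    exact isPreconnected_Icc
  · by_cases hx : x ∈ reciprocals
    · refine OrdConnected.isPreconnected ⟨fun a ha b hb c hc => ⟨⟨ha.1.1, ?_, fun h =>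
        absurd hx h⟩, ha.2⟩⟩
      have h1 := abs_le.1 ha.1.2.1
      have h2 := abs_le.1 hb.1.2.1
      simp only at h1 h2 ⊢
      rw [abs_le]
      exact ⟨h1.1.trans hc.1, hc.2.trans h2.2⟩
    · refine Set.Subsingleton.isPreconnected fun a ha b hb => ?_
      exact (ha.1.2.2 hx).trans (hb.1.2.2 hx).symm

theorem exists_sin_inv_eq {d : ℝ} (hd : 0 < d) : ∃ u v : ℝ, 0 < u ∧ u < d ∧ 0 < v ∧ v < d ∧
    Real.sin u⁻¹ = 1 ∧ Real.sin v⁻¹ = -1 := by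
  obtain ⟨k, hk⟩ := exists_nat_gt (d⁻¹ + 2)
  have hd' : 0 < d⁻¹ := inv_pos.2 hd
  have hpi := Real.pi_gt_three
  have hpi4 := Real.pi_lt_four
  have hs : d⁻¹ < -(Real.pi / 2) + k * (2 * Real.pi) := by nlinarith
  have hm : d⁻¹ < Real.pi / 2 + k * (2 * Real.pi) := by linarith
  refine ⟨(Real.pi / 2 + k * (2 * Real.pi))⁻¹, (-(Real.pi / 2) + k * (2 * Real.pi))⁻¹,
    inv_pos.2 (hd'.trans hm), inv_lt_of_inv_lt₀ hd hm, inv_pos.2 (hd'.trans hs),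
    inv_lt_of_inv_lt₀ hd hs, ?_, ?_⟩
  · rw [inv_inv, Real.sin_add_nat_mul_two_pi, Real.sin_pi_div_two]
  · rw [inv_inv, Real.sin_add_nat_mul_two_pi, Real.sin_neg, Real.sin_pi_div_two]

/-- A path cannot arrive at the line x = a for the first time at its end: just before, it would
follow the oscillating graph through heights near a/4 and near -a/4, contradicting continuity. -/
theorem exists_lt_one_fst_eq_of_path {w : ℝ × ℝ} (γ : Path ((0, 0) : ℝ × ℝ) w)
    (hγ : ∀ t, γ t ∈ sineChain) {a : ℝ} (ha : 0 < a) (haT : a ∈ reciprocals)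
    (haw : w.1 = a) : ∃ t < 1, (γ t).1 = a := by
  by_contra! hne
  obtain ⟨δ, hδ, hcont⟩ := Metric.continuousAt_iff.1 (γ.continuous_extend.continuousAt (x := 1))
    -- Within a/16 of w the abscissa exceeds 15a/16, so the extreme heights ±x/4 differ by more than
    -- 15a/32, while continuity allows less than a/8.
    (a / 16) (by positivity)
  set g := γ.extend with hg
  have hg1 : g 1 = w := γ.extend_one
  have hgm : ∀ t, g t ∈ sineChain := fun t => hγ _
  set t₁ := max (1 - δ / 2) 0 with ht₁
  have ht₁1 : t₁ < 1 := max_lt (by linarith) one_pos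
  have hnear : ∀ t ∈ Icc t₁ 1, |(g t).1 - a| < a / 16 ∧ |(g t).2 - w.2| < a / 16 := by
    intro t ht
    have h1 : dist t 1 < δ := by
      have := le_max_left (1 - δ / 2) 0
      rw [Real.dist_eq, abs_lt]
      constructor <;> linarith [ht.1, ht.2]
    have := hcont h1
    rwa [hg1, ← mem_ball, mem_ball_prod, haw] at this
  have hg1c : Continuous fun t => (g t).1 := continuous_fst.comp γ.continuous_extend
  have ht₁a : (g t₁).1 ≠ a := by
    have h1 : t₁ ∈ unitInterval := ⟨le_max_right _ _, ht₁1.le⟩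
    rw [hg, γ.extend_apply h1]
    exact hne _ ht₁1
  -- Passing over this x, the distance to the reciprocals is positive, and it is 0 at time 1. In
  -- between it takes all small values, in particular those where the sine is 1 and -1.
  obtain ⟨x, hxT, hx1, hx2⟩ := exists_notMem_reciprocals (min_lt_max.2 ht₁a)
  obtain ⟨t₂, ht₂, ht₂x⟩ := intermediate_value_uIcc (a := t₁) (b := 1)
    hg1c.continuousOn (show x ∈ uIcc (g t₁).1 (g 1).1 by rw [hg1, haw]; exact ⟨hx1.le, hx2.le⟩)
  simp only at ht₂x
  rw [uIcc_of_le ht₁1.le] at ht₂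
  obtain ⟨u, v, hu, hud, hv, hvd, hsu, hsv⟩ := exists_sin_inv_eq (infDist_reciprocals_pos hxT)
  have hval : ∀ u, 0 < u → u < infDist x reciprocals → ∃ t ∈ Icc t₁ 1,
      (g t).2 = (g t).1 / 4 * Real.sin u⁻¹ := by
    intro u hu hud
    obtain ⟨t, ht, htu⟩ := isPreconnected_Icc.intermediate_value (s := Icc t₂ 1)
      (right_mem_Icc.2 ht₂.2) (left_mem_Icc.2 ht₂.2)
      (f := fun t => infDist (g t).1 reciprocals)
      ((continuous_infDist_pt reciprocals).comp hg1c).continuousOn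
      (show u ∈ Icc (infDist (g 1).1 reciprocals) (infDist (g t₂).1 reciprocals) by
        rw [hg1, haw, ht₂x, infDist_zero_of_mem haT]
        exact ⟨hu.le, hud.le⟩)
    simp only at htu
    refine ⟨t, ⟨ht₂.1.trans ht.1, ht.2⟩, ?_⟩
    rw [(hgm t).2.2 fun h => hu.ne' (by rw [← htu]; exact infDist_zero_of_mem h), oscillation, htu]
  obtain ⟨s, hs, hs'⟩ := hval u hu hud
  obtain ⟨t, ht, ht'⟩ := hval v hv hvd
  rw [hsu] at hs'
  rw [hsv] at ht'
  have h1 := hnear s hs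
  have h2 := hnear t ht
  simp only [abs_lt] at h1 h2
  linarith

/-- Near the origin both the frontier and the complement coincide with the chain. Its initial pieces
are connected and relatively open, but a path from the origin to (b, 0) with b a reciprocal would
have a first arrival at x = b. -/
theorem separates_f2_g3 : Separates .f2 .g3 := by
  have h0R : ((0, 0) : ℝ × ℝ) ∈ openSquare := by constructor <;> constructor <;> norm_num
  have hmem : ∀ x ∈ reciprocals, 0 ≤ x → (x, 0) ∈ sineChain := fun x hx h =>
    ⟨h, by simp only [abs_zero]; linarith, fun h => absurd hx h⟩
  refine ⟨sineSlit, (0, 0), isOpen_sineSlit, isBounded_sineSlit, simplyConnectedSpace_sineSlit,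
    (mem_frontier_sineSlit h0R).2 (hmem 0 zero_mem_reciprocals le_rfl), ?_, ?_⟩
  · intro r hr
    obtain ⟨ε, hε, hεr, hε1⟩ : ∃ ε : ℝ, 0 < ε ∧ ε ≤ r ∧ ε ≤ 1 :=
      ⟨min r 1, by positivity, min_le_left _ _, min_le_right _ _⟩
    refine ⟨ball (0, 0) ε, isOpen_ball, mem_ball_self hε,
      fun p hp => ball_subset_ball hεr hp.1, ?_⟩
    rw [show ball (0, 0) ε ∩ frontier sineSlit = sineChain ∩ {p | p.1 < ε} from ?_]
    · exact isConnected_sineChain hε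
    ext p
    constructor
    · rintro ⟨h1, h2⟩
      refine ⟨(mem_frontier_sineSlit (ball_subset_openSquare hε1 h1)).1 h2, ?_⟩
      simp only [mem_ball_prod, sub_zero, abs_lt] at h1
      exact h1.1.2
    · rintro ⟨h1, h2 : p.1 < ε⟩
      have h3 : p ∈ ball ((0, 0) : ℝ × ℝ) ε := by
        have h4 := abs_le.1 h1.2.1
        have h5 := h1.1
        simp only [mem_ball_prod, sub_zero, abs_lt]
        refine ⟨⟨?_, ?_⟩, ?_, ?_⟩ <;> linarith
      exact ⟨h3, (mem_frontier_sineSlit (ball_subset_openSquare hε1 h3)).2 h1⟩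
  · intro h
    obtain ⟨A, hAS, hAr, hA, U, hU, hxU, hUA⟩ := h (1 / 2) (by norm_num)
    obtain ⟨η, hη, hηU⟩ := Metric.isOpen_iff.1 hU _ hxU
    have hAC : A ⊆ sineChain := fun p hp => by
      by_contra hc
      exact hAS hp ⟨ball_subset_openSquare (by norm_num) (hAr hp), hc⟩
    have hin : ∀ x ∈ reciprocals, 0 ≤ x → x < η → (x, 0) ∈ A := by
      refine fun x hxT h0 hxη => hUA ⟨hηU ?_, fun h => h.2 (hmem x hxT h0)⟩
      simp only [mem_ball_prod, sub_zero, abs_lt]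
      refine ⟨⟨?_, ?_⟩, ?_, ?_⟩ <;> linarith
    obtain ⟨b, hbT, hb0, hbη⟩ := exists_reciprocal_lt hη
    obtain ⟨γ, hγ⟩ := hA.joinedIn _ (hin 0 zero_mem_reciprocals le_rfl hη) _
      (hin b hbT hb0.le hbη)
    obtain ⟨w, hw, γ', hγ', hr⟩ := exists_path_first_hit
      (isClosed_eq continuous_fst continuous_const : IsClosed {p : ℝ × ℝ | p.1 = b}) γ
      hb0.ne rfl
    obtain ⟨t, ht, htb⟩ := exists_lt_one_fst_eq_of_path γ' (fun t => by
      obtain ⟨s, hs⟩ := hr t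
      rw [← hs]
      exact hAC (hγ s)) hb0 hbT hw
    exact hγ' t ht htb

end Slit

/-! ### A sequence of brooms converging to the boundary point -/

section Brooms

/-- The first coordinate `1 / (n + 1)` of the vertex of the `n`-th broom. -/
noncomputable def node (n : ℕ) : ℝ := 1 / ((n : ℝ) + 1)

theorem node_pos (n : ℕ) : 0 < node n := by unfold node; positivity

theorem node_zero : node 0 = 1 := by simp [node]

theorem strictAnti_node : StrictAnti node := fun m n h => by
  unfold node
  have : (m : ℝ) < n := by exact_mod_cast h
  gcongr

theorem node_le_one (n : ℕ) : node n ≤ 1 := node_zero ▸ strictAnti_node.antitone (Nat.zero_le n)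

/-- Together with `bristle_four_mul_le`, this keeps all bristles below the line y = x/4. -/
theorem node_sub_le (n : ℕ) : node n - node (n + 1) ≤ node (n + 1) := by
  unfold node
  push_cast
  rw [sub_le_iff_le_add, ← add_div, div_le_div_iff₀ (by positivity) (by positivity)]
  nlinarith [n.cast_nonneg (α := ℝ)]

theorem exists_node_lt {ε : ℝ} (hε : 0 < ε) : ∃ n, node n < ε := exists_nat_one_div_lt hε

theorem exists_mem_band {x : ℝ} (h0 : 0 < x) (h1 : x < 1) :
    ∃ n, node (n + 1) ≤ x ∧ x < node n := by
  classical
  have hex : ∃ n, node (n + 1) ≤ x := by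
    obtain ⟨n, hn⟩ := exists_node_lt h0
    exact ⟨n, ((strictAnti_node n.lt_succ_self).trans hn).le⟩
  refine ⟨Nat.find hex, Nat.find_spec hex, ?_⟩
  rcases h : Nat.find hex with _ | m
  · rwa [node_zero]
  · exact not_le.1 (Nat.find_min hex (m := m) (by omega))

theorem le_of_node_lt {m n : ℕ} {x : ℝ} (h1 : node (m + 1) ≤ x) (h2 : x < node n) : n ≤ m :=
  Nat.lt_succ_iff.1 (strictAnti_node.lt_iff_gt.1 (h1.trans_lt h2))

/-- The `k`-th bristle of the `n`-th broom. -/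
def bristle (n k : ℕ) : Set (ℝ × ℝ) :=
  {p | node (n + 1) ≤ p.1 ∧ p.1 ≤ node n ∧ ((k : ℝ) + 4) * p.2 = node n - p.1}

/-- The first axis together with a sequence of brooms. -/
def brooms : Set (ℝ × ℝ) := {p | p.2 = 0 ∨ ∃ n k, p ∈ bristle n k}

theorem isClosed_bristle (n k : ℕ) : IsClosed (bristle n k) := by
  have h1 : IsClosed {p : ℝ × ℝ | node (n + 1) ≤ p.1} := isClosed_le (by fun_prop) (by fun_prop)
  have h2 : IsClosed {p : ℝ × ℝ | p.1 ≤ node n} := isClosed_le (by fun_prop) (by fun_prop)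
  have h3 : IsClosed {p : ℝ × ℝ | ((k : ℝ) + 4) * p.2 = node n - p.1} :=
    isClosed_eq (by fun_prop) (by fun_prop)
  exact h1.inter (h2.inter h3)

theorem bristle_snd_nonneg {n k : ℕ} {p : ℝ × ℝ} (h : p ∈ bristle n k) : 0 ≤ p.2 := by
  obtain ⟨-, h1, h2⟩ := h
  have h3 : 0 ≤ ((k : ℝ) + 4) * p.2 := by linarith
  exact nonneg_of_mul_nonneg_right h3 (by positivity)

theorem bristle_four_mul_le {n k : ℕ} {p : ℝ × ℝ} (h : p ∈ bristle n k) :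
    4 * p.2 ≤ node n - p.1 := by
  have := bristle_snd_nonneg h
  rw [← h.2.2]
  nlinarith [k.cast_nonneg (α := ℝ)]

/-- Bristles accumulate only on the axis: those reaching a given positive height have bounded n and
k. -/
theorem isClosed_brooms : IsClosed brooms := by
  rw [← isOpen_compl_iff, isOpen_iff_mem_nhds]
  intro p hp
  have hp0 : p.2 ≠ 0 := fun h => hp (.inl h)
  rcases lt_or_gt_of_ne hp0 with h0 | h0
  · have : ∀ᶠ q : ℝ × ℝ in 𝓝 p, q.2 < 0 := continuous_snd.continuousAt (gt_mem_nhds h0)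
    filter_upwards [this] with q hq
    rintro (h | ⟨n, k, h⟩)
    · exact hq.ne h
    · exact not_lt.2 (bristle_snd_nonneg h) hq
  · obtain ⟨N, hN⟩ := exists_nat_gt (p.2 / 2)⁻¹
    have hcl : IsClosed (⋃ i ∈ Finset.range N ×ˢ Finset.range N, bristle i.1 i.2) :=
      isClosed_biUnion_finset fun i _ => isClosed_bristle _ _
    have h1 : ∀ᶠ q : ℝ × ℝ in 𝓝 p, p.2 / 2 < q.2 :=
      continuous_snd.continuousAt (lt_mem_nhds (by linarith))
    have h2 := hcl.isOpen_compl.mem_nhds (x := p) (by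
      simp only [mem_compl_iff, mem_iUnion, not_exists]
      exact fun i _ h => hp (.inr ⟨_, _, h⟩))
    have hN' : 1 < N * (p.2 / 2) := by
      rwa [inv_lt_iff_one_lt_mul₀ (by linarith)] at hN
    filter_upwards [h1, h2] with q hq hq'
    rintro (h | ⟨n, k, h⟩)
    · linarith
    · refine hq' ?_
      have hn := node_pos (n + 1)
      have hk : k < N := by
        by_contra! hc
        have : (N : ℝ) ≤ k := by exact_mod_cast hc
        have h3 := h.2.2
        have h4 := node_le_one n
        have h5 := h.1
        nlinarith
      have hn : n < N := by
        by_contra! hc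
        have h3 : (N : ℝ) ≤ n := by exact_mod_cast hc
        have h4 := bristle_four_mul_le h
        have h5 := h.1
        have h6 : node n * (n + 1) = 1 := by
          unfold node
          field_simp
        have h7 : p.2 / 2 < node n := by linarith
        nlinarith
      simp only [mem_iUnion]
      exact ⟨(n, k), by simp [hn, hk], h⟩

theorem dense_compl_brooms : Dense broomsᶜ := by
  intro p
  have hc : {y | (p.1, y) ∈ brooms}.Countable := by
    refine ((countable_singleton 0).union (countable_range
      fun i : ℕ × ℕ => (node i.1 - p.1) / ((i.2 : ℝ) + 4))).mono ?_
    rintro y (h | ⟨n, k, -, -, h⟩)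
    · exact .inl h
    · refine .inr ⟨(n, k), ?_⟩
      simp only at h ⊢
      rw [← h]
      field_simp
  have h1 : p.2 ∈ closure {y | (p.1, y) ∈ brooms}ᶜ := hc.dense_compl ℝ p.2
  have h2 := image_closure_subset_closure_image (f := fun y => (p.1, y)) (by fun_prop)
    (mem_image_of_mem _ h1)
  exact closure_mono (image_subset_iff.2 fun y hy => hy) h2

/-- The open unit square with a sequence of brooms removed. -/
def broomDomain : Set (ℝ × ℝ) := (Ioo 0 1 ×ˢ Ioo 0 1) \ brooms

theorem isOpen_broomDomain : IsOpen broomDomain :=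
  (isOpen_Ioo.prod isOpen_Ioo).sdiff isClosed_brooms

theorem isBounded_broomDomain : Bornology.IsBounded broomDomain :=
  ((isBounded_Ioo _ _).prod (isBounded_Ioo _ _)).subset sdiff_subset

theorem mem_frontier_broomDomain {p : ℝ × ℝ} : p ∈ frontier broomDomain ↔
    (p.1 ∈ Icc (0 : ℝ) 1 ∧ p.2 ∈ Icc (0 : ℝ) 1) ∧ p ∉ broomDomain := by
  rw [broomDomain, frontier_sdiff_of_dense (isOpen_Ioo.prod isOpen_Ioo) isClosed_brooms
    dense_compl_brooms, closure_prod_eq, closure_Ioo zero_ne_one, mem_sdiff, mem_prod]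

theorem bristle_subset_brooms (n k : ℕ) : bristle n k ⊆ brooms := fun _ h => .inr ⟨n, k, h⟩

theorem notMem_broomDomain_of_bristle {n k : ℕ} {p : ℝ × ℝ} (h : p ∈ bristle n k) :
    p ∉ broomDomain := fun hp => hp.2 (bristle_subset_brooms n k h)

theorem mem_bristle_of_notMem_broomDomain {p : ℝ × ℝ} (h : p ∉ broomDomain) (h1 : p.1 ∈ Ioo (0 : ℝ) 1)
    (h2 : p.2 ∈ Ioo (0 : ℝ) 1) : ∃ n k, p ∈ bristle n k := by
  by_contra hc
  refine h ⟨⟨h1, h2⟩, fun hb => hb.elim (fun h => h2.1.ne' h) hc⟩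

/-- The part of the region spanned by the `n`-th broom below its topmost bristle. -/
def broomTriangle (n : ℕ) : Set (ℝ × ℝ) :=
  {p | (node (n + 1) ≤ p.1 ∧ p.1 < node n) ∧ 0 < p.2 ∧ 4 * p.2 < node n - p.1}

/-- The motion of a point towards the left along the ray from the vertex of the `n`-th broom. -/
noncomputable def slide (n : ℕ) (q : (ℝ × ℝ) × ℝ) : ℝ × ℝ :=
  ((1 - q.2) * q.1.1 + q.2 * min q.1.1 (node (n + 1)),
    q.1.2 / (node n - q.1.1) * (node n - ((1 - q.2) * q.1.1 + q.2 * min q.1.1 (node (n + 1)))))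

theorem continuousOn_slide (n : ℕ) : ContinuousOn (slide n) {q | q.1.1 < node n} := by
  refine ContinuousOn.prodMk (by fun_prop) (ContinuousOn.mul (ContinuousOn.div (by fun_prop)
    (by fun_prop) fun q (hq : q.1.1 < node n) => (sub_pos.2 hq).ne') (by fun_prop))

theorem slide_eq_self {n : ℕ} {p : ℝ × ℝ} (h : p.1 ≤ node (n + 1)) (t : ℝ) :
    slide n (p, t) = p := by
  have h1 : p.1 < node n := h.trans_lt (strictAnti_node n.lt_succ_self)
  have h2 : (1 - t) * p.1 + t * min p.1 (node (n + 1)) = p.1 := by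
    rw [min_eq_left h]; ring
  ext
  · exact h2
  · simp only [slide, h2]
    exact div_mul_cancel₀ _ (sub_pos.2 h1).ne'

theorem slide_zero {n : ℕ} {p : ℝ × ℝ} (h : p.1 < node n) : slide n (p, 0) = p := by
  ext
  · simp [slide]
  · simp only [slide, sub_zero, one_mul, zero_mul, add_zero]
    exact div_mul_cancel₀ _ (sub_pos.2 h).ne'

theorem slide_mem {n : ℕ} {p : ℝ × ℝ} (hp : p ∈ broomDomain) (hpn : p ∈ broomTriangle n) {t : ℝ}
    (ht : t ∈ Icc (0 : ℝ) 1) : slide n (p, t) ∈ broomDomain := by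
  obtain ⟨⟨h1, h2⟩, h3, h4⟩ := hpn
  have hpos : 0 < node n - p.1 := sub_pos.2 h2
  set x' := (1 - t) * p.1 + t * min p.1 (node (n + 1)) with hx'
  set σ := p.2 / (node n - p.1) with hσ
  have hσp : σ * (node n - p.1) = p.2 := div_mul_cancel₀ _ hpos.ne'
  have hσ0 : 0 < σ := div_pos h3 hpos
  have hσ4 : 4 * σ < 1 := by
    rw [hσ, ← mul_div_assoc, div_lt_one hpos]; exact h4
  have hs : slide n (p, t) = (x', σ * (node n - x')) := rfl
  rw [min_eq_right h1] at hx'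
  have hxl : node (n + 1) ≤ x' := by
    nlinarith [mul_nonneg (sub_nonneg.2 ht.2) (sub_nonneg.2 h1)]
  have hxr : x' ≤ p.1 := by nlinarith [mul_nonneg ht.1 (sub_nonneg.2 h1)]
  have hn1 := node_pos (n + 1)
  have hx'n : 0 < node n - x' := by linarith
  have hle := node_le_one n
  have hy' : 0 < σ * (node n - x') := mul_pos hσ0 hx'n
  rw [hs]
  refine ⟨⟨⟨by simp only; linarith, by simp only; linarith⟩, hy', by simp only; nlinarith⟩, ?_⟩
  rintro (h | ⟨m, j, hb1, hb2, hb3⟩)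
  · exact hy'.ne' h
  · simp only at hb1 hb2 hb3
    have hj : (0 : ℝ) < (j : ℝ) + 4 := by positivity
    have hnm : n ≤ m := le_of_node_lt hb1 (by linarith)
    have hmn : m ≤ n + 1 := strictAnti_node.le_iff_ge.1 (hxl.trans hb2)
    obtain rfl | rfl : m = n ∨ m = n + 1 := by omega
    · refine hp.2 (.inr ⟨m, j, h1, h2.le, ?_⟩)
      have h5 : ((j : ℝ) + 4) * σ = 1 := by
        have : (((j : ℝ) + 4) * σ) * (node m - x') = 1 * (node m - x') := by linarith
        exact mul_right_cancel₀ hx'n.ne' this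
      rw [← hσp, ← mul_assoc, h5, one_mul]
    · have := mul_pos hj hy'
      linarith

theorem slide_one {n : ℕ} {p : ℝ × ℝ} (h : node (n + 1) ≤ p.1) :
    (slide n (p, 1)).1 = node (n + 1) := by
  simp [slide, min_eq_right h]

/-- The points of `broomDomain` that do not lie below the topmost bristle of a broom. -/
def aboveBrooms : Set (ℝ × ℝ) :=
  {p | p ∈ broomDomain ∧ ∀ n, node (n + 1) < p.1 → p.1 < node n → node n - p.1 < 4 * p.2}

/-- Below the topmost bristle, points slide left along rays from the vertex of the broom. The
bristles lie on such rays too, so none is met before the open left end of the broom. -/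
theorem deformsInto_aboveBrooms : DeformsInto broomDomain broomDomain aboveBrooms := by
  classical
  let H : (ℝ × ℝ) × ℝ → ℝ × ℝ := fun q =>
    if h : ∃ n, q.1 ∈ broomTriangle n then slide h.choose q else q.1
  have hHs : ∀ n p t, p ∈ broomTriangle n → H (p, t) = slide n (p, t) := by
    intro n p t hp
    have hex : ∃ n, p ∈ broomTriangle n := ⟨n, hp⟩
    have heq : hex.choose = n :=
      le_antisymm (le_of_node_lt hp.1.1 hex.choose_spec.1.2) (le_of_node_lt hex.choose_spec.1.1 hp.1.2)
    simp only [H, dif_pos hex, heq]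
  have hHn : ∀ p t, (∀ n, p ∉ broomTriangle n) → H (p, t) = p := fun p t hp =>
    dif_neg (not_exists.2 hp)
  refine .of_continuousOn H ?_ ?_ ?_ ?_ fun p hp => hp.1
  · refine continuousOn_of_locally_continuousOn ?_
    rintro ⟨p, t⟩ ⟨hp, -⟩
    obtain ⟨n, hn1, hn2⟩ := exists_mem_band hp.1.1.1 hp.1.1.2
    have hlt := strictAnti_node (n + 1).lt_succ_self
    rcases lt_trichotomy (4 * p.2) (node n - p.1) with h | h | h
    -- The last inequality excludes the triangle of the next broom, so that left of node (n + 1) the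
    -- motion is constant, as `slide` is there.
    · refine ⟨{q | ((node (n + 2) < q.1.1 ∧ q.1.1 < node n) ∧ 0 < q.1.2) ∧
        4 * q.1.2 < node n - q.1.1 ∧ node (n + 1) - q.1.1 < 4 * q.1.2}, ?_,
        ⟨⟨⟨hlt.trans_le hn1, hn2⟩, hp.1.2.1⟩, h, ?_⟩, ?_⟩
      · have e1 : IsOpen {q : (ℝ × ℝ) × ℝ | node (n + 2) < q.1.1} :=
          isOpen_lt (by fun_prop) (by fun_prop)
        have e2 : IsOpen {q : (ℝ × ℝ) × ℝ | q.1.1 < node n} :=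
          isOpen_lt (by fun_prop) (by fun_prop)
        have e3 : IsOpen {q : (ℝ × ℝ) × ℝ | 0 < q.1.2} := isOpen_lt (by fun_prop) (by fun_prop)
        have e4 : IsOpen {q : (ℝ × ℝ) × ℝ | 4 * q.1.2 < node n - q.1.1} :=
          isOpen_lt (by fun_prop) (by fun_prop)
        have e5 : IsOpen {q : (ℝ × ℝ) × ℝ | node (n + 1) - q.1.1 < 4 * q.1.2} :=
          isOpen_lt (by fun_prop) (by fun_prop)
        exact ((e1.inter e2).inter e3).inter (e4.inter e5)
      · have := hp.1.2.1
        simp only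
        linarith
      · refine ((continuousOn_slide n).mono fun q hq => hq.2.1.1.2).congr ?_
        rintro ⟨q, s⟩ ⟨-, ⟨⟨h1, h2⟩, h3⟩, h4, h5⟩
        simp only at h1 h2 h3 h4 h5
        rcases le_or_gt (node (n + 1)) q.1 with h6 | h6
        · exact hHs n q s ⟨⟨h6, h2⟩, h3, h4⟩
        · rw [slide_eq_self h6.le, hHn]
          rintro m ⟨⟨hm1, hm2⟩, -, hm3⟩
          have e1 := le_of_node_lt hm1 h6
          have e2 := le_of_node_lt h1.le hm2
          obtain rfl : m = n + 1 := by omega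
          linarith
    · exact absurd (.inr ⟨n, 0, hn1, hn2.le, by simpa using h⟩) hp.2
    · refine ⟨{q | (node (n + 2) < q.1.1 ∧ q.1.1 < node n) ∧ node n - q.1.1 < 4 * q.1.2}, ?_,
        ⟨⟨hlt.trans_le hn1, hn2⟩, h⟩, ?_⟩
      · have e1 : IsOpen {q : (ℝ × ℝ) × ℝ | node (n + 2) < q.1.1} :=
          isOpen_lt (by fun_prop) (by fun_prop)
        have e2 : IsOpen {q : (ℝ × ℝ) × ℝ | q.1.1 < node n} :=
          isOpen_lt (by fun_prop) (by fun_prop)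
        have e5 : IsOpen {q : (ℝ × ℝ) × ℝ | node n - q.1.1 < 4 * q.1.2} :=
          isOpen_lt (by fun_prop) (by fun_prop)
        exact (e1.inter e2).inter e5
      · refine continuousOn_fst.congr ?_
        rintro ⟨q, s⟩ ⟨-, ⟨h1, h2⟩, h3⟩
        simp only at h1 h2 h3
        refine hHn q s ?_
        rintro m ⟨⟨hm1, hm2⟩, -, hm3⟩
        have e1 := strictAnti_node.antitone (le_of_node_lt hm1 h2)
        linarith
  · intro p hp t ht
    by_cases h : ∃ n, p ∈ broomTriangle n
    · obtain ⟨n, hn⟩ := h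
      rw [hHs n p t hn]
      exact slide_mem hp hn ht
    · rwa [hHn p t (not_exists.1 h)]
  · intro p hp
    by_cases h : ∃ n, p ∈ broomTriangle n
    · obtain ⟨n, hn⟩ := h
      rw [hHs n p 0 hn, slide_zero hn.1.2]
    · exact hHn p 0 (not_exists.1 h)
  · intro p hp
    by_cases h : ∃ n, p ∈ broomTriangle n
    · obtain ⟨n, hn⟩ := h
      rw [hHs n p 1 hn]
      refine ⟨slide_mem hp hn (by simp), fun m h1 h2 => ?_⟩
      rw [slide_one hn.1.1] at h1 h2
      have e1 := strictAnti_node.lt_iff_gt.1 h1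
      have e2 := strictAnti_node.lt_iff_gt.1 h2
      omega
    · rw [hHn p 1 (not_exists.1 h)]
      refine ⟨hp, fun n h1 h2 => ?_⟩
      by_contra! hc
      rcases hc.eq_or_lt with h3 | h3
      · exact hp.2 (.inr ⟨n, 0, h1.le, h2.le, by simpa using h3⟩)
      · exact h ⟨n, ⟨h1.le, h2⟩, hp.1.2.1, h3⟩

/-- The part of the unit square above the line of slope `1 / 2`. -/
def upperPart : Set (ℝ × ℝ) := (Ioo 0 1 ×ˢ Ioo 0 1) ∩ {p | 1 * p.1 + (-2) * p.2 < 0}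

theorem upperPart_subset : upperPart ⊆ broomDomain := by
  rintro p ⟨hp, h : 1 * p.1 + (-2) * p.2 < 0⟩
  refine ⟨hp, ?_⟩
  have hp2 := hp.2.1
  rintro (h0 | ⟨n, k, hb⟩)
  · exact hp2.ne' h0
  · have h1 := bristle_four_mul_le hb
    have h2 := hb.1
    have h3 := node_sub_le n
    linarith

/-- Points move in the direction (-1, 1) up to the diagonal. This direction is steeper than any
bristle, so points above the topmost bristles stay above them. -/
theorem deformsInto_upperPart : DeformsInto broomDomain aboveBrooms upperPart := by
  refine .of_continuousOn (fun q => (q.1.1 - q.2 * max 0 ((q.1.1 - q.1.2) / 2),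
    q.1.2 + q.2 * max 0 ((q.1.1 - q.1.2) / 2))) (by fun_prop) ?_ (by simp) ?_ upperPart_subset
  · rintro ⟨x, y⟩ ⟨hp, hab⟩ t ht
    obtain ⟨⟨hx0, hx1⟩, hy0, hy1⟩ := hp.1
    simp only at hx0 hx1 hy0 hy1 hab ⊢
    have hm : 0 ≤ max 0 ((x - y) / 2) := le_max_left _ _
    have hl0 : 0 ≤ t * max 0 ((x - y) / 2) := mul_nonneg ht.1 hm
    rcases hl0.eq_or_lt with hl | hl
    · rw [← hl, sub_zero, add_zero]
      exact hp
    have hl1 : t * max 0 ((x - y) / 2) ≤ (x - y) / 2 := by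
      refine (mul_le_of_le_one_left hm ht.2).trans (max_le ?_ le_rfl)
      by_contra! hc
      rw [max_eq_left hc.le, mul_zero] at hl
      exact lt_irrefl _ hl
    set l := t * max 0 ((x - y) / 2)
    refine ⟨⟨⟨?_, ?_⟩, ?_, ?_⟩, ?_⟩
    iterate 4 simp only; linarith
    rintro (h | ⟨m, j, hb⟩)
    · simp only at h; linarith
    · have h1 := bristle_four_mul_le hb
      have h2 := hb.1
      simp only at h1 h2
      rcases le_or_gt (node m) x with h | h
      · linarith
      · have := hab m (by linarith) h
        linarith
  · rintro ⟨x, y⟩ ⟨hp, -⟩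
    obtain ⟨⟨hx0, hx1⟩, hy0, hy1⟩ := hp.1
    simp only at hx0 hx1 hy0 hy1
    rcases le_total 0 ((x - y) / 2) with h | h
    · simp only [max_eq_right h]
      refine ⟨⟨⟨?_, ?_⟩, ?_, ?_⟩, ?_⟩ <;> simp only [mem_ofPred_eq] <;> linarith
    · simp only [max_eq_left h]
      refine ⟨⟨⟨?_, ?_⟩, ?_, ?_⟩, ?_⟩ <;> simp only [mem_ofPred_eq] <;> linarith

theorem simplyConnectedSpace_broomDomain : SimplyConnectedSpace broomDomain := by
  have hc : ((1 / 2, 1 / 2) : ℝ × ℝ) ∈ upperPart := by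
    refine ⟨⟨⟨?_, ?_⟩, ?_, ?_⟩, ?_⟩ <;> norm_num
  have hconv : Convex ℝ upperPart :=
    ((convex_Ioo _ _).prod (convex_Ioo _ _)).inter (convex_setOf_lt _ _ _)
  exact (deformsInto_aboveBrooms.trans (deformsInto_upperPart.trans
    (.of_starConvex (hconv.starConvex hc) hc upperPart_subset))).simplyConnectedSpace

theorem joinedIn_graph {S : Set (ℝ × ℝ)} {f : ℝ → ℝ} (hf : Continuous f) {x x' : ℝ}
    (h : ∀ s ∈ uIcc x x', (s, f s) ∈ S) : JoinedIn S (x, f x) (x', f x') := by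
  have h1 : IsPathConnected ((fun s => (s, f s)) '' uIcc x x') :=
    ((convex_uIcc x x').isPathConnected nonempty_uIcc).image (by fun_prop)
  exact (h1.joinedIn _ ⟨x, left_mem_uIcc, rfl⟩ _ ⟨x', right_mem_uIcc, rfl⟩).mono
    (image_subset_iff.2 h)

theorem axis_notMem_broomDomain (x : ℝ) : (x, 0) ∉ broomDomain := fun h => lt_irrefl _ h.1.2.1

theorem pathConnectedImKleinenAt_frontier_broomDomain :
    PathConnectedImKleinenAt (frontier broomDomain) (0, 0) := by
  intro r hr
  obtain ⟨N, hN⟩ := exists_node_lt (ε := min r 1) (by positivity)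
  obtain ⟨hN, hN1'⟩ := lt_min_iff.1 hN
  have hN0 := node_pos N
  have hN1 := hN1'.le
  -- The last condition drops the left ends of the bristles of the preceding broom, which lie on x =
  -- node N but are attached only at a vertex outside A.
  set A : Set (ℝ × ℝ) := {p | p ∈ frontier broomDomain ∧ p.1 ≤ node N ∧ p.2 ≤ node N ∧
    (p.1 = node N → p.2 = 0)} with hA
  have hax : ∀ x, 0 ≤ x → x ≤ node N → (x, 0) ∈ A := fun x h0 h1 =>
    ⟨mem_frontier_broomDomain.2 ⟨⟨⟨h0, h1.trans hN1⟩, by simp⟩, axis_notMem_broomDomain x⟩,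
      h1, hN0.le, fun _ => rfl⟩
  have hj : ∀ x, 0 ≤ x → x ≤ node N → JoinedIn A (x, 0) (0, 0) := fun x h0 h1 =>
    joinedIn_horizontal fun s hs => by
      rw [uIcc_of_ge h0] at hs
      exact hax s hs.1 (hs.2.trans h1)
  refine ⟨A, fun p hp => hp.1, fun p hp => ?_, isPathConnected_of_joinedIn
    (isPathConnected_singleton ((0, 0) : ℝ × ℝ)) (singleton_subset_iff.2 (hax 0 le_rfl hN0.le))
    fun p hp => ⟨_, rfl, ?_⟩, ball (0, 0) (node N), isOpen_ball, mem_ball_self hN0, fun p hp => ?_⟩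
  · obtain ⟨h1, h2, h3, -⟩ := hp
    obtain ⟨⟨h4, h5⟩, -⟩ := mem_frontier_broomDomain.1 h1
    simp only [mem_ball_prod, sub_zero, abs_lt]
    refine ⟨⟨?_, ?_⟩, ?_, ?_⟩ <;> linarith [h4.1, h5.1]
  · obtain ⟨x, y⟩ := p
    obtain ⟨h1, h2, h3, h6⟩ := hp
    obtain ⟨⟨⟨h4, h4'⟩, h5, h5'⟩, h7⟩ := mem_frontier_broomDomain.1 h1
    simp only at h2 h3 h4 h4' h5 h5' h6
    rcases h5.eq_or_lt with rfl | hy0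
    · exact hj x h4 h2
    rcases h4.eq_or_lt with rfl | hx0
    · refine joinedIn_vertical fun s hs => ?_
      rw [uIcc_of_ge h5] at hs
      exact ⟨mem_frontier_broomDomain.2 ⟨⟨by simp, hs.1, hs.2.trans h5'⟩,
        fun h => lt_irrefl _ h.1.1.1⟩, h2, hs.2.trans h3, fun h => absurd h hN0.ne⟩
    have hxN : x < node N := lt_of_le_of_ne h2 fun h => hy0.ne' (h6 h)
    obtain ⟨n, k, hb⟩ := mem_bristle_of_notMem_broomDomain h7 ⟨hx0, hxN.trans_le hN1⟩
      ⟨hy0, h3.trans_lt hN1'⟩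
    have hNn : node n ≤ node N := strictAnti_node.antitone (le_of_node_lt hb.1 hxN)
    have hk : (0 : ℝ) < (k : ℝ) + 4 := by positivity
    have hxn : x ≤ node n := hb.2.1
    have hyk : y = (node n - x) / ((k : ℝ) + 4) := by
      rw [eq_div_iff hk.ne', mul_comm]; exact hb.2.2
    have h8 : JoinedIn A (x, y) (node n, 0) := by
      have := joinedIn_graph (S := A) (f := fun s => (node n - s) / ((k : ℝ) + 4))
        (by fun_prop) (x := x) (x' := node n) fun s hs => ?_
      · simp only [sub_self, zero_div] at this
        rwa [← hyk] at this
      · rw [uIcc_of_le hxn] at hs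
        have hs0 : 0 ≤ (node n - s) / ((k : ℝ) + 4) := div_nonneg (sub_nonneg.2 hs.2) hk.le
        have hs1 : (node n - s) / ((k : ℝ) + 4) ≤ y := by
          rw [hyk]
          exact div_le_div_of_nonneg_right (by linarith [hs.1]) hk.le
        have hsb : (s, (node n - s) / ((k : ℝ) + 4)) ∈ bristle n k :=
          ⟨hb.1.trans hs.1, hs.2, mul_div_cancel₀ _ hk.ne'⟩
        refine ⟨mem_frontier_broomDomain.2 ⟨⟨⟨h4.trans hs.1, by simp only; linarith [hs.2]⟩, hs0,
          hs1.trans h5'⟩, notMem_broomDomain_of_bristle hsb⟩, hs.2.trans hNn, hs1.trans h3,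
          fun h => ?_⟩
        have h9 : s = node N := h
        have h10 : s = node n := le_antisymm hs.2 (by rw [h9]; exact hNn)
        simp [h10]
    exact h8.trans (hj _ (node_pos n).le hNn)
  · have hb := hp.1
    simp only [mem_ball_prod, sub_zero, abs_lt] at hb
    exact ⟨hp.2, hb.1.2.le, hb.2.2.le, fun h => absurd h hb.1.2.ne⟩

/-- The n-th broom hangs together at its vertex (node n, 0), while its free ends accumulate at (node
(n + 1), 0). If G contains the latter point but not the vertex, a low bristle meets G in a nonempty
clopen part of G ∩ broomDomainᶜ that misses the origin. -/
theorem node_mem_of_isPreconnected {G : Set (ℝ × ℝ)} (hG : IsOpen G) (h0 : (0, 0) ∈ G)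
    (hc : IsPreconnected (G ∩ broomDomainᶜ)) {n : ℕ} (hn : (node (n + 1), 0) ∈ G) :
    (node n, 0) ∈ G := by
  by_contra hnG
  have hlt := strictAnti_node n.lt_succ_self
  have hlt2 := strictAnti_node (n + 1).lt_succ_self
  have hn0 := node_pos (n + 1)
  obtain ⟨η, hη, hηG⟩ := Metric.isOpen_iff.1 hG _ hn
  obtain ⟨k, hk⟩ := exists_nat_gt (1 / η)
  have hk4 : (0 : ℝ) < (k : ℝ) + 4 := by positivity
  have hq : (node (n + 1), (node n - node (n + 1)) / ((k : ℝ) + 4)) ∈ bristle n k :=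
    ⟨le_rfl, hlt.le, mul_div_cancel₀ _ hk4.ne'⟩
  have hqG : (node (n + 1), (node n - node (n + 1)) / ((k : ℝ) + 4)) ∈ G := by
    refine hηG (mem_ball_prod.2 ⟨by simpa using hη, ?_⟩)
    have h1 : 0 ≤ (node n - node (n + 1)) / ((k : ℝ) + 4) := bristle_snd_nonneg hq
    simp only [sub_zero]
    rw [abs_of_nonneg h1, div_lt_iff₀ hk4]
    have h2 := node_le_one n
    rw [div_lt_iff₀ hη] at hk
    nlinarith
  -- The factors k + 5 and k + 3 exclude the neighbouring bristles, whose factors are j + 4 with j =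
  -- k ± 1; the last inequality excludes the next broom.
  set O : Set (ℝ × ℝ) := {p | ((node (n + 2) < p.1 ∧ p.1 < node n) ∧
    (node n - p.1 < ((k : ℝ) + 5) * p.2 ∧ ((k : ℝ) + 3) * p.2 < node n - p.1)) ∧
    node (n + 1) - p.1 < 4 * p.2} with hO
  have hOo : IsOpen O := by
    have e1 : IsOpen {q : ℝ × ℝ | node (n + 2) < q.1} := isOpen_lt (by fun_prop) (by fun_prop)
    have e2 : IsOpen {q : ℝ × ℝ | q.1 < node n} := isOpen_lt (by fun_prop) (by fun_prop)
    have e3 : IsOpen {q : ℝ × ℝ | node n - q.1 < ((k : ℝ) + 5) * q.2} :=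
      isOpen_lt (by fun_prop) (by fun_prop)
    have e4 : IsOpen {q : ℝ × ℝ | ((k : ℝ) + 3) * q.2 < node n - q.1} :=
      isOpen_lt (by fun_prop) (by fun_prop)
    have e5 : IsOpen {q : ℝ × ℝ | node (n + 1) - q.1 < 4 * q.2} :=
      isOpen_lt (by fun_prop) (by fun_prop)
    exact ((e1.inter e2).inter (e3.inter e4)).inter e5
  have hbO : ∀ p ∈ bristle n k, p ∈ G → p ∈ O := by
    rintro ⟨x, y⟩ hp hpG
    have hy := bristle_snd_nonneg hp
    obtain ⟨h1, h2, h3⟩ := hp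
    simp only at h1 h2 h3 hy
    have hxn : x < node n := by
      refine lt_of_le_of_ne h2 ?_
      rintro rfl
      rw [sub_self, mul_eq_zero, or_iff_right hk4.ne'] at h3
      exact hnG (h3 ▸ hpG)
    have hy0 : 0 < y := by
      refine lt_of_le_of_ne hy ?_
      rintro rfl
      rw [mul_zero] at h3
      linarith
    refine ⟨⟨⟨hlt2.trans_le h1, hxn⟩, ?_, ?_⟩, ?_⟩ <;> simp only <;> linarith
  have hOb : ∀ p ∈ O, p ∉ broomDomain → p ∈ bristle n k := by
    rintro ⟨x, y⟩ ⟨⟨⟨h1, h2⟩, h3, h4⟩, h5⟩ hp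
    simp only at h1 h2 h3 h4 h5
    have hy0 : 0 < y := by
      by_contra! hc
      nlinarith
    have hx0 := node_pos (n + 2)
    have hn1 := node_le_one n
    have hk3 : 0 ≤ (k : ℝ) * y := by positivity
    obtain ⟨m, j, hb⟩ := mem_bristle_of_notMem_broomDomain hp
      (show x ∈ Ioo (0 : ℝ) 1 from ⟨by linarith, by linarith⟩)
      (show y ∈ Ioo (0 : ℝ) 1 from ⟨hy0, by linarith⟩)
    have e1 : n ≤ m := le_of_node_lt hb.1 h2
    have e2 : m < n + 2 := strictAnti_node.lt_iff_gt.1 (h1.trans_le hb.2.1)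
    obtain rfl | rfl : m = n ∨ m = n + 1 := by omega
    · have h6 := hb.2.2
      simp only at h6
      have h7 : (j : ℝ) + 4 < (k : ℝ) + 5 := by
        by_contra! hc
        nlinarith
      have h8 : (k : ℝ) + 3 < (j : ℝ) + 4 := by
        by_contra! hc
        nlinarith
      have h9 : j < k + 1 := by
        have : (j : ℝ) < (k : ℝ) + 1 := by linarith
        exact_mod_cast this
      have h10 : k < j + 1 := by
        have : (k : ℝ) < (j : ℝ) + 1 := by linarith
        exact_mod_cast this
      obtain rfl : j = k := by omega
      exact hb
    · have := bristle_four_mul_le hb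
      simp only at this
      linarith
  obtain ⟨z, ⟨-, hz⟩, hzO, hzb⟩ := hc O (bristle n k)ᶜ hOo (isClosed_bristle n k).isOpen_compl
    (fun z hz => by
      by_cases hzb : z ∈ bristle n k
      · exact .inl (hbO z hzb hz.1)
      · exact .inr hzb)
    ⟨_, ⟨hqG, notMem_broomDomain_of_bristle hq⟩, hbO _ hq hqG⟩
    ⟨(0, 0), ⟨h0, axis_notMem_broomDomain 0⟩, fun h => not_lt.2 h.1 hn0⟩
  exact hzb (hOb z hzO hz)

/-- A connected relatively open neighbourhood of the origin contains some vertex, hence by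
descending induction all earlier ones up to (1, 0), and is therefore not small. -/
theorem separates_f3_g2 : Separates .f3 .g2 := by
  refine ⟨broomDomain, (0, 0), isOpen_broomDomain, isBounded_broomDomain,
    simplyConnectedSpace_broomDomain, mem_frontier_broomDomain.2 ⟨by simp,
    axis_notMem_broomDomain 0⟩, pathConnectedImKleinenAt_frontier_broomDomain, fun h => ?_⟩
  obtain ⟨G, hG, h0, hGr, hGc⟩ := h (1 / 2) (by norm_num)
  obtain ⟨η, hη, hηG⟩ := Metric.isOpen_iff.1 hG _ h0
  obtain ⟨n, hn⟩ := exists_node_lt hη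
  have hnG : (node n, 0) ∈ G := by
    refine hηG (mem_ball_prod.2 ⟨?_, by simpa using hη⟩)
    simpa [abs_of_pos (node_pos n)] using hn
  have h1 : (node 0, 0) ∈ G := Nat.decreasingInduction (motive := fun m _ => (node m, 0) ∈ G)
    (fun m _ hm => node_mem_of_isPreconnected hG h0 hGc.isPreconnected hm) hnG (Nat.zero_le n)
  have h2 := hGr ⟨h1, axis_notMem_broomDomain _⟩
  rw [node_zero, mem_ball_prod] at h2
  norm_num at h2

end Brooms

end BoundaryConnectivity

/-! ### The theorem -/

theorem mainTheorem6 :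
    -- all implications of the diagrams hold in every proper locally connected metric space
    (∀ (X : Type*) [MetricSpace X] [ProperSpace X] [LocallyConnectedSpace X]
      (Ω : Set X) (x₀ : X), IsOpen Ω → x₀ ∈ frontier Ω →
      ∀ p q : BoundaryConnectivity.Label, BoundaryConnectivity.Arrow p q →
        BoundaryConnectivity.Holds Ω x₀ p → BoundaryConnectivity.Holds Ω x₀ q) ∧
    -- every implication that does not follow from the diagrams by composing arrows fails for
    -- some bounded simply connected planar domain
    (∀ p q : BoundaryConnectivity.Label,
      ¬ Relation.ReflTransGen BoundaryConnectivity.Arrow p q →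
      ∃ (Ω : Set (EuclideanSpace ℝ (Fin 2))) (x₀ : EuclideanSpace ℝ (Fin 2)),
        IsOpen Ω ∧ Bornology.IsBounded Ω ∧ SimplyConnectedSpace Ω ∧ x₀ ∈ frontier Ω ∧
        BoundaryConnectivity.Holds Ω x₀ p ∧ ¬ BoundaryConnectivity.Holds Ω x₀ q) := by
  refine ⟨fun X _ _ _ Ω x₀ hΩ hx p q hpq hp => hp.of_arrow hΩ hx hpq, fun p q hpq => ?_⟩
  obtain ⟨p₀, q₀, hmem, hp, hq⟩ := BoundaryConnectivity.exists_separating_pair hpq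
  have hsep : BoundaryConnectivity.Separates p₀ q₀ ∧ p₀ ≠ .c ∧ q₀ ≠ .c := by
    simp only [mem_insert_iff, mem_singleton_iff, Prod.mk.injEq] at hmem
    rcases hmem with h | h | h | h | h | h | h <;> obtain ⟨rfl, rfl⟩ := h
    · exact ⟨BoundaryConnectivity.separates_f1_a, by simp, by simp⟩
    · exact ⟨BoundaryConnectivity.separates_e_g4, by simp, by simp⟩
    · exact ⟨BoundaryConnectivity.separates_d_e, by simp, by simp⟩
    · exact ⟨BoundaryConnectivity.separates_a_d, by simp, by simp⟩
    · exact ⟨BoundaryConnectivity.separates_f2_g3, by simp, by simp⟩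
    · exact ⟨BoundaryConnectivity.separates_f3_g2, by simp, by simp⟩
    · exact ⟨BoundaryConnectivity.separates_g1_f4, by simp, by simp⟩
  exact hsep.1.euclidean hsep.2.1 hsep.2.2 hp hq
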